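/- Let $(M,\tau)$ be a Real manifold, i.e. a finite-dimensional smooth manifold with a smooth involution $\tau$. A Real bundle gerbe $(P,Y)$ over $M$ consists of a surjective submersion $\pi\colon Y\to M$, a principal $U(1)$-bundle $P\to Y^{[2]}=Y\times_M Y$ with a smooth associative multiplication $P_{(y_1,y_2)}\otimes P_{(y_2,y_3)}\to P_{(y_1,y_3)}$, an involution $\tau_Y$ of $Y$ covering $\tau$, and an involution $\tau_P$ of $P$ covering the induced involution of $Y^{[2]}$, with $\tau_P(pz)=\tau_P(p)\bar z$ for $z\in U(1)$, commuting with the multiplication. A Real bundle gerbe module is a finite-rank complex vector bundle $E\to Y$ with an antilinear involution $\tau_E$ covering $\tau_Y$ and isomorphisms $P_{(y_1,y_2)}\otimes E_{y_2}\simeq E_{y_1}$ that are associative with respect to the multiplication of $P$ and commute with the Real structures. Let $\mathrm{Mod}_R(P,Y)$ be the semigroup, under direct sum, of isomorphism classes of Real bundle gerbe modules, and $\mathrm{Vect}_R(M)$ the semigroup of isomorphism classes of Real vector bundles on $M$ in the sense of Atiyah, i.e. complex vector bundles with an antilinear involution covering $\tau$. Ranks are locally constant. All vector bundles, their Real structures,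 actions and isomorphisms are taken to be of class $C^k$ for a fixed $k\in\{0,1,\dots,\infty\}$. (1) Let $(P,Y)$ and $(Q,X)$ be Real bundle gerbes over $M$. A Real stable isomorphism $(P,Y)\to(Q,X)$, that is, a principal $U(1)$-bundle $R\to Y\times_M X$ with a conjugate involution covering that of $Y\times_M X$ and an isomorphism of Real bundle gerbes $Q\otimes P^*\simeq\delta R$, i.e. isomorphisms $P_{(y_1,y_2)}\otimes R_{(y_2,x_2)}\simeq R_{(y_1,x_1)}\otimes Q_{(x_1,x_2)}$ compatible with multiplications and Real structures, induces an isomorphism of semigroups $\mathrm{Mod}_R(P,Y)\to\mathrm{Mod}_R(Q,X)$. It sends $[E]$ to $[F]$ if and only if there is an isomorphism $R_{(y,x)}\otimes F_x\simeq E_y$ over $Y\times_M X$ compatible with the actions of $P$ and $Q$ and with the Real structures. (2) A Real trivialisation of $(P,Y)$, that is, a principal $U(1)$-bundle $R\to Y$ with a conjugate involution covering $\tau_Y$ and an isomorphism of Real bundle gerbes $P\simeq\delta R$, where $(\delta R)_{(y_1,y_2)}=R_{y_1}^*\otimes R_{y_2}$, induces an isomorphism of semigroups $\mathrm{Mod}_R(P,Y)\to\mathrm{Vect}_R(M)$.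 It sends $[E]$ to $[F]$ if and only if there is an isomorphism $R_y\otimes E_y\simeq F_{\pi(y)}$ over $Y$ compatible with the action of $P$ and with the Real structures. Suppose moreover that $M$ is compact, let $KR_{\mathrm{bg}}(M,P)$ be the Grothendieck group of $\mathrm{Mod}_R(P,Y)$ and $KR(M)$ that of $\mathrm{Vect}_R(M)$. Then a Real stable isomorphism $(P,Y)\to(Q,X)$ induces an isomorphism $KR_{\mathrm{bg}}(M,P)\simeq KR_{\mathrm{bg}}(M,Q)$ extending that of (1); if $(P,Y)$ and $(Q,X)$ have the same Real Dixmier--Douady class in $H^2(M;\mathbb Z_2,\overline{\mathcal U(1)})$, then $KR_{\mathrm{bg}}(M,P)\simeq KR_{\mathrm{bg}}(M,Q)$; and a Real trivialisation of $(P,Y)$ induces an isomorphism $KR_{\mathrm{bg}}(M,P)\simeq KR(M)$ extending that of (2). Here $H^2(M;\mathbb Z_2,\overline{\mathcal U(1)})$ is the limit over Real open covers (indexed by a set with a free involution $\alpha\mapsto\bar\alpha$, $\tau(U_\alpha)=U_{\bar\alpha}$) of the \v{C}ech cohomology of cochains with $g_{\bar\alpha_0\cdots\bar\alpha_p}\circ\tau=\bar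 g_{\alpha_0\cdots\alpha_p}$, and the class of $(P,Y)$ is represented by $g_{\alpha\beta\gamma}$ where $\sigma_{\alpha\beta}\sigma_{\beta\gamma}=\sigma_{\alpha\gamma}g_{\alpha\beta\gamma}$ for sections $s_\alpha$ of $Y$ over $U_\alpha$ and $\sigma_{\alpha\beta}$ of $(s_\alpha,s_\beta)^{-1}P$ that commute with the Real structures. -/

import Mathlib

open scoped Manifold ContDiff Topology

universe u u' w w' v

noncomputable section

namespace RealGerbe

/-! ## Real manifolds -/

section Involution

variable {E H : Type*} [NormedAddCommGroup E] [NormedSpace ℝ E] [TopologicalSpace H]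

/-- A smooth involution of a manifold `N`; the pair is a Real manifold. -/
structure SmoothInvolution (I : ModelWithCorners ℝ E H) (N : Type*) [TopologicalSpace N]
    [ChartedSpace H N] where
  toFun : N → N
  invol : ∀ n, toFun (toFun n) = n
  smooth : ContMDiff I I ∞ toFun

instance (I : ModelWithCorners ℝ E H) (N : Type*) [TopologicalSpace N] [ChartedSpace H N] :
    CoeFun (SmoothInvolution I N) (fun _ => N → N) := ⟨SmoothInvolution.toFun⟩

end Involution

/-! ## Principal `U(1)`-bundles over a subset of a manifold

The base is a subset `S` of a manifold `N`. It is used for `S` all of `N`, and for the fibre products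
`Y ×_M X` inside `Y × X`, which are embedded submanifolds because `Y → M` is a submersion. A function
on such a submanifold is smooth if and only if it is smooth within the subset, in the sense of
`ContMDiffWithinAt`, at each of its points. -/

section CircleBundles

variable {E H : Type*} [NormedAddCommGroup E] [NormedSpace ℝ E] [TopologicalSpace H]
  {N : Type*} [TopologicalSpace N] [ChartedSpace H N]

/-- A family of `U(1)`-torsors over `S`, with a family of local sections: `sec a` is a section near
the point `a`, of which only the values on the open set `dom a` matter. -/
structure PreCircleBundle (S : Set N) where
  fiber : S → Type w
  [mulAction : ∀ s, MulAction Circle (fiber s)]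
  torsor : ∀ (s : S) (p q : fiber s), ∃! z : Circle, z • p = q
  dom : S → Set N
  isOpen_dom : ∀ a, IsOpen (dom a)
  mem_dom : ∀ a : S, a.1 ∈ dom a
  sec : S → ∀ s : S, fiber s

attribute [instance] PreCircleBundle.mulAction

/-- `σ` is a section of `L` along the map `f : A → S`, where `A` is a subset of a manifold `T`. It is
smooth if its quotient by each of the given local sections is a smooth function to `U(1)`. -/
def PreCircleBundle.IsSmoothAlong {S : Set N} (L : PreCircleBundle.{w} S)
    {E' H' : Type*} [NormedAddCommGroup E'] [NormedSpace ℝ E'] [TopologicalSpace H']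
    (J : ModelWithCorners ℝ E' H') {T : Type*} [TopologicalSpace T] [ChartedSpace H' T]
    (A : Set T) (f : T → N) (hf : ∀ t ∈ A, f t ∈ S)
    (σ : ∀ (t : T) (ht : t ∈ A), L.fiber ⟨f t, hf t ht⟩) : Prop :=
  ∀ (a : S) (t₀ : T), t₀ ∈ A → f t₀ ∈ L.dom a →
    ∃ g : T → Circle, ContMDiffWithinAt J 𝓘(ℝ, ℂ) ∞ (fun t => (g t : ℂ)) A t₀ ∧
      ∀ᶠ t in 𝓝[A] t₀, ∀ ht : t ∈ A, σ t ht = g t • L.sec a ⟨f t, hf t ht⟩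

/-- A smooth principal `U(1)`-bundle: the transition functions between the local sections are
smooth. -/
structure CircleBundle (I : ModelWithCorners ℝ E H) (S : Set N) extends
    PreCircleBundle.{w} S where
  sec_smooth : ∀ b : S, toPreCircleBundle.IsSmoothAlong I (S ∩ dom b) (fun n => n)
    (fun _ h => h.1) (fun n h => sec b ⟨n, h.1⟩)

/-- A Real structure on a `U(1)`-bundle covering the map `t`: a smooth conjugate involution. The map
from the fibre at `s` to the fibre at `t s` is written as a map to the fibre at `s'`, for every `s'`
that equals `t s`. -/
structure CircleBundle.RealStructure {I : ModelWithCorners ℝ E H} {S : Set N}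
    (L : CircleBundle.{w} I S) (t : N → N) where
  maps : ∀ n ∈ S, t n ∈ S
  tau : ∀ s s' : S, s'.1 = t s.1 → L.fiber s → L.fiber s'
  tau_smul : ∀ s s' h (z : Circle) (p : L.fiber s), tau s s' h (z • p) = z⁻¹ • tau s s' h p
  tau_tau : ∀ s s' h h' (p : L.fiber s), tau s' s h' (tau s s' h p) = p
  tau_smooth : ∀ b : S, L.IsSmoothAlong I (S ∩ L.dom b) t (fun n h => maps n h.1)
    (fun n h => tau ⟨n, h.1⟩ ⟨t n, maps n h.1⟩ rfl (L.sec b ⟨n, h.1⟩))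

end CircleBundles

/-! ## Complex and Real vector bundles

Vector bundles have finite rank, which is locally constant but may differ from one component of the
base to another. The class of differentiability is a parameter `k`: for `k = ∞` the bundles are smooth
and for `k = 0` they are topological vector bundles. -/

section VectorBundles

variable {E H : Type*} [NormedAddCommGroup E] [NormedSpace ℝ E] [TopologicalSpace H]
  {N : Type*} [TopologicalSpace N] [ChartedSpace H N]

/-- A family of complex vector spaces with a family of local frames: `frame a` is a frame on the open
neighbourhood `dom a` of `a`. -/
structure PreVectorBundle (N : Type*) [TopologicalSpace N] where
  fiber : N → Type v
  [addCommGroup : ∀ n, AddCommGroup (fiber n)]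
  [module : ∀ n, Module ℂ (fiber n)]
  dom : N → Set N
  isOpen_dom : ∀ a, IsOpen (dom a)
  mem_dom : ∀ a, a ∈ dom a
  idx : N → Type
  [fintype : ∀ a, Fintype (idx a)]
  frame : ∀ a n, n ∈ dom a → Module.Basis (idx a) ℂ (fiber n)

attribute [instance] PreVectorBundle.addCommGroup PreVectorBundle.module PreVectorBundle.fintype

/-- `σ` is a section of `V` along the map `f : A → N`, where `A` is a subset of a manifold `T`. It is
of class `C^k` if its coefficients in each of the given local frames are of class `C^k`. -/
def PreVectorBundle.IsSmoothAlong (V : PreVectorBundle.{v} N) (k : ℕ∞)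
    {E' H' : Type*} [NormedAddCommGroup E'] [NormedSpace ℝ E'] [TopologicalSpace H']
    (J : ModelWithCorners ℝ E' H') {T : Type*} [TopologicalSpace T] [ChartedSpace H' T]
    (A : Set T) (f : T → N) (σ : ∀ t ∈ A, V.fiber (f t)) : Prop :=
  ∀ (a : N) (t₀ : T), t₀ ∈ A → f t₀ ∈ V.dom a →
    ∃ c : V.idx a → T → ℂ, (∀ i, ContMDiffWithinAt J 𝓘(ℝ, ℂ) k (c i) A t₀) ∧
      ∀ᶠ t in 𝓝[A] t₀, ∀ (ht : t ∈ A) (hd : f t ∈ V.dom a),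
        σ t ht = ∑ i, c i t • V.frame a (f t) hd i

/-- A complex vector bundle of class `C^k`: the transition functions are of class `C^k`. -/
structure VectorBundle (k : ℕ∞) (I : ModelWithCorners ℝ E H) (N : Type*) [TopologicalSpace N]
    [ChartedSpace H N] extends PreVectorBundle.{v} N where
  frame_smooth : ∀ b j, toPreVectorBundle.IsSmoothAlong k I (dom b) (fun n => n)
    (fun n h => frame b n h j)

/-- A Real vector bundle in the sense of Atiyah over the Real manifold `(N, t)`: a complex vector bundle
with an antilinear involution covering `t`. The map from the fibre at `n` to the fibre at `t n` is written
as a map to the fibre at `n'`, for every `n'` that equals `t n`. -/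
structure RealVectorBundle (k : ℕ∞) {I : ModelWithCorners ℝ E H} (t : SmoothInvolution I N)
    extends VectorBundle.{v} k I N where
  tau : ∀ n n' : N, n' = t n → (fiber n →ₛₗ[starRingEnd ℂ] fiber n')
  tau_tau : ∀ n n' h h' (x : fiber n), tau n' n h' (tau n n' h x) = x
  tau_smooth : ∀ b j, toPreVectorBundle.IsSmoothAlong k I (dom b) t
    (fun n h => tau n (t n) rfl (frame b n h j))

/-- An isomorphism of Real vector bundles. -/
structure RealVectorBundle.Iso {k : ℕ∞} {I : ModelWithCorners ℝ E H} {t : SmoothInvolution I N}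
    (V W : RealVectorBundle.{v} k t) where
  equiv : ∀ n, V.fiber n ≃ₗ[ℂ] W.fiber n
  smooth : ∀ b j, W.IsSmoothAlong k I (V.dom b) (fun n => n)
    (fun n h => equiv n (V.frame b n h j))
  symm_smooth : ∀ b j, V.IsSmoothAlong k I (W.dom b) (fun n => n)
    (fun n h => (equiv n).symm (W.frame b n h j))
  map_tau : ∀ n n' h (x : V.fiber n), equiv n' (V.tau n n' h x) = W.tau n n' h (equiv n x)

/-! ### Direct sums of vector bundles -/

namespace PreVectorBundle

variable {E' H' : Type*} [NormedAddCommGroup E'] [NormedSpace ℝ E'] [TopologicalSpace H']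
  {J : ModelWithCorners ℝ E' H'} {T : Type*} [TopologicalSpace T] [ChartedSpace H' T]
  {k : ℕ∞}

theorem IsSmoothAlong.mono {V : PreVectorBundle.{v} N} {A B : Set T} {f : T → N}
    {σ : ∀ t ∈ A, V.fiber (f t)} (hσ : V.IsSmoothAlong k J A f σ) (hBA : B ⊆ A) :
    V.IsSmoothAlong k J B f (fun t ht => σ t (hBA ht)) := by
  intro a t₀ ht₀ hd
  obtain ⟨c, hc, he⟩ := hσ a t₀ (hBA ht₀) hd
  refine ⟨c, fun i => (hc i).mono hBA, ?_⟩
  filter_upwards [nhdsWithin_mono t₀ hBA he] with t ht hB hd'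
  exact ht (hBA hB) hd'

theorem isSmoothAlong_zero (V : PreVectorBundle.{v} N) (A : Set T) (f : T → N) :
    V.IsSmoothAlong k J A f (fun _ _ => 0) := by
  intro a t₀ _ _
  exact ⟨fun _ _ => 0, fun _ => contMDiffWithinAt_const, by simp⟩

/-- The zero vector bundle. -/
def zero (N : Type*) [TopologicalSpace N] : PreVectorBundle.{v} N where
  fiber _ := PUnit
  dom _ := Set.univ
  isOpen_dom _ := isOpen_univ
  mem_dom _ := trivial
  idx _ := Empty
  frame _ _ _ := Module.Basis.empty _

theorem zero_isSmoothAlong (A : Set T) (f : T → N) (σ : ∀ t ∈ A, (zero.{v} N).fiber (f t)) :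
    (zero.{v} N).IsSmoothAlong k J A f σ := by
  intro a t₀ _ _
  refine ⟨fun _ _ => 0, fun _ => contMDiffWithinAt_const, ?_⟩
  exact Filter.Eventually.of_forall fun t _ _ => @Subsingleton.elim PUnit _ _ _

/-- The direct sum. -/
def sum (V W : PreVectorBundle.{v} N) : PreVectorBundle.{v} N where
  fiber n := V.fiber n × W.fiber n
  dom a := V.dom a ∩ W.dom a
  isOpen_dom a := (V.isOpen_dom a).inter (W.isOpen_dom a)
  mem_dom a := ⟨V.mem_dom a, W.mem_dom a⟩
  idx a := V.idx a ⊕ W.idx a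
  frame a n h := (V.frame a n h.1).prod (W.frame a n h.2)

/-- A bundle map that sends local frames to `C^k` sections sends `C^k` sections to `C^k` sections. -/
theorem isSmoothAlong_comp (V W : PreVectorBundle.{v} N) {I : ModelWithCorners ℝ E H}
    (φ : ∀ n, V.fiber n →ₗ[ℂ] W.fiber n)
    (hφ : ∀ b j, W.IsSmoothAlong k I (V.dom b) (fun n => n) (fun n h => φ n (V.frame b n h j)))
    {A : Set N} {σ : ∀ n ∈ A, V.fiber n} (hσ : V.IsSmoothAlong k I A (fun n => n) σ) :
    W.IsSmoothAlong k I A (fun n => n) (fun n h => φ n (σ n h)) := by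
  intro a t₀ ht₀ hd
  obtain ⟨c, hc, hce⟩ := hσ t₀ t₀ ht₀ (V.mem_dom t₀)
  choose d hdd hde using fun j => hφ t₀ j a t₀ (V.mem_dom t₀) hd
  have hopen : V.dom t₀ ∈ 𝓝 t₀ := (V.isOpen_dom t₀).mem_nhds (V.mem_dom t₀)
  refine ⟨fun i t => ∑ j, c j t * d j i t, fun i => ?_, ?_⟩
  · refine contMDiffWithinAt_finsetSum fun j _ => ?_
    have h2 : ContMDiffWithinAt I 𝓘(ℝ, ℂ) k (d j i) A t₀ :=
      ((hdd j i).contMDiffAt hopen).contMDiffWithinAt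
    exact (contDiff_mul.contMDiff.contMDiffAt).comp_contMDiffWithinAt t₀ ((hc j).prodMk_space h2)
  · have hde' : ∀ᶠ t in 𝓝[A] t₀, ∀ j, ∀ (ht : t ∈ V.dom t₀) (hd : t ∈ W.dom a),
        φ t (V.frame t₀ t ht j) = ∑ i, d j i t • W.frame a t hd i := by
      rw [Filter.eventually_all]
      intro j
      have := hde j
      rw [nhdsWithin_eq_nhds.2 hopen] at this
      exact nhdsWithin_le_nhds this
    filter_upwards [hce, hde', nhdsWithin_le_nhds hopen] with t h1 h2 h3 hA hW
    rw [h1 hA h3, map_sum]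
    simp only [map_smul, h2 _ h3 hW, Finset.smul_sum, Finset.sum_smul, smul_smul]
    exact Finset.sum_comm

theorem IsSmoothAlong.pair {V W : PreVectorBundle.{v} N} {A : Set T} {f : T → N}
    {σ : ∀ t ∈ A, V.fiber (f t)} {ρ : ∀ t ∈ A, W.fiber (f t)}
    (hσ : V.IsSmoothAlong k J A f σ) (hρ : W.IsSmoothAlong k J A f ρ) :
    (V.sum W).IsSmoothAlong k J A f (fun t ht => (σ t ht, ρ t ht)) := by
  intro a t₀ ht₀ hd
  obtain ⟨c, hc, hce⟩ := hσ a t₀ ht₀ hd.1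
  obtain ⟨d, hd', hde⟩ := hρ a t₀ ht₀ hd.2
  refine ⟨Sum.elim c d, ?_, ?_⟩
  · rintro (i | i)
    · exact hc i
    · exact hd' i
  · filter_upwards [hce, hde] with t h1 h2 hA hD
    rw [h1 hA hD.1, h2 hA hD.2]
    refine Eq.trans ?_ (Fintype.sum_sum_type (α₁ := V.idx a) (α₂ := W.idx a)
      (fun i => (Sum.elim c d i t • (((V.frame a (f t) hD.1).prod (W.frame a (f t) hD.2)) i) :
        V.fiber (f t) × W.fiber (f t)))).symm
    refine Prod.ext ?_ ?_
    · simp [Prod.fst_sum]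
    · simp [Prod.snd_sum]

theorem IsSmoothAlong.congr {V : PreVectorBundle.{v} N} {A : Set T} {f : T → N}
    {σ ρ : ∀ t ∈ A, V.fiber (f t)} (hσ : V.IsSmoothAlong k J A f σ)
    (h : ∀ t ht, ρ t ht = σ t ht) : V.IsSmoothAlong k J A f ρ := by
  have : ρ = σ := by funext t ht; exact h t ht
  rwa [this]

theorem sum_frame_inl (V W : PreVectorBundle.{v} N) (a n : N) (h : n ∈ (V.sum W).dom a)
    (j : V.idx a) : (V.sum W).frame a n h (Sum.inl j) = (V.frame a n h.1 j, 0) :=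
  Prod.ext (Module.Basis.prod_apply_inl_fst _ _ _) (Module.Basis.prod_apply_inl_snd _ _ _)

theorem sum_frame_inr (V W : PreVectorBundle.{v} N) (a n : N) (h : n ∈ (V.sum W).dom a)
    (j : W.idx a) : (V.sum W).frame a n h (Sum.inr j) = (0, W.frame a n h.2 j) :=
  Prod.ext (Module.Basis.prod_apply_inr_fst _ _ _) (Module.Basis.prod_apply_inr_snd _ _ _)

/-- To check that the images of the local frames of a direct sum are `C^k`, it suffices to check it on
both summands. -/
theorem sum_desc (U V W : PreVectorBundle.{v} N) {I : ModelWithCorners ℝ E H} {f : N → N}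
    (φ : ∀ n, V.fiber n × W.fiber n → U.fiber (f n)) (b : N)
    (h₁ : ∀ j, U.IsSmoothAlong k I (V.dom b) f (fun n h => φ n (V.frame b n h j, 0)))
    (h₂ : ∀ j, U.IsSmoothAlong k I (W.dom b) f (fun n h => φ n (0, W.frame b n h j)))
    (j : V.idx b ⊕ W.idx b) :
    U.IsSmoothAlong k I (V.dom b ∩ W.dom b) f
      (fun n h => φ n ((V.sum W).frame b n h j)) := by
  rcases j with j | j
  · exact ((h₁ j).mono Set.inter_subset_left).congr
      fun n h => congrArg (φ n) (sum_frame_inl V W b n h j)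
  · exact ((h₂ j).mono Set.inter_subset_right).congr
      fun n h => congrArg (φ n) (sum_frame_inr V W b n h j)

end PreVectorBundle

namespace RealVectorBundle

open PreVectorBundle

variable {k : ℕ∞} {I : ModelWithCorners ℝ E H} {t : SmoothInvolution I N}

/-- The zero Real vector bundle. -/
def zero (k : ℕ∞) (t : SmoothInvolution I N) : RealVectorBundle.{v} k t where
  toPreVectorBundle := PreVectorBundle.zero N
  frame_smooth _ j := Empty.elim j
  tau _ _ _ := 0
  tau_tau _ _ _ _ _ := rfl
  tau_smooth _ j := Empty.elim j

/-- The direct sum of Real vector bundles. -/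
def sum (V W : RealVectorBundle.{v} k t) : RealVectorBundle.{v} k t where
  toPreVectorBundle := V.toPreVectorBundle.sum W.toPreVectorBundle
  frame_smooth b := sum_desc (V.toPreVectorBundle.sum W.toPreVectorBundle) V.toPreVectorBundle
    W.toPreVectorBundle (f := fun n => n) (fun _ x => x) b
    (fun j => (V.frame_smooth b j).pair (isSmoothAlong_zero _ _ _))
    (fun j => (isSmoothAlong_zero _ _ _).pair (W.frame_smooth b j))
  tau n n' h :=
    { toFun := fun x => (V.tau n n' h x.1, W.tau n n' h x.2)
      map_add' := fun _ _ => Prod.ext (map_add (V.tau n n' h) _ _) (map_add (W.tau n n' h) _ _)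
      map_smul' := fun z x => Prod.ext (map_smulₛₗ (V.tau n n' h) z x.1)
        (map_smulₛₗ (W.tau n n' h) z x.2) }
  tau_tau n n' h h' x := Prod.ext (V.tau_tau n n' h h' x.1) (W.tau_tau n n' h h' x.2)
  tau_smooth b := sum_desc (V.toPreVectorBundle.sum W.toPreVectorBundle) V.toPreVectorBundle
    W.toPreVectorBundle (f := t)
    (fun n x => (V.tau n (t n) rfl x.1, W.tau n (t n) rfl x.2)) b
    (fun j => ((V.tau_smooth b j).pair (isSmoothAlong_zero _ _ _)).congr
      fun n _ => Prod.ext rfl (map_zero (W.tau n (t n) rfl)))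
    (fun j => ((isSmoothAlong_zero _ _ _).pair (W.tau_smooth b j)).congr
      fun n _ => Prod.ext (map_zero (V.tau n (t n) rfl)) rfl)

namespace Iso

/-- The identity. -/
def refl (V : RealVectorBundle.{v} k t) : Iso V V where
  equiv _ := LinearEquiv.refl ℂ _
  smooth := V.frame_smooth
  symm_smooth := V.frame_smooth
  map_tau _ _ _ _ := rfl

/-- The inverse. -/
def symm {V W : RealVectorBundle.{v} k t} (φ : Iso V W) : Iso W V where
  equiv n := (φ.equiv n).symm
  smooth := φ.symm_smooth
  symm_smooth := φ.smooth
  map_tau n n' h x := by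
    rw [LinearEquiv.symm_apply_eq, φ.map_tau, LinearEquiv.apply_symm_apply]

/-- The composition. -/
def trans {U V W : RealVectorBundle.{v} k t} (φ : Iso U V) (ψ : Iso V W) : Iso U W where
  equiv n := (φ.equiv n).trans (ψ.equiv n)
  smooth b j := PreVectorBundle.isSmoothAlong_comp _ _ (fun n => (ψ.equiv n).toLinearMap) ψ.smooth
    (φ.smooth b j)
  symm_smooth b j := PreVectorBundle.isSmoothAlong_comp _ _
    (fun n => (φ.equiv n).symm.toLinearMap) φ.symm_smooth (ψ.symm_smooth b j)
  map_tau n n' h x := by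
    simp [φ.map_tau, ψ.map_tau]

theorem sumCongr_smooth (V V' W W' : PreVectorBundle.{v} N)
    (φ : ∀ n, V.fiber n →ₗ[ℂ] V'.fiber n) (ψ : ∀ n, W.fiber n →ₗ[ℂ] W'.fiber n)
    (hφ : ∀ b j, V'.IsSmoothAlong k I (V.dom b) (fun n => n) (fun n h => φ n (V.frame b n h j)))
    (hψ : ∀ b j, W'.IsSmoothAlong k I (W.dom b) (fun n => n) (fun n h => ψ n (W.frame b n h j)))
    (b : N) : ∀ j : V.idx b ⊕ W.idx b,
    (V'.sum W').IsSmoothAlong k I (V.dom b ∩ W.dom b) (fun n => n)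
      (fun n h => (φ n ((V.sum W).frame b n h j).1, ψ n ((V.sum W).frame b n h j).2)) :=
  sum_desc (V'.sum W') V W (fun n x => (φ n x.1, ψ n x.2)) b
    (fun j => ((hφ b j).pair (isSmoothAlong_zero _ _ _)).congr
      fun n _ => Prod.ext rfl (map_zero (ψ n)))
    (fun j => ((isSmoothAlong_zero _ _ _).pair (hψ b j)).congr
      fun n _ => Prod.ext (map_zero (φ n)) rfl)

/-- The direct sum of two isomorphisms. -/
def sumCongr {V V' W W' : RealVectorBundle.{v} k t} (φ : Iso V V') (ψ : Iso W W') :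
    Iso (V.sum W) (V'.sum W') where
  equiv n := (φ.equiv n).prodCongr (ψ.equiv n)
  smooth := sumCongr_smooth _ _ _ _ (fun n => (φ.equiv n).toLinearMap)
    (fun n => (ψ.equiv n).toLinearMap) φ.smooth ψ.smooth
  symm_smooth := sumCongr_smooth _ _ _ _ (fun n => (φ.equiv n).symm.toLinearMap)
    (fun n => (ψ.equiv n).symm.toLinearMap) φ.symm_smooth ψ.symm_smooth
  map_tau n n' h x := Prod.ext (φ.map_tau n n' h x.1) (ψ.map_tau n n' h x.2)

theorem sumComm_smooth (V W : RealVectorBundle.{v} k t) (b : N) : ∀ j : V.idx b ⊕ W.idx b,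
    (W.sum V).IsSmoothAlong k I (V.dom b ∩ W.dom b) (fun n => n)
      (fun n h => Prod.swap ((V.sum W).frame b n h j)) :=
  sum_desc (W.sum V).toPreVectorBundle V.toPreVectorBundle W.toPreVectorBundle
    (fun _ x => x.swap) b
    (fun j => (isSmoothAlong_zero _ _ _).pair (V.frame_smooth b j))
    (fun j => (W.frame_smooth b j).pair (isSmoothAlong_zero _ _ _))

/-- The direct sum is commutative. -/
def sumComm (V W : RealVectorBundle.{v} k t) : Iso (V.sum W) (W.sum V) where
  equiv n := LinearEquiv.prodComm ℂ (V.fiber n) (W.fiber n)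
  smooth := sumComm_smooth V W
  symm_smooth := sumComm_smooth W V
  map_tau _ _ _ _ := rfl

/-- The direct sum is associative. -/
def sumAssoc (U V W : RealVectorBundle.{v} k t) :
    Iso ((U.sum V).sum W) (U.sum (V.sum W)) where
  equiv n := LinearEquiv.prodAssoc ℂ (U.fiber n) (V.fiber n) (W.fiber n)
  smooth b := sum_desc (U.sum (V.sum W)).toPreVectorBundle (U.sum V).toPreVectorBundle
    W.toPreVectorBundle (fun _ x => (x.1.1, (x.1.2, x.2))) b
    (sum_desc (U.sum (V.sum W)).toPreVectorBundle U.toPreVectorBundle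
      V.toPreVectorBundle (fun _ x => (x.1, (x.2, 0))) b
      (fun j => (U.frame_smooth b j).pair
        ((isSmoothAlong_zero _ _ _).pair (isSmoothAlong_zero _ _ _)))
      (fun j => (isSmoothAlong_zero _ _ _).pair
        ((V.frame_smooth b j).pair (isSmoothAlong_zero _ _ _))))
    (fun j => (isSmoothAlong_zero _ _ _).pair
      ((isSmoothAlong_zero _ _ _).pair (W.frame_smooth b j)))
  symm_smooth b := sum_desc ((U.sum V).sum W).toPreVectorBundle U.toPreVectorBundle
    (V.sum W).toPreVectorBundle (fun _ x => ((x.1, x.2.1), x.2.2)) b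
    (fun j => ((U.frame_smooth b j).pair (isSmoothAlong_zero _ _ _)).pair
      (isSmoothAlong_zero _ _ _))
    (sum_desc ((U.sum V).sum W).toPreVectorBundle V.toPreVectorBundle
      W.toPreVectorBundle (fun _ x => ((0, x.1), x.2)) b
      (fun j => ((isSmoothAlong_zero _ _ _).pair (V.frame_smooth b j)).pair
        (isSmoothAlong_zero _ _ _))
      (fun j => ((isSmoothAlong_zero _ _ _).pair (isSmoothAlong_zero _ _ _)).pair
        (W.frame_smooth b j)))
  map_tau _ _ _ _ := rfl

/-- The zero bundle is neutral. -/
def zeroSum (V : RealVectorBundle.{v} k t) : Iso ((zero k t).sum V) V where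
  equiv n := LinearEquiv.uniqueProd (R := ℂ) (M := V.fiber n) (M₂ := PUnit.{v + 1})
  smooth b := sum_desc V.toPreVectorBundle (zero k t).toPreVectorBundle V.toPreVectorBundle
    (fun _ x => x.2) b (fun j => Empty.elim j) (fun j => V.frame_smooth b j)
  symm_smooth b j := (isSmoothAlong_zero (zero.{v} k t).toPreVectorBundle _ _).pair
    (V.frame_smooth b j)
  map_tau _ _ _ _ := rfl

end Iso

/-- The isomorphism of Real vector bundles. -/
instance setoid (k : ℕ∞) (t : SmoothInvolution I N) : Setoid (RealVectorBundle.{v} k t) where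
  r V W := Nonempty (Iso V W)
  iseqv := ⟨fun V => ⟨.refl V⟩, fun ⟨φ⟩ => ⟨φ.symm⟩, fun ⟨φ⟩ ⟨ψ⟩ => ⟨φ.trans ψ⟩⟩

end RealVectorBundle

/-- The set of isomorphism classes of Real vector bundles of class `C^k` over a Real manifold. -/
def RVect (k : ℕ∞) {I : ModelWithCorners ℝ E H} (t : SmoothInvolution I N) :=
  Quotient (RealVectorBundle.setoid.{v} k t)

/-- The class of a Real vector bundle. -/
def RVect.mk {k : ℕ∞} {I : ModelWithCorners ℝ E H} {t : SmoothInvolution I N}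
    (V : RealVectorBundle.{v} k t) : RVect.{v} k t := Quotient.mk _ V

/-- The semigroup structure of `RVect` is the direct sum. -/
instance RVect.instAddCommMonoid (k : ℕ∞) {I : ModelWithCorners ℝ E H}
    (t : SmoothInvolution I N) : AddCommMonoid (RVect.{v} k t) where
  add := Quotient.map₂ RealVectorBundle.sum
    fun _ _ ⟨φ⟩ _ _ ⟨ψ⟩ => ⟨.sumCongr φ ψ⟩
  zero := RVect.mk (.zero k t)
  add_assoc := by
    rintro ⟨U⟩ ⟨V⟩ ⟨W⟩
    exact Quotient.sound ⟨.sumAssoc U V W⟩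
  add_comm := by
    rintro ⟨V⟩ ⟨W⟩
    exact Quotient.sound ⟨.sumComm V W⟩
  zero_add := by
    rintro ⟨V⟩
    exact Quotient.sound ⟨.zeroSum V⟩
  add_zero := by
    rintro ⟨V⟩
    exact Quotient.sound ⟨(RealVectorBundle.Iso.sumComm V _).trans (.zeroSum V)⟩
  nsmul := @nsmulRec _ ⟨RVect.mk (.zero k t)⟩
    ⟨Quotient.map₂ RealVectorBundle.sum fun _ _ ⟨φ⟩ _ _ ⟨ψ⟩ => ⟨.sumCongr φ ψ⟩⟩

end VectorBundles

/-! ## Real bundle gerbes -/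

section Gerbes

variable {EM : Type*} [NormedAddCommGroup EM] [NormedSpace ℝ EM]
  {M : Type u} [TopologicalSpace M] [ChartedSpace EM M]

/-- A bundle gerbe over `M`: a surjective submersion `Y → M` and a principal `U(1)`-bundle `P` over
`Y ×_M Y` with an associative multiplication `P_(y₁,y₂) ⊗ P_(y₂,y₃) → P_(y₁,y₃)`. A map out of the tensor
product of two `U(1)`-torsors is the same as a map of two variables that is equivariant in each. -/
structure BundleGerbe (EM : Type*) [NormedAddCommGroup EM] [NormedSpace ℝ EM]
    (M : Type u) [TopologicalSpace M] [ChartedSpace EM M]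
    (EY : Type*) [NormedAddCommGroup EY] [NormedSpace ℝ EY]
    (Y : Type*) [TopologicalSpace Y] [ChartedSpace EY Y] where
  proj : Y → M
  proj_surjective : Function.Surjective proj
  proj_submersion : Manifold.IsSubmersion 𝓘(ℝ, EY) 𝓘(ℝ, EM) ∞ proj
  P : CircleBundle.{w} (𝓘(ℝ, EY).prod 𝓘(ℝ, EY)) {q : Y × Y | proj q.1 = proj q.2}
  mul : ∀ {y₁ y₂ y₃ : Y} (h₁₂ : proj y₁ = proj y₂) (h₂₃ : proj y₂ = proj y₃),
    P.fiber ⟨(y₁, y₂), h₁₂⟩ → P.fiber ⟨(y₂, y₃), h₂₃⟩ → P.fiber ⟨(y₁, y₃), h₁₂.trans h₂₃⟩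
  smul_mul : ∀ {y₁ y₂ y₃ : Y} (h₁₂ : proj y₁ = proj y₂) (h₂₃ : proj y₂ = proj y₃) (z : Circle) p q,
    mul h₁₂ h₂₃ (z • p) q = z • mul h₁₂ h₂₃ p q
  mul_smul : ∀ {y₁ y₂ y₃ : Y} (h₁₂ : proj y₁ = proj y₂) (h₂₃ : proj y₂ = proj y₃) (z : Circle) p q,
    mul h₁₂ h₂₃ p (z • q) = z • mul h₁₂ h₂₃ p q
  mul_assoc : ∀ {y₁ y₂ y₃ y₄ : Y} (h₁₂ : proj y₁ = proj y₂) (h₂₃ : proj y₂ = proj y₃)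
    (h₃₄ : proj y₃ = proj y₄) p q r,
    mul (h₁₂.trans h₂₃) h₃₄ (mul h₁₂ h₂₃ p q) r = mul h₁₂ (h₂₃.trans h₃₄) p (mul h₂₃ h₃₄ q r)
  mul_smooth : ∀ a b, P.IsSmoothAlong (𝓘(ℝ, EY).prod (𝓘(ℝ, EY).prod 𝓘(ℝ, EY)))
    {t : Y × Y × Y | (proj t.1 = proj t.2.1 ∧ proj t.2.1 = proj t.2.2) ∧
      (t.1, t.2.1) ∈ P.dom a ∧ (t.2.1, t.2.2) ∈ P.dom b}
    (fun t => (t.1, t.2.2)) (fun _ ht => ht.1.1.trans ht.1.2)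
    (fun t ht => mul ht.1.1 ht.1.2 (P.sec a ⟨(t.1, t.2.1), ht.1.1⟩)
      (P.sec b ⟨(t.2.1, t.2.2), ht.1.2⟩))

/-- A Real bundle gerbe over the Real manifold `(M, τ)`: a bundle gerbe with an involution of `Y` that
covers `τ` and a conjugate involution of `P` that covers the induced involution of `Y ×_M Y` and
commutes with the multiplication. -/
structure RealBundleGerbe (τ : SmoothInvolution 𝓘(ℝ, EM) M)
    (EY : Type*) [NormedAddCommGroup EY] [NormedSpace ℝ EY]
    (Y : Type*) [TopologicalSpace Y] [ChartedSpace EY Y] extends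
    BundleGerbe.{u, w} EM M EY Y where
  tauY : SmoothInvolution 𝓘(ℝ, EY) Y
  proj_tauY : ∀ y, proj (tauY y) = τ (proj y)
  tauP : P.RealStructure (fun q => (tauY q.1, tauY q.2))
  tau_mul : ∀ {y₁ y₂ y₃ : Y} (h₁₂ : proj y₁ = proj y₂) (h₂₃ : proj y₂ = proj y₃)
    (p : P.fiber ⟨(y₁, y₂), h₁₂⟩) (q : P.fiber ⟨(y₂, y₃), h₂₃⟩),
    tauP.tau ⟨(y₁, y₃), h₁₂.trans h₂₃⟩ ⟨(tauY y₁, tauY y₃), tauP.maps (y₁, y₃) (h₁₂.trans h₂₃)⟩ rfl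
        (mul h₁₂ h₂₃ p q) =
      mul (tauP.maps (y₁, y₂) h₁₂) (tauP.maps (y₂, y₃) h₂₃)
        (tauP.tau ⟨(y₁, y₂), h₁₂⟩ ⟨(tauY y₁, tauY y₂), tauP.maps (y₁, y₂) h₁₂⟩ rfl p)
        (tauP.tau ⟨(y₂, y₃), h₂₃⟩ ⟨(tauY y₂, tauY y₃), tauP.maps (y₂, y₃) h₂₃⟩ rfl q)

variable {EY : Type*} [NormedAddCommGroup EY] [NormedSpace ℝ EY]
  {Y : Type*} [TopologicalSpace Y] [ChartedSpace EY Y]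
  {EX : Type*} [NormedAddCommGroup EX] [NormedSpace ℝ EX]
  {X : Type*} [TopologicalSpace X] [ChartedSpace EX X]
  {τ : SmoothInvolution 𝓘(ℝ, EM) M}

/-- A Real trivialisation of `(P, Y)`: a `U(1)`-bundle `R` over `Y` with a Real structure, and an
isomorphism of Real bundle gerbes from `P` to `δR`, where `(δR)_(y₁,y₂) = R_{y₁}^* ⊗ R_{y₂}`. An element of
`R_{y₁}^* ⊗ R_{y₂}` is the same as an equivariant map from `R_{y₁}` to `R_{y₂}`, and the multiplication of `δR`
is the composition of such maps; `act` is the isomorphism, written as a map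
`R_{y₁} × P_(y₁,y₂) → R_{y₂}`. -/
structure RealTrivialisation (G : RealBundleGerbe.{u, w} τ EY Y) where
  R : CircleBundle.{w'} 𝓘(ℝ, EY) (Set.univ : Set Y)
  tau : R.RealStructure G.tauY
  act : ∀ {y₁ y₂ : Y} (h : G.proj y₁ = G.proj y₂), R.fiber ⟨y₁, trivial⟩ →
    G.P.fiber ⟨(y₁, y₂), h⟩ → R.fiber ⟨y₂, trivial⟩
  smul_act : ∀ {y₁ y₂ : Y} (h : G.proj y₁ = G.proj y₂) (z : Circle) r p,
    act h (z • r) p = z • act h r p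
  act_smul : ∀ {y₁ y₂ : Y} (h : G.proj y₁ = G.proj y₂) (z : Circle) r p,
    act h r (z • p) = z • act h r p
  act_mul : ∀ {y₁ y₂ y₃ : Y} (h₁₂ : G.proj y₁ = G.proj y₂) (h₂₃ : G.proj y₂ = G.proj y₃) r p q,
    act (h₁₂.trans h₂₃) r (G.mul h₁₂ h₂₃ p q) = act h₂₃ (act h₁₂ r p) q
  act_smooth : ∀ a b, R.IsSmoothAlong (𝓘(ℝ, EY).prod 𝓘(ℝ, EY))
    {t : Y × Y | G.proj t.1 = G.proj t.2 ∧ t.1 ∈ R.dom a ∧ t ∈ G.P.dom b}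
    (fun t => t.2) (fun _ _ => trivial)
    (fun t ht => act ht.1 (R.sec a ⟨t.1, trivial⟩) (G.P.sec b ⟨(t.1, t.2), ht.1⟩))
  tau_act : ∀ {y₁ y₂ : Y} (h : G.proj y₁ = G.proj y₂) r p,
    tau.tau ⟨y₂, trivial⟩ ⟨G.tauY y₂, trivial⟩ rfl (act h r p) =
      act (G.tauP.maps (y₁, y₂) h) (tau.tau ⟨y₁, trivial⟩ ⟨G.tauY y₁, trivial⟩ rfl r)
        (G.tauP.tau ⟨(y₁, y₂), h⟩ ⟨(G.tauY y₁, G.tauY y₂), G.tauP.maps (y₁, y₂) h⟩ rfl p)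

/-- A Real stable isomorphism from `(P, Y)` to `(Q, X)`: a Real trivialisation of `Q ⊗ P^*`, that is, a
`U(1)`-bundle `R` over `Y ×_M X` with a Real structure, and an isomorphism of Real bundle gerbes from
`Q ⊗ P^*` to `δR`. The isomorphism is written as a map that sends `p` in `P_(y₁,y₂)`, `r` in `R_(y₁,x₁)` and
`q` in `Q_(x₁,x₂)` to the element `r'` of `R_(y₂,x₂)` for which `p ⊗ r'` corresponds to `r ⊗ q` under
`P_(y₁,y₂) ⊗ R_(y₂,x₂) ≃ R_(y₁,x₁) ⊗ Q_(x₁,x₂)`. -/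
structure RealStableIso (G : RealBundleGerbe.{u, w} τ EY Y) (G' : RealBundleGerbe.{u, w'} τ EX X) where
  R : CircleBundle.{v} (𝓘(ℝ, EY).prod 𝓘(ℝ, EX)) {s : Y × X | G.proj s.1 = G'.proj s.2}
  tau : R.RealStructure (fun s => (G.tauY s.1, G'.tauY s.2))
  act : ∀ {y₁ y₂ : Y} {x₁ x₂ : X} (hy : G.proj y₁ = G.proj y₂) (hx : G'.proj x₁ = G'.proj x₂)
    (h₁ : G.proj y₁ = G'.proj x₁) (h₂ : G.proj y₂ = G'.proj x₂),
    G.P.fiber ⟨(y₁, y₂), hy⟩ → R.fiber ⟨(y₁, x₁), h₁⟩ → G'.P.fiber ⟨(x₁, x₂), hx⟩ →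
      R.fiber ⟨(y₂, x₂), h₂⟩
  act_smul_left : ∀ {y₁ y₂ : Y} {x₁ x₂ : X} (hy : G.proj y₁ = G.proj y₂)
    (hx : G'.proj x₁ = G'.proj x₂) (h₁ : G.proj y₁ = G'.proj x₁) (h₂ : G.proj y₂ = G'.proj x₂)
    (z : Circle) p r q, act hy hx h₁ h₂ (z • p) r q = z⁻¹ • act hy hx h₁ h₂ p r q
  act_smul_middle : ∀ {y₁ y₂ : Y} {x₁ x₂ : X} (hy : G.proj y₁ = G.proj y₂)
    (hx : G'.proj x₁ = G'.proj x₂) (h₁ : G.proj y₁ = G'.proj x₁) (h₂ : G.proj y₂ = G'.proj x₂)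
    (z : Circle) p r q, act hy hx h₁ h₂ p (z • r) q = z • act hy hx h₁ h₂ p r q
  act_smul_right : ∀ {y₁ y₂ : Y} {x₁ x₂ : X} (hy : G.proj y₁ = G.proj y₂)
    (hx : G'.proj x₁ = G'.proj x₂) (h₁ : G.proj y₁ = G'.proj x₁) (h₂ : G.proj y₂ = G'.proj x₂)
    (z : Circle) p r q, act hy hx h₁ h₂ p r (z • q) = z • act hy hx h₁ h₂ p r q
  act_mul : ∀ {y₁ y₂ y₃ : Y} {x₁ x₂ x₃ : X} (hy : G.proj y₁ = G.proj y₂)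
    (hy' : G.proj y₂ = G.proj y₃) (hx : G'.proj x₁ = G'.proj x₂) (hx' : G'.proj x₂ = G'.proj x₃)
    (h₁ : G.proj y₁ = G'.proj x₁) (h₂ : G.proj y₂ = G'.proj x₂) (h₃ : G.proj y₃ = G'.proj x₃)
    p p' r q q',
    act (hy.trans hy') (hx.trans hx') h₁ h₃ (G.mul hy hy' p p') r (G'.mul hx hx' q q') =
      act hy' hx' h₂ h₃ p' (act hy hx h₁ h₂ p r q) q'
  act_smooth : ∀ a b c,
    R.IsSmoothAlong ((𝓘(ℝ, EY).prod 𝓘(ℝ, EY)).prod (𝓘(ℝ, EX).prod 𝓘(ℝ, EX)))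
      {t : (Y × Y) × (X × X) | (G.proj t.1.1 = G.proj t.1.2 ∧ G'.proj t.2.1 = G'.proj t.2.2 ∧
        G.proj t.1.1 = G'.proj t.2.1 ∧ G.proj t.1.2 = G'.proj t.2.2) ∧
        t.1 ∈ G.P.dom a ∧ (t.1.1, t.2.1) ∈ R.dom b ∧ t.2 ∈ G'.P.dom c}
      (fun t => (t.1.2, t.2.2)) (fun _ ht => ht.1.2.2.2)
      (fun t ht => act ht.1.1 ht.1.2.1 ht.1.2.2.1 ht.1.2.2.2
        (G.P.sec a ⟨(t.1.1, t.1.2), ht.1.1⟩) (R.sec b ⟨(t.1.1, t.2.1), ht.1.2.2.1⟩)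
        (G'.P.sec c ⟨(t.2.1, t.2.2), ht.1.2.1⟩))
  tau_act : ∀ {y₁ y₂ : Y} {x₁ x₂ : X} (hy : G.proj y₁ = G.proj y₂)
    (hx : G'.proj x₁ = G'.proj x₂) (h₁ : G.proj y₁ = G'.proj x₁) (h₂ : G.proj y₂ = G'.proj x₂)
    p r q,
    tau.tau ⟨(y₂, x₂), h₂⟩ ⟨(G.tauY y₂, G'.tauY x₂), tau.maps (y₂, x₂) h₂⟩ rfl (act hy hx h₁ h₂ p r q) =
      act (G.tauP.maps (y₁, y₂) hy) (G'.tauP.maps (x₁, x₂) hx)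
        (tau.maps (y₁, x₁) h₁) (tau.maps (y₂, x₂) h₂)
        (G.tauP.tau ⟨(y₁, y₂), hy⟩ ⟨(G.tauY y₁, G.tauY y₂), G.tauP.maps (y₁, y₂) hy⟩ rfl p)
        (tau.tau ⟨(y₁, x₁), h₁⟩ ⟨(G.tauY y₁, G'.tauY x₁), tau.maps (y₁, x₁) h₁⟩ rfl r)
        (G'.tauP.tau ⟨(x₁, x₂), hx⟩ ⟨(G'.tauY x₁, G'.tauY x₂), G'.tauP.maps (x₁, x₂) hx⟩ rfl q)

/-! ## Real bundle gerbe modules -/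

/-- A Real bundle gerbe module: a Real vector bundle `V` over `Y` with isomorphisms
`P_(y₁,y₂) ⊗ V_{y₂} ≃ V_{y₁}` that are associative and compatible with the Real structures. For a
`U(1)`-torsor `P` and a complex vector space `V`, a linear isomorphism out of `P ⊗ V` is the same as a family
of linear isomorphisms out of `V`, indexed by `P` and equivariant in it. -/
structure RealModule (k : ℕ∞) (G : RealBundleGerbe.{u, w} τ EY Y) extends
    RealVectorBundle.{v} k G.tauY where
  act : ∀ {y₁ y₂ : Y} (h : G.proj y₁ = G.proj y₂), G.P.fiber ⟨(y₁, y₂), h⟩ →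
    (fiber y₂ ≃ₗ[ℂ] fiber y₁)
  smul_act : ∀ {y₁ y₂ : Y} (h : G.proj y₁ = G.proj y₂) (z : Circle) p x,
    act h (z • p) x = (z : ℂ) • act h p x
  mul_act : ∀ {y₁ y₂ y₃ : Y} (h₁₂ : G.proj y₁ = G.proj y₂) (h₂₃ : G.proj y₂ = G.proj y₃) p q x,
    act (h₁₂.trans h₂₃) (G.mul h₁₂ h₂₃ p q) x = act h₁₂ p (act h₂₃ q x)
  act_smooth : ∀ a b j, toPreVectorBundle.IsSmoothAlong k (𝓘(ℝ, EY).prod 𝓘(ℝ, EY))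
    {t : Y × Y | G.proj t.1 = G.proj t.2 ∧ t ∈ G.P.dom a ∧ t.2 ∈ dom b} (fun t => t.1)
    (fun t ht => act ht.1 (G.P.sec a ⟨(t.1, t.2), ht.1⟩) (frame b t.2 ht.2.2 j))
  tau_act : ∀ {y₁ y₂ : Y} (h : G.proj y₁ = G.proj y₂) p x,
    tau y₁ (G.tauY y₁) rfl (act h p x) =
      act (G.tauP.maps (y₁, y₂) h)
        (G.tauP.tau ⟨(y₁, y₂), h⟩ ⟨(G.tauY y₁, G.tauY y₂), G.tauP.maps (y₁, y₂) h⟩ rfl p)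
        (tau y₂ (G.tauY y₂) rfl x)

namespace RealModule

open PreVectorBundle

variable {k : ℕ∞} {G : RealBundleGerbe.{u, w} τ EY Y}

/-- An isomorphism of Real bundle gerbe modules. -/
structure Iso (V W : RealModule.{u, w, v} k G) extends
    RealVectorBundle.Iso V.toRealVectorBundle W.toRealVectorBundle where
  map_act : ∀ {y₁ y₂ : Y} (h : G.proj y₁ = G.proj y₂) p x,
    equiv y₁ (V.act h p x) = W.act h p (equiv y₂ x)

/-- The zero module. -/
def zero (k : ℕ∞) (G : RealBundleGerbe.{u, w} τ EY Y) : RealModule.{u, w, v} k G where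
  toRealVectorBundle := RealVectorBundle.zero k G.tauY
  act _ _ := LinearEquiv.refl ℂ PUnit.{v + 1}
  smul_act _ _ _ _ := rfl
  mul_act _ _ _ _ _ := rfl
  act_smooth _ _ j := Empty.elim j
  tau_act _ _ _ := rfl

/-- The direct sum of modules. -/
def sum (V W : RealModule.{u, w, v} k G) : RealModule.{u, w, v} k G where
  toRealVectorBundle := V.toRealVectorBundle.sum W.toRealVectorBundle
  act h p := (V.act h p).prodCongr (W.act h p)
  smul_act h z p x := Prod.ext (V.smul_act h z p x.1) (W.smul_act h z p x.2)
  mul_act h₁₂ h₂₃ p q x := Prod.ext (V.mul_act h₁₂ h₂₃ p q x.1) (W.mul_act h₁₂ h₂₃ p q x.2)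
  act_smooth := by
    rintro a b (j | j)
    · refine (((V.act_smooth a b j).mono fun t ht => ⟨ht.1, ht.2.1, ht.2.2.1⟩).pair
        (isSmoothAlong_zero W.toPreVectorBundle _ _)).congr fun t ht => ?_
      exact (congrArg ((V.act ht.1 _).prodCongr (W.act ht.1 _))
        (sum_frame_inl V.toPreVectorBundle W.toPreVectorBundle b t.2 ht.2.2 j)).trans
          (Prod.ext rfl (map_zero (W.act ht.1 _)))
    · refine ((isSmoothAlong_zero V.toPreVectorBundle _ _).pair
        ((W.act_smooth a b j).mono fun t ht => ⟨ht.1, ht.2.1, ht.2.2.2⟩)).congr fun t ht => ?_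
      exact (congrArg ((V.act ht.1 _).prodCongr (W.act ht.1 _))
        (sum_frame_inr V.toPreVectorBundle W.toPreVectorBundle b t.2 ht.2.2 j)).trans
          (Prod.ext (map_zero (V.act ht.1 _)) rfl)
  tau_act h p x := Prod.ext (V.tau_act h p x.1) (W.tau_act h p x.2)

namespace Iso

/-- The composition. -/
def trans {U V W : RealModule.{u, w, v} k G} (φ : Iso U V) (ψ : Iso V W) : Iso U W where
  toIso := φ.toIso.trans ψ.toIso
  map_act h p x := (congrArg (ψ.equiv _) (φ.map_act h p x)).trans (ψ.map_act h p _)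

/-- The inverse. -/
def symm {V W : RealModule.{u, w, v} k G} (φ : Iso V W) : Iso W V where
  toIso := φ.toIso.symm
  map_act {y₁ y₂} h p x := by
    refine (LinearEquiv.symm_apply_eq (φ.equiv y₁)).2 ?_
    refine Eq.trans ?_ (φ.map_act h p _).symm
    exact congrArg (W.act h p) ((φ.equiv y₂).apply_symm_apply x).symm

/-- The direct sum is commutative. -/
def sumComm (V W : RealModule.{u, w, v} k G) : Iso (V.sum W) (W.sum V) where
  toIso := .sumComm V.toRealVectorBundle W.toRealVectorBundle
  map_act _ _ _ := rfl

/-- The zero module is neutral. -/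
def zeroSum (V : RealModule.{u, w, v} k G) : Iso ((zero k G).sum V) V where
  toIso := .zeroSum V.toRealVectorBundle
  map_act _ _ _ := rfl

end Iso

/-- The isomorphism of Real bundle gerbe modules. -/
instance setoid (k : ℕ∞) (G : RealBundleGerbe.{u, w} τ EY Y) :
    Setoid (RealModule.{u, w, v} k G) where
  r V W := Nonempty (Iso V W)
  iseqv := ⟨fun V => ⟨⟨.refl V.toRealVectorBundle, fun _ _ _ => rfl⟩⟩, fun ⟨φ⟩ => ⟨φ.symm⟩,
    fun ⟨φ⟩ ⟨ψ⟩ => ⟨φ.trans ψ⟩⟩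

end RealModule

/-- The set of isomorphism classes of Real bundle gerbe modules of class `C^k`. -/
def Rmod (k : ℕ∞) (G : RealBundleGerbe.{u, w} τ EY Y) :=
  Quotient (RealModule.setoid.{u, w, v} k G)

/-- The class of a Real bundle gerbe module. -/
def Rmod.mk {k : ℕ∞} {G : RealBundleGerbe.{u, w} τ EY Y} (V : RealModule.{u, w, v} k G) :
    Rmod.{u, w, v} k G := Quotient.mk _ V

/-- The direct sum of isomorphism classes. -/
instance Rmod.instAdd (k : ℕ∞) (G : RealBundleGerbe.{u, w} τ EY Y) : Add (Rmod.{u, w, v} k G) where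
  add := Quotient.map₂ RealModule.sum fun _ _ ⟨φ⟩ _ _ ⟨ψ⟩ =>
    ⟨⟨.sumCongr φ.toIso ψ.toIso, fun h p x => Prod.ext (φ.map_act h p x.1) (ψ.map_act h p x.2)⟩⟩

/-- The semigroup structure of `Rmod` is the direct sum. -/
instance Rmod.instAddCommMonoid (k : ℕ∞) (G : RealBundleGerbe.{u, w} τ EY Y) :
    AddCommMonoid (Rmod.{u, w, v} k G) where
  zero := Rmod.mk (.zero k G)
  add_assoc := by
    rintro ⟨U⟩ ⟨V⟩ ⟨W⟩
    exact Quotient.sound ⟨⟨.sumAssoc U.toRealVectorBundle V.toRealVectorBundle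
      W.toRealVectorBundle, fun _ _ _ => rfl⟩⟩
  add_comm := by
    rintro ⟨V⟩ ⟨W⟩
    exact Quotient.sound ⟨.sumComm V W⟩
  zero_add := by
    rintro ⟨V⟩
    exact Quotient.sound ⟨.zeroSum V⟩
  add_zero := by
    rintro ⟨V⟩
    exact Quotient.sound ⟨(RealModule.Iso.sumComm V _).trans (.zeroSum V)⟩
  nsmul := @nsmulRec _ ⟨Rmod.mk (.zero k G)⟩ _

/-- The bundle gerbe `KR`-theory group of a Real bundle gerbe over a compact Real manifold. -/
abbrev KRbg (k : ℕ∞) (G : RealBundleGerbe.{u, w} τ EY Y) :=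
  Algebra.GrothendieckAddGroup (Rmod.{u, w, v} k G)

/-- Atiyah's group `KR(M)` of a compact Real manifold. -/
abbrev KR (k : ℕ∞) (τ : SmoothInvolution 𝓘(ℝ, EM) M) :=
  Algebra.GrothendieckAddGroup (RVect.{v} k τ)

/-- The module `W` of `(Q, X)` is induced by the module `V` of `(P, Y)` through the Real stable isomorphism
`S`, given by the bundle `R`: there is an isomorphism `R_(y,x) ⊗ W_x ≃ V_y` over `Y ×_M X`, compatible with the
actions of `P` and `Q` and with the Real structures. In other words, `W` is the descent to `X` of
`R^* ⊗ V`. -/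
def RealStableIso.Induces {G : RealBundleGerbe.{u, w} τ EY Y} {G' : RealBundleGerbe.{u, w'} τ EX X}
    (S : RealStableIso.{u, w, w', v} G G') {k : ℕ∞} (V : RealModule.{u, w, u'} k G)
    (W : RealModule.{u, w', u'} k G') : Prop :=
  ∃ ρ : ∀ (y : Y) (x : X) (h : G.proj y = G'.proj x),
      S.R.fiber ⟨(y, x), h⟩ → (W.fiber x ≃ₗ[ℂ] V.fiber y),
    (∀ y x h (z : Circle) r ξ, ρ y x h (z • r) ξ = (z : ℂ) • ρ y x h r ξ) ∧
    (∀ y₁ y₂ x₁ x₂ (hy : G.proj y₁ = G.proj y₂) (hx : G'.proj x₁ = G'.proj x₂)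
      (h₁ : G.proj y₁ = G'.proj x₁) (h₂ : G.proj y₂ = G'.proj x₂) p r q ξ,
      V.act hy p (ρ y₂ x₂ h₂ (S.act hy hx h₁ h₂ p r q) ξ) = ρ y₁ x₁ h₁ r (W.act hx q ξ)) ∧
    (∀ y x (h : G.proj y = G'.proj x) r ξ,
      V.tau y (G.tauY y) rfl (ρ y x h r ξ) =
        ρ (G.tauY y) (G'.tauY x) (S.tau.maps (y, x) h)
          (S.tau.tau ⟨(y, x), h⟩ ⟨(G.tauY y, G'.tauY x), S.tau.maps (y, x) h⟩ rfl r)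
          (W.tau x (G'.tauY x) rfl ξ)) ∧
    (∀ a b j, V.IsSmoothAlong k (𝓘(ℝ, EY).prod 𝓘(ℝ, EX))
      {t : Y × X | G.proj t.1 = G'.proj t.2 ∧ t ∈ S.R.dom a ∧ t.2 ∈ W.dom b} (fun t => t.1)
      (fun t ht => ρ t.1 t.2 ht.1 (S.R.sec a ⟨(t.1, t.2), ht.1⟩) (W.frame b t.2 ht.2.2 j)))

/-- The Real vector bundle `W` over `M` is induced by the module `V` of `(P, Y)` through the Real
trivialisation `S`, given by the bundle `R`: there is an isomorphism `R_y ⊗ V_y ≃ W_{π(y)}` over `Y`,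
compatible with the action of `P` and with the Real structures. In other words, `W` is the descent to `M` of
`R ⊗ V`. -/
def RealTrivialisation.Induces {G : RealBundleGerbe.{u, w} τ EY Y}
    (S : RealTrivialisation.{u, w, w'} G) {k : ℕ∞} (V : RealModule.{u, w, v} k G)
    (W : RealVectorBundle.{v} k τ) : Prop :=
  ∃ ρ : ∀ (y : Y) (m : M), G.proj y = m →
      S.R.fiber ⟨y, trivial⟩ → (V.fiber y ≃ₗ[ℂ] W.fiber m),
    (∀ y m h (z : Circle) r ξ, ρ y m h (z • r) ξ = (z : ℂ) • ρ y m h r ξ) ∧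
    (∀ y₁ y₂ m (hy : G.proj y₁ = G.proj y₂) (h₂ : G.proj y₂ = m) r p ξ,
      ρ y₁ m (hy.trans h₂) r (V.act hy p ξ) = ρ y₂ m h₂ (S.act hy r p) ξ) ∧
    (∀ y m (h : G.proj y = m) (h' : G.proj (G.tauY y) = τ m) r ξ,
      W.tau m (τ m) rfl (ρ y m h r ξ) =
        ρ (G.tauY y) (τ m) h' (S.tau.tau ⟨y, trivial⟩ ⟨G.tauY y, trivial⟩ rfl r)
          (V.tau y (G.tauY y) rfl ξ)) ∧
    (∀ a b j, W.IsSmoothAlong k 𝓘(ℝ, EY) {y : Y | y ∈ S.R.dom a ∧ y ∈ V.dom b} G.proj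
      (fun y hy => ρ y (G.proj y) rfl (S.R.sec a ⟨y, trivial⟩) (V.frame b y hy.2 j)))

end Gerbes

/-! ## The Real Dixmier-Douady class -/

section Cohomology

variable {EM : Type*} [NormedAddCommGroup EM] [NormedSpace ℝ EM]
  {M : Type u} [TopologicalSpace M] [ChartedSpace EM M]

/-- A Real open cover of `(M, τ)`, whose index set has an involution without fixed points. -/
structure RealCover (τ : SmoothInvolution 𝓘(ℝ, EM) M) where
  ι : Type u
  U : ι → Set M
  isOpen : ∀ i, IsOpen (U i)
  cover : ∀ m, ∃ i, m ∈ U i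
  bar : ι → ι
  bar_bar : ∀ i, bar (bar i) = i
  bar_ne : ∀ i, bar i ≠ i
  mem_bar : ∀ i m, m ∈ U (bar i) ↔ τ m ∈ U i

/-- An equivariant refinement of Real open covers. -/
structure RealCover.Refinement {τ : SmoothInvolution 𝓘(ℝ, EM) M} (𝒲 𝒰 : RealCover τ) where
  map : 𝒲.ι → 𝒰.ι
  map_bar : ∀ i, map (𝒲.bar i) = 𝒰.bar (map i)
  subset : ∀ i, 𝒲.U i ⊆ 𝒰.U (map i)

/-- A Real 1-cochain with values in the sheaf of smooth functions to `U(1)` with the conjugation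
action: smooth functions `c_ij` on `U_i ∩ U_j` with `c_{i̅ j̅} ∘ τ` the conjugate of `c_ij`. -/
structure RealCochain {τ : SmoothInvolution 𝓘(ℝ, EM) M} (𝒰 : RealCover τ) where
  c : 𝒰.ι → 𝒰.ι → M → Circle
  smooth : ∀ i j, ContMDiffOn 𝓘(ℝ, EM) 𝓘(ℝ, ℂ) ∞ (fun m => (c i j m : ℂ)) (𝒰.U i ∩ 𝒰.U j)
  real : ∀ i j m, m ∈ 𝒰.U i → m ∈ 𝒰.U j → c (𝒰.bar i) (𝒰.bar j) (τ m) = (c i j m)⁻¹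

/-- A Real 2-cocycle with values in the sheaf of smooth functions to `U(1)` with the conjugation
action. -/
structure RealCocycle {τ : SmoothInvolution 𝓘(ℝ, EM) M} (𝒰 : RealCover τ) where
  g : 𝒰.ι → 𝒰.ι → 𝒰.ι → M → Circle
  smooth : ∀ i j k, ContMDiffOn 𝓘(ℝ, EM) 𝓘(ℝ, ℂ) ∞ (fun m => (g i j k m : ℂ))
    (𝒰.U i ∩ 𝒰.U j ∩ 𝒰.U k)
  real : ∀ i j k m, m ∈ 𝒰.U i → m ∈ 𝒰.U j → m ∈ 𝒰.U k →
    g (𝒰.bar i) (𝒰.bar j) (𝒰.bar k) (τ m) = (g i j k m)⁻¹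
  cocycle : ∀ i j k l m, m ∈ 𝒰.U i → m ∈ 𝒰.U j → m ∈ 𝒰.U k → m ∈ 𝒰.U l →
    g j k l m * g i j l m = g i k l m * g i j k m

variable {τ : SmoothInvolution 𝓘(ℝ, EM) M}

/-- Two Real 2-cocycles have the same class in the inductive limit over Real open covers if, on a
common refinement, they differ by the coboundary of a Real 1-cochain. -/
def Cohomologous (a b : Σ 𝒰 : RealCover τ, RealCocycle 𝒰) : Prop :=
  ∃ (𝒲 : RealCover τ) (r : 𝒲.Refinement a.1) (s : 𝒲.Refinement b.1) (e : RealCochain 𝒲),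
    ∀ i j k m, m ∈ 𝒲.U i → m ∈ 𝒲.U j → m ∈ 𝒲.U k →
      a.2.g (r.map i) (r.map j) (r.map k) m =
        b.2.g (s.map i) (s.map j) (s.map k) m * (e.c j k m * (e.c i k m)⁻¹ * e.c i j m)

theorem contMDiffOn_circle_mul {f g : M → Circle} {s : Set M}
    (hf : ContMDiffOn 𝓘(ℝ, EM) 𝓘(ℝ, ℂ) ∞ (fun m => (f m : ℂ)) s)
    (hg : ContMDiffOn 𝓘(ℝ, EM) 𝓘(ℝ, ℂ) ∞ (fun m => (g m : ℂ)) s) :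
    ContMDiffOn 𝓘(ℝ, EM) 𝓘(ℝ, ℂ) ∞ (fun m => ((f m * g m : Circle) : ℂ)) s := by
  simp only [Circle.coe_mul]
  exact contDiff_mul.contMDiff.comp_contMDiffOn (hf.prodMk_space hg)

theorem contMDiffOn_circle_inv {f : M → Circle} {s : Set M}
    (hf : ContMDiffOn 𝓘(ℝ, EM) 𝓘(ℝ, ℂ) ∞ (fun m => (f m : ℂ)) s) :
    ContMDiffOn 𝓘(ℝ, EM) 𝓘(ℝ, ℂ) ∞ (fun m => (((f m)⁻¹ : Circle) : ℂ)) s := by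
  simp only [Circle.coe_inv_eq_conj]
  exact Complex.conjCLE.contDiff.contMDiff.comp_contMDiffOn hf

theorem Cohomologous.refl (a : Σ 𝒰 : RealCover τ, RealCocycle 𝒰) : Cohomologous a a :=
  ⟨a.1, ⟨id, fun _ => rfl, fun _ => subset_rfl⟩, ⟨id, fun _ => rfl, fun _ => subset_rfl⟩,
    ⟨fun _ _ _ => 1, fun _ _ => contMDiffOn_const, fun _ _ _ _ _ => by simp⟩,
    fun _ _ _ _ _ _ _ => by simp⟩

theorem Cohomologous.symm {a b : Σ 𝒰 : RealCover τ, RealCocycle 𝒰} (h : Cohomologous a b) :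
    Cohomologous b a := by
  obtain ⟨𝒲, r, s, e, h⟩ := h
  refine ⟨𝒲, s, r, ⟨fun i j m => (e.c i j m)⁻¹, fun i j => contMDiffOn_circle_inv (e.smooth i j),
    fun i j m hi hj => by rw [e.real i j m hi hj]⟩, fun i j k m hi hj hk => ?_⟩
  rw [h i j k m hi hj hk, mul_assoc, ← mul_one (b.2.g _ _ _ _), mul_assoc]
  congr 1
  rw [one_mul, eq_comm, inv_inv]
  rw [show e.c j k m * (e.c i k m)⁻¹ * e.c i j m *
      ((e.c j k m)⁻¹ * e.c i k m * (e.c i j m)⁻¹) =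
      (e.c j k m * (e.c j k m)⁻¹) * ((e.c i k m)⁻¹ * e.c i k m) *
        (e.c i j m * (e.c i j m)⁻¹) from by
    simp only [mul_comm, mul_left_comm, mul_assoc]]
  simp

/-- The cochain homotopy between two refinement maps. -/
theorem homotopy_identity {A : Type*} [CommGroup A] {g : Fin 6 → Fin 6 → Fin 6 → A}
    (hg : ∀ i j k l, g j k l * g i j l = g i k l * g i j k) :
    g 3 4 5 = g 0 1 2 * ((g 1 4 5 * (g 1 2 5)⁻¹) * (g 0 3 5 * (g 0 2 5)⁻¹)⁻¹ *
      (g 0 3 4 * (g 0 1 4)⁻¹)) := by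
  have h1 : g 3 4 5 = g 0 4 5 * g 0 3 4 * (g 0 3 5)⁻¹ := by
    rw [← hg 0 3 4 5]; group
  have h2 : g 1 4 5 = g 0 4 5 * g 0 1 4 * (g 0 1 5)⁻¹ := by
    rw [← hg 0 1 4 5]; group
  have h3 : g 1 2 5 = g 0 2 5 * g 0 1 2 * (g 0 1 5)⁻¹ := by
    rw [← hg 0 1 2 5]; group
  rw [h1, h2, h3]
  apply Additive.ofMul.injective
  simp only [ofMul_mul, ofMul_inv]
  abel

/-- The common refinement of two Real open covers. -/
def RealCover.inf (𝒰 𝒱 : RealCover τ) : RealCover τ where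
  ι := 𝒰.ι × 𝒱.ι
  U i := 𝒰.U i.1 ∩ 𝒱.U i.2
  isOpen i := (𝒰.isOpen i.1).inter (𝒱.isOpen i.2)
  cover m := by
    obtain ⟨i, hi⟩ := 𝒰.cover m
    obtain ⟨j, hj⟩ := 𝒱.cover m
    exact ⟨(i, j), hi, hj⟩
  bar i := (𝒰.bar i.1, 𝒱.bar i.2)
  bar_bar i := Prod.ext (𝒰.bar_bar i.1) (𝒱.bar_bar i.2)
  bar_ne i h := 𝒰.bar_ne i.1 (congrArg Prod.fst h)
  mem_bar i m := and_congr (𝒰.mem_bar i.1 m) (𝒱.mem_bar i.2 m)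

theorem RealCover.tau_mem (𝒰 : RealCover τ) {i : 𝒰.ι} {m : M} (h : m ∈ 𝒰.U i) :
    τ m ∈ 𝒰.U (𝒰.bar i) := by
  rw [𝒰.mem_bar, τ.invol]
  exact h

theorem Cohomologous.trans {a b d : Σ 𝒰 : RealCover τ, RealCocycle 𝒰} (hab : Cohomologous a b)
    (hbd : Cohomologous b d) : Cohomologous a d := by
  obtain ⟨𝒲, r, s, e, h⟩ := hab
  obtain ⟨𝒲', r', s', e', h'⟩ := hbd
  have hs : ∀ {i m}, m ∈ (𝒲.inf 𝒲').U i → m ∈ b.1.U (s.map i.1) := fun hm => s.subset _ hm.1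
  have hr : ∀ {i m}, m ∈ (𝒲.inf 𝒲').U i → m ∈ b.1.U (r'.map i.2) := fun hm => r'.subset _ hm.2
  refine ⟨𝒲.inf 𝒲', ⟨fun i => r.map i.1, fun i => r.map_bar i.1, fun i m hm => r.subset _ hm.1⟩,
    ⟨fun i => s'.map i.2, fun i => s'.map_bar i.2, fun i m hm => s'.subset _ hm.2⟩,
    ⟨fun i j m => e.c i.1 j.1 m * e'.c i.2 j.2 m *
      (b.2.g (r'.map i.2) (s.map i.1) (s.map j.1) m *
        (b.2.g (r'.map i.2) (r'.map j.2) (s.map j.1) m)⁻¹), ?_, ?_⟩, ?_⟩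
  · intro i j
    refine contMDiffOn_circle_mul (contMDiffOn_circle_mul ?_ ?_) (contMDiffOn_circle_mul ?_
      (contMDiffOn_circle_inv ?_))
    · exact (e.smooth i.1 j.1).mono fun m hm => ⟨hm.1.1, hm.2.1⟩
    · exact (e'.smooth i.2 j.2).mono fun m hm => ⟨hm.1.2, hm.2.2⟩
    · exact (b.2.smooth _ _ _).mono fun m hm => ⟨⟨hr hm.1, hs hm.1⟩, hs hm.2⟩
    · exact (b.2.smooth _ _ _).mono fun m hm => ⟨⟨hr hm.1, hr hm.2⟩, hs hm.2⟩
  · intro i j m hi hj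
    change e.c (𝒲.bar i.1) (𝒲.bar j.1) (τ m) * e'.c (𝒲'.bar i.2) (𝒲'.bar j.2) (τ m) *
      (b.2.g (r'.map (𝒲'.bar i.2)) (s.map (𝒲.bar i.1)) (s.map (𝒲.bar j.1)) (τ m) *
        (b.2.g (r'.map (𝒲'.bar i.2)) (r'.map (𝒲'.bar j.2)) (s.map (𝒲.bar j.1)) (τ m))⁻¹) = _
    rw [e.real _ _ _ hi.1 hj.1, e'.real _ _ _ hi.2 hj.2, r'.map_bar, r'.map_bar, s.map_bar,
      s.map_bar, b.2.real _ _ _ _ (hr hi) (hs hi) (hs hj), b.2.real _ _ _ _ (hr hi) (hr hj) (hs hj)]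
    apply Additive.ofMul.injective
    simp only [ofMul_mul, ofMul_inv]
    abel
  · intro i j k m hi hj hk
    have key := homotopy_identity (A := Circle)
      (g := fun x y z => b.2.g (![r'.map i.2, r'.map j.2, r'.map k.2, s.map i.1, s.map j.1,
        s.map k.1] x) (![r'.map i.2, r'.map j.2, r'.map k.2, s.map i.1, s.map j.1, s.map k.1] y)
        (![r'.map i.2, r'.map j.2, r'.map k.2, s.map i.1, s.map j.1, s.map k.1] z) m)
      (by
        have : ∀ x, m ∈ b.1.U (![r'.map i.2, r'.map j.2, r'.map k.2, s.map i.1, s.map j.1,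
            s.map k.1] x) := by
          intro x
          fin_cases x
          exacts [hr hi, hr hj, hr hk, hs hi, hs hj, hs hk]
        exact fun _ _ _ _ => b.2.cocycle _ _ _ _ _ (this _) (this _) (this _) (this _))
    change b.2.g (s.map i.1) (s.map j.1) (s.map k.1) m =
      b.2.g (r'.map i.2) (r'.map j.2) (r'.map k.2) m *
      ((b.2.g (r'.map j.2) (s.map j.1) (s.map k.1) m *
        (b.2.g (r'.map j.2) (r'.map k.2) (s.map k.1) m)⁻¹) *
      (b.2.g (r'.map i.2) (s.map i.1) (s.map k.1) m *
        (b.2.g (r'.map i.2) (r'.map k.2) (s.map k.1) m)⁻¹)⁻¹ *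
      (b.2.g (r'.map i.2) (s.map i.1) (s.map j.1) m *
        (b.2.g (r'.map i.2) (r'.map j.2) (s.map j.1) m)⁻¹)) at key
    simp only
    rw [h i.1 j.1 k.1 m hi.1 hj.1 hk.1, key, h' i.2 j.2 k.2 m hi.2 hj.2 hk.2]
    apply Additive.ofMul.injective
    simp only [ofMul_mul, ofMul_inv]
    abel

/-- The equality of classes of Real 2-cocycles. -/
instance cohomologousSetoid (τ : SmoothInvolution 𝓘(ℝ, EM) M) :
    Setoid (Σ 𝒰 : RealCover τ, RealCocycle 𝒰) where
  r := Cohomologous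
  iseqv := ⟨Cohomologous.refl, Cohomologous.symm, Cohomologous.trans⟩

/-- The set underlying the second cohomology group of the Real manifold `(M, τ)` with values in the
sheaf of smooth functions to `U(1)` with the conjugation action. -/
def RealH2 (τ : SmoothInvolution 𝓘(ℝ, EM) M) := Quotient (cohomologousSetoid τ)

variable {EY : Type*} [NormedAddCommGroup EY] [NormedSpace ℝ EY]
  {Y : Type*} [TopologicalSpace Y] [ChartedSpace EY Y]

/-- The choices in the construction of the Real Dixmier-Douady class of `(P, Y)`: sections `s_i` of
`Y → M` over `U_i` and sections `σ_ij` of `P` along `(s_i, s_j)` over `U_i ∩ U_j`, equivariant under the Real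
structures, with `σ_ij σ_jk = σ_ik g_ijk`. -/
structure RealDDData (G : RealBundleGerbe.{u, w} τ EY Y) (𝒰 : RealCover τ) (g : RealCocycle 𝒰) where
  s : 𝒰.ι → M → Y
  s_smooth : ∀ i, ContMDiffOn 𝓘(ℝ, EM) 𝓘(ℝ, EY) ∞ (s i) (𝒰.U i)
  proj_s : ∀ {i m}, m ∈ 𝒰.U i → G.proj (s i m) = m
  s_real : ∀ {i m}, m ∈ 𝒰.U i → s (𝒰.bar i) (τ m) = G.tauY (s i m)
  σ : ∀ {i j m} (hi : m ∈ 𝒰.U i) (hj : m ∈ 𝒰.U j),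
    G.P.fiber ⟨(s i m, s j m), (proj_s hi).trans (proj_s hj).symm⟩
  σ_smooth : ∀ i j, G.P.IsSmoothAlong 𝓘(ℝ, EM) (𝒰.U i ∩ 𝒰.U j) (fun m => (s i m, s j m))
    (fun _ h => (proj_s h.1).trans (proj_s h.2).symm) (fun _ h => σ h.1 h.2)
  σ_real : ∀ {i j m} (hi : m ∈ 𝒰.U i) (hj : m ∈ 𝒰.U j),
    σ (𝒰.tau_mem hi) (𝒰.tau_mem hj) =
      G.tauP.tau ⟨(s i m, s j m), (proj_s hi).trans (proj_s hj).symm⟩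
        ⟨(s (𝒰.bar i) (τ m), s (𝒰.bar j) (τ m)),
          (proj_s (𝒰.tau_mem hi)).trans (proj_s (𝒰.tau_mem hj)).symm⟩
        (Prod.ext (s_real hi) (s_real hj)) (σ hi hj)
  mul_σ : ∀ {i j k m} (hi : m ∈ 𝒰.U i) (hj : m ∈ 𝒰.U j) (hk : m ∈ 𝒰.U k),
    G.mul ((proj_s hi).trans (proj_s hj).symm) ((proj_s hj).trans (proj_s hk).symm)
      (σ hi hj) (σ hj hk) = g.g i j k m • σ hi hk

/-- `c` is the Real Dixmier-Douady class of `(P, Y)`. -/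
def HasRealDDClass (G : RealBundleGerbe.{u, w} τ EY Y) (c : RealH2 τ) : Prop :=
  ∃ (𝒰 : RealCover τ) (g : RealCocycle 𝒰),
    Nonempty (RealDDData G 𝒰 g) ∧ c = Quotient.mk (cohomologousSetoid τ) ⟨𝒰, g⟩

end Cohomology

end RealGerbe

end

/-! Everything rests on the relation `Induces` between a module $V$ of $P$ and a module $W$ of $Q$,
witnessed by an `Intertwiner` $R_{(y,x)}\otimes W_x\simeq V_y$. It is the graph of an isomorphism of
semigroups of classes (`RealStableIso.exists_addEquiv`), for the following reasons.

Existence (`induces_descent`). Instead of descending the bundle $R^*\otimes V$ by a quotient, choose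
over each $x$, with no continuity, a point $y_0$ of $Y$ and a point $r_0$ of $R_{(y_0,x)}$, and put
$W_x=V_{y_0}$. For any other $y$ and $r\in R_{(y,x)}$ there is exactly one $p\in P_{(y,y_0)}$ that
carries $r$ to $r_0$ over the unit of $Q_{(x,x)}$ (`solve`), and its action identifies $W_x$ with
$V_y$. These identifications are consistent because solutions multiply (`solve_mul`). Solving with
$q\in Q_{(x_1,x_2)}$ in place of the unit gives the action of $Q$, and conjugating gives the Real
structure. Local frames of $W$ come from smooth local lifts $(y(x),r(x))$, which exist because $Y\to
M$ is a submersion. Two lifts differ by the action of a smooth section of $P$, so the transition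
functions are $C^k$ even though the base points jump.

Uniqueness (`compareIso`). Two intertwiners into the same $V$ yield $W_x\to V_y\to W'_x$. The
composite does not depend on $(y,r)$, so it can be computed with smooth lifts.

Symmetry (`induces_symm_iff`). Dualising $R$ and exchanging the factors reverses a stable
isomorphism and inverts intertwiners. Existence and uniqueness on the other side follow, and direct
sums of intertwiners give additivity.

A trivialisation is a stable isomorphism from the trivial gerbe over $M$, whose modules are exactly
Real vector bundles, since the unit acts as the identity. For gerbes with the same class, pass to a
common refinement and absorb the coboundary into the sections $\sigma_{ij}$ of one of them, so that
both have the same cocycle. The bundles $P_{(s_i,y)}^*\otimes Q_{(t_i,x)}$ then glue over the cover,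
because the two copies of $g_{ijk}$ cancel (`Pairing.ratio_mul_ratio`), and the result is a stable
isomorphism (`RealDDData.toStableIso`). The statements on $KR$ follow by functoriality of the
Grothendieck group. -/

noncomputable section

namespace RealGerbe

/-! ### Smooth functions to the circle and to the complex numbers -/

section CircleFunctions

variable {E' H' : Type*} [NormedAddCommGroup E'] [NormedSpace ℝ E'] [TopologicalSpace H']
  {J : ModelWithCorners ℝ E' H'} {T : Type*} [TopologicalSpace T] [ChartedSpace H' T]

theorem contMDiffWithinAt_circle_mul {n : ℕ∞ω} {f g : T → Circle} {A : Set T} {t : T}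
    (hf : ContMDiffWithinAt J 𝓘(ℝ, ℂ) n (fun m => (f m : ℂ)) A t)
    (hg : ContMDiffWithinAt J 𝓘(ℝ, ℂ) n (fun m => (g m : ℂ)) A t) :
    ContMDiffWithinAt J 𝓘(ℝ, ℂ) n (fun m => ((f m * g m : Circle) : ℂ)) A t := by
  simp only [Circle.coe_mul]
  exact (contDiff_mul.contMDiff.contMDiffAt).comp_contMDiffWithinAt t (hf.prodMk_space hg)

theorem contMDiffWithinAt_mul_complex {n : ℕ∞ω} {f g : T → ℂ} {A : Set T} {t : T}
    (hf : ContMDiffWithinAt J 𝓘(ℝ, ℂ) n f A t)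
    (hg : ContMDiffWithinAt J 𝓘(ℝ, ℂ) n g A t) :
    ContMDiffWithinAt J 𝓘(ℝ, ℂ) n (fun m => f m * g m) A t :=
  (contDiff_mul.contMDiff.contMDiffAt).comp_contMDiffWithinAt t (hf.prodMk_space hg)

theorem contMDiffWithinAt_conj {n : ℕ∞ω} {f : T → ℂ} {A : Set T} {t : T}
    (hf : ContMDiffWithinAt J 𝓘(ℝ, ℂ) n f A t) :
    ContMDiffWithinAt J 𝓘(ℝ, ℂ) n (fun m => starRingEnd ℂ (f m)) A t :=
  (Complex.conjCLE.contDiff.contMDiff.contMDiffAt).comp_contMDiffWithinAt t hf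

theorem contMDiffWithinAt_circle_inv {n : ℕ∞ω} {f : T → Circle} {A : Set T} {t : T}
    (hf : ContMDiffWithinAt J 𝓘(ℝ, ℂ) n (fun m => (f m : ℂ)) A t) :
    ContMDiffWithinAt J 𝓘(ℝ, ℂ) n (fun m => (((f m)⁻¹ : Circle) : ℂ)) A t := by
  simp only [Circle.coe_inv_eq_conj]
  exact contMDiffWithinAt_conj hf

theorem contMDiffWithinAt_inv_complex {n : ℕ∞ω} {f : T → ℂ} {A : Set T} {t : T}
    (hf : ContMDiffWithinAt J 𝓘(ℝ, ℂ) n f A t) (h0 : f t ≠ 0) :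
    ContMDiffWithinAt J 𝓘(ℝ, ℂ) n (fun m => (f m)⁻¹) A t :=
  ContMDiffAt.comp_contMDiffWithinAt t (contDiffAt_inv ℝ h0).contMDiffAt hf

theorem contMDiffWithinAt_sum_complex {n : ℕ∞ω} {ι : Type*} {s : Finset ι} {f : ι → T → ℂ}
    {A : Set T} {t : T} (hf : ∀ i ∈ s, ContMDiffWithinAt J 𝓘(ℝ, ℂ) n (f i) A t) :
    ContMDiffWithinAt J 𝓘(ℝ, ℂ) n (fun m => ∑ i ∈ s, f i m) A t :=
  contMDiffWithinAt_finsetSum hf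

theorem contMDiffWithinAt_prod_complex {n : ℕ∞ω} {ι : Type*} {s : Finset ι} {f : ι → T → ℂ}
    {A : Set T} {t : T} (hf : ∀ i ∈ s, ContMDiffWithinAt J 𝓘(ℝ, ℂ) n (f i) A t) :
    ContMDiffWithinAt J 𝓘(ℝ, ℂ) n (fun m => ∏ i ∈ s, f i m) A t := by
  classical
  induction s using Finset.induction_on with
  | empty => simpa using contMDiffWithinAt_const
  | insert a s ha ih =>
    simp only [Finset.prod_insert ha]
    exact contMDiffWithinAt_mul_complex (hf a (by simp))
      (ih fun i hi => hf i (Finset.mem_insert_of_mem hi))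

/-- By the Leibniz formula the determinant is a polynomial in the entries. It serves Cramer's rule
in `contMDiffOn_repr_of_basis`. -/
theorem contMDiffWithinAt_det {n : ℕ∞ω} {ι : Type*} [Fintype ι] [DecidableEq ι]
    {F : T → Matrix ι ι ℂ} {A : Set T} {t : T}
    (hF : ∀ i j, ContMDiffWithinAt J 𝓘(ℝ, ℂ) n (fun m => F m i j) A t) :
    ContMDiffWithinAt J 𝓘(ℝ, ℂ) n (fun m => (F m).det) A t := by
  simp only [Matrix.det_apply']
  exact contMDiffWithinAt_sum_complex fun σ _ => contMDiffWithinAt_mul_complex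
    contMDiffWithinAt_const (contMDiffWithinAt_prod_complex fun i _ => hF _ _)

/-- The sets `dom` of bundles are open, so near a given point of `A` a map stays in the domain of
one local section or frame. Nearly all local arguments below start from this. -/
theorem exists_open_of_continuousOn {N : Type*} [TopologicalSpace N] {f : T → N} {A : Set T}
    (hf : ContinuousOn f A) {D : Set N} (hD : IsOpen D) {t₀ : T} (ht₀ : t₀ ∈ A) (hd : f t₀ ∈ D) :
    ∃ U : Set T, IsOpen U ∧ t₀ ∈ U ∧ ∀ t ∈ A ∩ U, f t ∈ D := by
  obtain ⟨U, hU, h⟩ := continuousOn_iff'.1 hf D hD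
  exact ⟨U, hU, (h.subset ⟨hd, ht₀⟩).1,
    fun t ht => (h.superset ⟨ht.2, ht.1⟩).1⟩

theorem nhdsWithin_inter_open {A U : Set T} (hU : IsOpen U) {t : T} (ht : t ∈ U) :
    𝓝[A ∩ U] t = 𝓝[A] t :=
  nhdsWithin_inter_of_mem' (nhdsWithin_le_nhds (hU.mem_nhds ht))

end CircleFunctions

/-! ### Calculus of smooth sections of circle bundles -/

section CircleBundleCalculus

variable {E H : Type*} [NormedAddCommGroup E] [NormedSpace ℝ E] [TopologicalSpace H]
  {N : Type*} [TopologicalSpace N] [ChartedSpace H N] {I : ModelWithCorners ℝ E H}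
  {E' H' : Type*} [NormedAddCommGroup E'] [NormedSpace ℝ E'] [TopologicalSpace H']
  {J : ModelWithCorners ℝ E' H'} {T : Type*} [TopologicalSpace T] [ChartedSpace H' T]
  {E'' H'' : Type*} [NormedAddCommGroup E''] [NormedSpace ℝ E''] [TopologicalSpace H'']
  {J' : ModelWithCorners ℝ E'' H''} {T' : Type*} [TopologicalSpace T'] [ChartedSpace H'' T']
  {S : Set N}

namespace PreCircleBundle

variable {L : PreCircleBundle.{w} S} {A : Set T} {f : T → N} {hf : ∀ t ∈ A, f t ∈ S}
  {σ : ∀ (t : T) (ht : t ∈ A), L.fiber ⟨f t, hf t ht⟩}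

theorem smul_right_cancel {s : S} {z z' : Circle} {p : L.fiber s} (h : z • p = z' • p) : z = z' :=
  (L.torsor s p (z' • p)).unique h rfl

/-- The quotient of two points of a fibre. -/
def quot {s : S} (p q : L.fiber s) : Circle := (L.torsor s p q).choose

theorem quot_smul {s : S} (p q : L.fiber s) : quot p q • p = q := (L.torsor s p q).choose_spec.1

theorem quot_eq {s : S} {p q : L.fiber s} {z : Circle} (h : z • p = q) : quot p q = z :=
  L.smul_right_cancel ((quot_smul p q).trans h.symm)

theorem IsSmoothAlong.mono (hσ : L.IsSmoothAlong J A f hf σ) {B : Set T} (hBA : B ⊆ A) :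
    L.IsSmoothAlong J B f (fun t h => hf t (hBA h)) (fun t h => σ t (hBA h)) := by
  intro a t₀ ht₀ hd
  obtain ⟨g, hg, he⟩ := hσ a t₀ (hBA ht₀) hd
  refine ⟨g, hg.mono hBA, ?_⟩
  filter_upwards [nhdsWithin_mono t₀ hBA he] with t ht hB using ht (hBA hB)

/-- The definition only sees germs at points of `A`, and an open `U` does not change `𝓝[A] t₀`. -/
theorem IsSmoothAlong.of_local
    (h : ∀ t₀ ∈ A, ∃ U : Set T, IsOpen U ∧ t₀ ∈ U ∧ L.IsSmoothAlong J (A ∩ U) f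
      (fun t h => hf t h.1) (fun t h => σ t h.1)) : L.IsSmoothAlong J A f hf σ := by
  intro a t₀ ht₀ hd
  obtain ⟨U, hU, htU, hs⟩ := h t₀ ht₀
  obtain ⟨g, hg, he⟩ := hs a t₀ ⟨ht₀, htU⟩ hd
  refine ⟨g, hg.mono_of_mem_nhdsWithin
    (Filter.inter_mem self_mem_nhdsWithin (nhdsWithin_le_nhds (hU.mem_nhds htU))), ?_⟩
  rw [nhdsWithin_inter_open hU htU] at he
  filter_upwards [he, nhdsWithin_le_nhds (hU.mem_nhds htU)] with t h1 h2 hA using h1 ⟨hA, h2⟩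

theorem IsSmoothAlong.comp (hσ : L.IsSmoothAlong J A f hf σ) {B : Set T'} {g : T' → T}
    (hg : ContMDiffOn J' J ∞ g B) (hBA : ∀ t ∈ B, g t ∈ A) :
    L.IsSmoothAlong J' B (fun t => f (g t)) (fun t h => hf _ (hBA t h))
      (fun t h => σ (g t) (hBA t h)) := by
  intro a t₀ ht₀ hd
  obtain ⟨c, hc, he⟩ := hσ a (g t₀) (hBA t₀ ht₀) hd
  refine ⟨fun t => c (g t), hc.comp t₀ (hg t₀ ht₀) hBA, ?_⟩
  have := ((hg t₀ ht₀).continuousWithinAt.tendsto_nhdsWithin hBA).eventually he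
  filter_upwards [this] with t ht hB using ht (hBA t hB)

theorem IsSmoothAlong.congr (hσ : L.IsSmoothAlong J A f hf σ)
    {ρ : ∀ (t : T) (ht : t ∈ A), L.fiber ⟨f t, hf t ht⟩} (h : ∀ t ht, ρ t ht = σ t ht) :
    L.IsSmoothAlong J A f hf ρ := by
  have : ρ = σ := by funext t ht; exact h t ht
  rwa [this]

theorem IsSmoothAlong.smul (hσ : L.IsSmoothAlong J A f hf σ) {g : T → Circle}
    (hg : ContMDiffOn J 𝓘(ℝ, ℂ) ∞ (fun t => (g t : ℂ)) A) :
    L.IsSmoothAlong J A f hf (fun t h => g t • σ t h) := by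
  intro a t₀ ht₀ hd
  obtain ⟨c, hc, he⟩ := hσ a t₀ ht₀ hd
  refine ⟨fun t => g t * c t, contMDiffWithinAt_circle_mul (hg t₀ ht₀) hc, ?_⟩
  filter_upwards [he] with t ht hA
  rw [ht hA, smul_smul]

/-- The definition supplies a coefficient only near each point. Coefficients in a torsor are unique,
so these germs are germs of a single function, the fibrewise quotient. -/
theorem IsSmoothAlong.exists_coeff (hσ : L.IsSmoothAlong J A f hf σ) {b : S}
    (hd : ∀ t ∈ A, f t ∈ L.dom b) : ∃ g : T → Circle,
      ContMDiffOn J 𝓘(ℝ, ℂ) ∞ (fun t => (g t : ℂ)) A ∧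
        ∀ t h, σ t h = g t • L.sec b ⟨f t, hf t h⟩ := by
  classical
  refine ⟨fun t => if h : t ∈ A then quot (L.sec b ⟨f t, hf t h⟩) (σ t h) else 1, ?_, ?_⟩
  · intro t₀ ht₀
    obtain ⟨c, hc, he⟩ := hσ b t₀ ht₀ (hd t₀ ht₀)
    have key : ∀ᶠ t in 𝓝[A] t₀, (if h : t ∈ A then quot (L.sec b ⟨f t, hf t h⟩) (σ t h) else 1)
        = c t := by
      filter_upwards [he, self_mem_nhdsWithin] with t h1 hA
      rw [dif_pos hA]
      exact quot_eq (h1 hA).symm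
    refine hc.congr_of_eventuallyEq ?_ (congrArg (fun z : Circle => (z : ℂ)) (key.self_of_nhdsWithin ht₀))
    filter_upwards [key] with t h using congrArg (fun z : Circle => (z : ℂ)) h
  · intro t h
    simp only [dif_pos h]
    exact (quot_smul _ _).symm

end PreCircleBundle

namespace CircleBundle

variable (L : CircleBundle.{w} I S) {A : Set T} {f : T → N}

theorem sec_isSmoothAlong (hfs : ContMDiffOn J I ∞ f A) (hf : ∀ t ∈ A, f t ∈ S) (b : S)
    (hd : ∀ t ∈ A, f t ∈ L.dom b) :
    L.IsSmoothAlong J A f hf (fun t h => L.sec b ⟨f t, hf t h⟩) :=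
  (L.sec_smooth b).comp hfs fun t h => ⟨hf t h, hd t h⟩

theorem exists_open_dom (hfs : ContinuousOn f A) (hf : ∀ t ∈ A, f t ∈ S) {t₀ : T} (ht₀ : t₀ ∈ A) :
    ∃ U : Set T, IsOpen U ∧ t₀ ∈ U ∧ ∀ t ∈ A ∩ U, f t ∈ L.dom ⟨f t₀, hf t₀ ht₀⟩ :=
  exists_open_of_continuousOn hfs (L.isOpen_dom _) ht₀ (L.mem_dom ⟨f t₀, hf t₀ ht₀⟩)

variable {L}

/-- The quotient of two smooth sections is a smooth function. -/
theorem exists_quot (hfs : ContinuousOn f A) {hf : ∀ t ∈ A, f t ∈ S}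
    {σ ρ : ∀ (t : T) (ht : t ∈ A), L.fiber ⟨f t, hf t ht⟩}
    (hσ : L.IsSmoothAlong J A f hf σ) (hρ : L.IsSmoothAlong J A f hf ρ) : ∃ g : T → Circle,
      ContMDiffOn J 𝓘(ℝ, ℂ) ∞ (fun t => (g t : ℂ)) A ∧ ∀ t h, ρ t h = g t • σ t h := by
  classical
  refine ⟨fun t => if h : t ∈ A then PreCircleBundle.quot (σ t h) (ρ t h) else 1, ?_, ?_⟩
  · intro t₀ ht₀
    obtain ⟨U, hU, htU, hUd⟩ := L.exists_open_dom hfs hf ht₀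
    obtain ⟨c, hc, he⟩ := (hσ.mono Set.inter_subset_left).exists_coeff hUd
    obtain ⟨d, hd', he'⟩ := (hρ.mono Set.inter_subset_left).exists_coeff hUd
    -- Both sections are measured against the same local section of `L`, with coefficients `c` and
    -- `d`; their quotient is the quotient of the coefficients.
    have hm : ContMDiffWithinAt J 𝓘(ℝ, ℂ) ∞ (fun t => ((d t * (c t)⁻¹ : Circle) : ℂ)) (A ∩ U) t₀ :=
      contMDiffWithinAt_circle_mul (hd' t₀ ⟨ht₀, htU⟩)
        (contMDiffWithinAt_circle_inv (hc t₀ ⟨ht₀, htU⟩))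
    have hmA : A ∩ U ∈ 𝓝[A] t₀ :=
      Filter.inter_mem self_mem_nhdsWithin (nhdsWithin_le_nhds (hU.mem_nhds htU))
    have key : ∀ᶠ t in 𝓝[A] t₀, (if h : t ∈ A then PreCircleBundle.quot (σ t h) (ρ t h) else 1)
        = d t * (c t)⁻¹ := by
      filter_upwards [hmA] with t h1
      rw [dif_pos h1.1]
      refine PreCircleBundle.quot_eq ?_
      rw [he t h1, he' t h1, smul_smul, inv_mul_cancel_right]
    refine (hm.mono_of_mem_nhdsWithin hmA).congr_of_eventuallyEq ?_
      (congrArg (fun z : Circle => (z : ℂ)) (key.self_of_nhdsWithin ht₀))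
    filter_upwards [key] with t h using congrArg (fun z : Circle => (z : ℂ)) h
  · intro t h
    simp only [dif_pos h]
    exact (PreCircleBundle.quot_smul _ _).symm

/-- Real structures preserve smoothness of sections. -/
theorem RealStructure.isSmoothAlong {t : N → N} (τ : L.RealStructure t)
    (hfs : ContMDiffOn J I ∞ f A) {hf : ∀ t ∈ A, f t ∈ S}
    {σ : ∀ (t : T) (ht : t ∈ A), L.fiber ⟨f t, hf t ht⟩} (hσ : L.IsSmoothAlong J A f hf σ) :
    L.IsSmoothAlong J A (fun s => t (f s)) (fun s h => τ.maps _ (hf s h))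
      (fun s h => τ.tau ⟨f s, hf s h⟩ ⟨t (f s), τ.maps _ (hf s h)⟩ rfl (σ s h)) := by
  refine .of_local fun t₀ ht₀ => ?_
  obtain ⟨U, hU, htU, hUd⟩ := L.exists_open_dom hfs.continuousOn hf ht₀
  obtain ⟨c, hc, he⟩ := (hσ.mono Set.inter_subset_left).exists_coeff hUd
  refine ⟨U, hU, htU, ?_⟩
  -- The involution is conjugate, so a coefficient `c` becomes its inverse.
  refine (((τ.tau_smooth ⟨f t₀, hf t₀ ht₀⟩).comp (hfs.mono Set.inter_subset_left)
    fun t h => ⟨hf t h.1, hUd t h⟩).smul (fun s hs => contMDiffWithinAt_circle_inv (hc s hs))).congr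
      fun s hs => ?_
  rw [he s hs, τ.tau_smul]

end CircleBundle

end CircleBundleCalculus

/-! ### Calculus of sections and homomorphisms of vector bundles -/

section VectorBundleCalculus

variable {E H : Type*} [NormedAddCommGroup E] [NormedSpace ℝ E] [TopologicalSpace H]
  {N : Type*} [TopologicalSpace N] [ChartedSpace H N] {I : ModelWithCorners ℝ E H}
  {F K : Type*} [NormedAddCommGroup F] [NormedSpace ℝ F] [TopologicalSpace K]
  {N' : Type*} [TopologicalSpace N'] [ChartedSpace K N'] {I' : ModelWithCorners ℝ F K}
  {E' H' : Type*} [NormedAddCommGroup E'] [NormedSpace ℝ E'] [TopologicalSpace H']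
  {J : ModelWithCorners ℝ E' H'} {T : Type*} [TopologicalSpace T] [ChartedSpace H' T]
  {E'' H'' : Type*} [NormedAddCommGroup E''] [NormedSpace ℝ E''] [TopologicalSpace H'']
  {J' : ModelWithCorners ℝ E'' H''} {T' : Type*} [TopologicalSpace T'] [ChartedSpace H'' T']
  {k : ℕ∞}

namespace PreVectorBundle

variable {V : PreVectorBundle.{v} N} {W : PreVectorBundle.{v} N'} {A : Set T} {f : T → N}
  {g : T → N'} {σ : ∀ t ∈ A, V.fiber (f t)}

theorem IsSmoothAlong.of_local
    (h : ∀ t₀ ∈ A, ∃ U : Set T, IsOpen U ∧ t₀ ∈ U ∧ V.IsSmoothAlong k J (A ∩ U) f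
      (fun t h => σ t h.1)) : V.IsSmoothAlong k J A f σ := by
  intro a t₀ ht₀ hd
  obtain ⟨U, hU, htU, hs⟩ := h t₀ ht₀
  obtain ⟨c, hc, he⟩ := hs a t₀ ⟨ht₀, htU⟩ hd
  refine ⟨c, fun i => (hc i).mono_of_mem_nhdsWithin
    (Filter.inter_mem self_mem_nhdsWithin (nhdsWithin_le_nhds (hU.mem_nhds htU))), ?_⟩
  rw [nhdsWithin_inter_open hU htU] at he
  filter_upwards [he, nhdsWithin_le_nhds (hU.mem_nhds htU)] with t h1 h2 hA using h1 ⟨hA, h2⟩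

theorem IsSmoothAlong.comp (hσ : V.IsSmoothAlong k J A f σ) {B : Set T'} {g : T' → T}
    (hg : ContMDiffOn J' J ∞ g B) (hBA : ∀ t ∈ B, g t ∈ A) :
    V.IsSmoothAlong k J' B (fun t => f (g t)) (fun t h => σ (g t) (hBA t h)) := by
  intro a t₀ ht₀ hd
  obtain ⟨c, hc, he⟩ := hσ a (g t₀) (hBA t₀ ht₀) hd
  refine ⟨fun i t => c i (g t), fun i => (hc i).comp t₀
    ((hg t₀ ht₀).of_le (by exact_mod_cast le_top)) hBA, ?_⟩
  have := ((hg t₀ ht₀).continuousWithinAt.tendsto_nhdsWithin hBA).eventually he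
  filter_upwards [this] with t ht hB using ht (hBA t hB)

theorem IsSmoothAlong.smul (hσ : V.IsSmoothAlong k J A f σ) {c : T → ℂ}
    (hc : ContMDiffOn J 𝓘(ℝ, ℂ) k c A) :
    V.IsSmoothAlong k J A f (fun t h => c t • σ t h) := by
  intro a t₀ ht₀ hd
  obtain ⟨d, hd, he⟩ := hσ a t₀ ht₀ hd
  refine ⟨fun i t => c t * d i t, fun i => contMDiffWithinAt_mul_complex (hc t₀ ht₀) (hd i), ?_⟩
  filter_upwards [he] with t ht hA hD
  simp only [ht hA hD, Finset.smul_sum, smul_smul]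

/-- Gerbes and circle bundles are always of class $C^\infty$, while modules are only of class $C^k$;
coefficients from the former are weakened to class $C^k$ here. -/
theorem IsSmoothAlong.circle_smul (hσ : V.IsSmoothAlong k J A f σ) {c : T → Circle}
    (hc : ContMDiffOn J 𝓘(ℝ, ℂ) ∞ (fun t => (c t : ℂ)) A) :
    V.IsSmoothAlong k J A f (fun t h => (c t : ℂ) • σ t h) :=
  hσ.smul (hc.of_le (by exact_mod_cast le_top))

theorem isSmoothAlong_sum {ι : Type*} [Fintype ι] {σ : ι → ∀ t ∈ A, V.fiber (f t)}
    (hσ : ∀ i, V.IsSmoothAlong k J A f (σ i)) :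
    V.IsSmoothAlong k J A f (fun t h => ∑ i, σ i t h) := by
  intro a t₀ ht₀ hd
  choose c hc he using fun i => hσ i a t₀ ht₀ hd
  refine ⟨fun j t => ∑ i, c i j t, fun j => contMDiffWithinAt_sum_complex fun i _ => hc i j, ?_⟩
  filter_upwards [Filter.eventually_all.2 he] with t ht hA hD
  simp only [ht _ hA hD, Finset.sum_smul]
  exact Finset.sum_comm

/-- Coordinates in a basis are unique, so the local coefficients of the definition are restrictions
of one function on `A`. -/
theorem IsSmoothAlong.contMDiffOn_repr (hσ : V.IsSmoothAlong k J A f σ) {b : N}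
    (hd : ∀ t ∈ A, f t ∈ V.dom b) : ∃ c : V.idx b → T → ℂ,
      (∀ i, ContMDiffOn J 𝓘(ℝ, ℂ) k (c i) A) ∧
        ∀ t h, σ t h = ∑ i, c i t • V.frame b (f t) (hd t h) i := by
  classical
  refine ⟨fun i t => if h : t ∈ A then (V.frame b (f t) (hd t h)).repr (σ t h) i else 0, ?_, ?_⟩
  · intro i t₀ ht₀
    obtain ⟨c, hc, he⟩ := hσ b t₀ ht₀ (hd t₀ ht₀)
    have key : ∀ᶠ t in 𝓝[A] t₀, (if h : t ∈ A then (V.frame b (f t) (hd t h)).repr (σ t h) i else 0)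
        = c i t := by
      filter_upwards [he, self_mem_nhdsWithin] with t h1 hA
      rw [dif_pos hA, h1 hA (hd t hA), Module.Basis.repr_sum_self]
    exact (hc i).congr_of_eventuallyEq key (key.self_of_nhdsWithin ht₀)
  · intro t h
    simp only [dif_pos h]
    exact (Module.Basis.sum_repr _ _).symm

/-- Smoothness can be tested on the coefficients in a frame that is defined on the whole domain; the
frames have to be chosen around each point. -/
theorem isSmoothAlong_of_coeff (hfs : ContinuousOn f A)
    (h : ∀ (a : N) (U : Set T), IsOpen U → ∀ hd : ∀ t ∈ A ∩ U, f t ∈ V.dom a,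
      ∃ c : V.idx a → T → ℂ, (∀ i, ContMDiffOn J 𝓘(ℝ, ℂ) k (c i) (A ∩ U)) ∧
        ∀ t h, σ t h.1 = ∑ i, c i t • V.frame a (f t) (hd t h) i) :
    V.IsSmoothAlong k J A f σ := by
  intro a t₀ ht₀ hd
  obtain ⟨U, hU, htU, hUd⟩ := exists_open_of_continuousOn hfs (V.isOpen_dom a) ht₀ hd
  obtain ⟨c, hc, he⟩ := h a U hU hUd
  have hmA : A ∩ U ∈ 𝓝[A] t₀ :=
    Filter.inter_mem self_mem_nhdsWithin (nhdsWithin_le_nhds (hU.mem_nhds htU))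
  refine ⟨c, fun i => (hc i t₀ ⟨ht₀, htU⟩).mono_of_mem_nhdsWithin hmA, ?_⟩
  filter_upwards [hmA] with t h hA hD using he t h

/-- A family of linear maps between the fibres of two vector bundles along two maps `f` and `g` is
of class `C^k` if it sends the local frames to sections of class `C^k`. -/
def HomSmooth (V : PreVectorBundle.{v} N) (W : PreVectorBundle.{v} N') (k : ℕ∞)
    (J : ModelWithCorners ℝ E' H') (A : Set T) (f : T → N) (g : T → N')
    (θ : ∀ t ∈ A, V.fiber (f t) →ₗ[ℂ] W.fiber (g t)) : Prop :=
  ∀ b j, W.IsSmoothAlong k J (A ∩ f ⁻¹' V.dom b) g (fun t h => θ t h.1 (V.frame b (f t) h.2 j))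

/-- By linearity, the image of a section is the combination of the images of the frame with the same
coefficients. -/
theorem HomSmooth.apply {θ : ∀ t ∈ A, V.fiber (f t) →ₗ[ℂ] W.fiber (g t)}
    (hθ : HomSmooth V W k J A f g θ) (hfs : ContinuousOn f A) (hσ : V.IsSmoothAlong k J A f σ) :
    W.IsSmoothAlong k J A g (fun t h => θ t h (σ t h)) := by
  refine .of_local fun t₀ ht₀ => ?_
  obtain ⟨U, hU, htU, hUd⟩ :=
    exists_open_of_continuousOn hfs (V.isOpen_dom (f t₀)) ht₀ (V.mem_dom _)
  obtain ⟨c, hc, he⟩ := (hσ.mono Set.inter_subset_left).contMDiffOn_repr hUd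
  refine ⟨U, hU, htU, (isSmoothAlong_sum (σ := fun i t h => c i t • θ t h.1
    (V.frame (f t₀) (f t) (hUd t h) i)) fun i => ((hθ (f t₀) i).mono
      fun t h => ⟨h.1, hUd t h⟩).smul (hc i)).congr fun t h => ?_⟩
  rw [he t h, map_sum]
  simp only [map_smul]

theorem HomSmooth.of_local {θ : ∀ t ∈ A, V.fiber (f t) →ₗ[ℂ] W.fiber (g t)}
    (h : ∀ t₀ ∈ A, ∃ U : Set T, IsOpen U ∧ t₀ ∈ U ∧
      HomSmooth V W k J (A ∩ U) f g (fun t h => θ t h.1)) : HomSmooth V W k J A f g θ := by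
  intro b j
  refine .of_local fun t₀ ht₀ => ?_
  obtain ⟨U, hU, htU, hs⟩ := h t₀ ht₀.1
  exact ⟨U, hU, htU, (hs b j).mono fun t h => ⟨⟨h.1.1, h.2⟩, h.1.2⟩⟩

/-- The coefficients of a smooth section in a basis that consists of smooth sections are smooth. -/
theorem contMDiffOn_repr_of_basis {ι : Type*} [Fintype ι] (hfs : ContinuousOn f A)
    (B : ∀ t ∈ A, Module.Basis ι ℂ (V.fiber (f t)))
    (hB : ∀ i, V.IsSmoothAlong k J A f (fun t h => B t h i)) (hσ : V.IsSmoothAlong k J A f σ)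
    {c : ι → T → ℂ} (hc : ∀ t h, σ t h = ∑ i, c i t • B t h i) (i : ι) :
    ContMDiffOn J 𝓘(ℝ, ℂ) k (c i) A := by
  classical
  intro t₀ ht₀
  obtain ⟨U, hU, htU, hUd⟩ :=
    exists_open_of_continuousOn hfs (V.isOpen_dom (f t₀)) ht₀ (V.mem_dom _)
  have hmA : A ∩ U ∈ 𝓝[A] t₀ :=
    Filter.inter_mem self_mem_nhdsWithin (nhdsWithin_le_nhds (hU.mem_nhds htU))
  obtain ⟨s, hs, hse⟩ := (hσ.mono Set.inter_subset_left).contMDiffOn_repr hUd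
  choose M hM hMe using fun i => ((hB i).mono Set.inter_subset_left).contMDiffOn_repr hUd
  -- Two bases of one fibre have index sets of the same size. The bijection is taken at `t₀` and
  -- kept nearby, which makes the change of basis a square matrix `D` with smooth entries.
  let e : ι ≃ V.idx (f t₀) := (B t₀ ht₀).indexEquiv (V.frame (f t₀) (f t₀) (V.mem_dom _))
  let D : T → Matrix ι ι ℂ := fun t => Matrix.of fun a b => M b (e a) t
  have hDm : ∀ t (h : t ∈ A ∩ U), D t =
      ((V.frame (f t₀) (f t) (hUd t h)).reindex e.symm).toMatrix (B t h.1) := by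
    intro t h
    ext a b
    have := congrArg (fun x => (V.frame (f t₀) (f t) (hUd t h)).repr x (e a)) (hMe b t h)
    simp only [Module.Basis.repr_sum_self] at this
    simp [D, Module.Basis.toMatrix_apply, this]
  have hdet : ∀ t (h : t ∈ A ∩ U), (D t).det ≠ 0 := by
    intro t h
    rw [hDm t h]
    exact (Module.Basis.isUnit_det _ (B t h.1)).ne_zero
  -- Cramer's rule expresses the coefficient by determinants of smooth matrices, with an invertible
  -- denominator.
  have hcr : ∀ t (h : t ∈ A ∩ U),
      c i t = ((D t).updateCol i (fun a => s (e a) t)).det * ((D t).det)⁻¹ := by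
    intro t h
    have hv : (fun a => s (e a) t) = (D t).mulVec (fun j => c j t) := by
      funext a
      have h1 := congrArg (fun x => (V.frame (f t₀) (f t) (hUd t h)).repr x (e a))
        ((hse t h).symm.trans (hc t h.1))
      simp only [Module.Basis.repr_sum_self] at h1
      rw [h1]
      have h2 : ∀ j, (V.frame (f t₀) (f t) (hUd t h)).repr (B t h.1 j) (e a) = M j (e a) t := by
        intro j
        rw [hMe j t h, Module.Basis.repr_sum_self]
      simp [Matrix.mulVec, dotProduct, D, h2, mul_comm]
    rw [← Matrix.cramer_apply, hv, Matrix.cramer_eq_adjugate_mulVec, Matrix.mulVec_mulVec,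
      Matrix.adjugate_mul, Matrix.smul_mulVec, Matrix.one_mulVec, Pi.smul_apply, smul_eq_mul,
      mul_comm, inv_mul_cancel_left₀ (hdet t h)]
  have hD : ∀ a b, ContMDiffWithinAt J 𝓘(ℝ, ℂ) k (fun t => D t a b) (A ∩ U) t₀ :=
    fun a b => hM b (e a) t₀ ⟨ht₀, htU⟩
  have hsm : ContMDiffWithinAt J 𝓘(ℝ, ℂ) k
      (fun t => ((D t).updateCol i (fun a => s (e a) t)).det * ((D t).det)⁻¹) (A ∩ U) t₀ := by
    refine contMDiffWithinAt_mul_complex (contMDiffWithinAt_det fun a b => ?_)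
      (contMDiffWithinAt_inv_complex (contMDiffWithinAt_det hD) (hdet t₀ ⟨ht₀, htU⟩))
    by_cases hb : b = i
    · subst hb
      simpa using hs (e a) t₀ ⟨ht₀, htU⟩
    · simpa [hb] using hD a b
  refine (hsm.mono_of_mem_nhdsWithin hmA).congr_of_eventuallyEq ?_ (hcr t₀ ⟨ht₀, htU⟩)
  filter_upwards [hmA] with t h using hcr t h

end PreVectorBundle

open PreVectorBundle

namespace VectorBundle

variable (V : VectorBundle.{v} k I N) (W : VectorBundle.{v} k I' N') {A : Set T} {f : T → N}
  {g : T → N'}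

theorem frame_isSmoothAlong (hfs : ContMDiffOn J I ∞ f A) (b : N) (hd : ∀ t ∈ A, f t ∈ V.dom b)
    (j : V.idx b) : V.IsSmoothAlong k J A f (fun t h => V.frame b (f t) (hd t h) j) :=
  (V.frame_smooth b j).comp hfs hd

variable {V W}

theorem isSmoothAlong_frame_sum (hfs : ContMDiffOn J I ∞ f A) {b : N} (hd : ∀ t ∈ A, f t ∈ V.dom b)
    {c : V.idx b → T → ℂ} (hc : ∀ i, ContMDiffOn J 𝓘(ℝ, ℂ) k (c i) A) :
    V.IsSmoothAlong k J A f (fun t h => ∑ i, c i t • V.frame b (f t) (hd t h) i) :=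
  isSmoothAlong_sum (σ := fun i t h => c i t • V.frame b (f t) (hd t h) i)
    fun i => (V.frame_isSmoothAlong hfs b hd i).smul (hc i)

/-- The inverse of a family of linear isomorphisms of class `C^k` is of class `C^k`. -/
theorem homSmooth_symm (hfs : ContMDiffOn J I ∞ f A) (hgs : ContMDiffOn J I' ∞ g A)
    {θ : ∀ t ∈ A, V.fiber (f t) ≃ₗ[ℂ] W.fiber (g t)}
    (hθ : HomSmooth V.toPreVectorBundle W.toPreVectorBundle k J A f g
      (fun t h => (θ t h).toLinearMap)) :
    HomSmooth W.toPreVectorBundle V.toPreVectorBundle k J A g f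
      (fun t h => (θ t h).symm.toLinearMap) := by
  classical
  intro b j
  refine .of_local fun t₀ ht₀ => ?_
  obtain ⟨U, hU, htU, hUd⟩ :=
    exists_open_of_continuousOn hfs.continuousOn (V.isOpen_dom (f t₀)) ht₀.1 (V.mem_dom _)
  refine ⟨U, hU, htU, ?_⟩
  have hA' : A ∩ g ⁻¹' W.dom b ∩ U ⊆ A := fun t h => h.1.1
  have hd : ∀ t ∈ A ∩ g ⁻¹' W.dom b ∩ U, f t ∈ V.dom (f t₀) := fun t h => hUd t ⟨h.1.1, h.2⟩
  -- The coordinates of $\theta^{-1}w$ in the frame of $V$ are those of $w$ in the image of that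
  -- frame under $\theta$. The image frame is of class $C^k$ by assumption, so no inverse has to be
  -- differentiated directly.
  let B : ∀ t ∈ A ∩ g ⁻¹' W.dom b ∩ U, Module.Basis (V.idx (f t₀)) ℂ (W.fiber (g t)) :=
    fun t h => (V.frame (f t₀) (f t) (hd t h)).map (θ t h.1.1)
  let c : V.idx (f t₀) → T → ℂ := fun i t =>
    if h : t ∈ A ∩ g ⁻¹' W.dom b ∩ U then (B t h).repr (W.frame b (g t) h.1.2 j) i else 0
  have hc : ∀ t (h : t ∈ A ∩ g ⁻¹' W.dom b ∩ U),
      W.frame b (g t) h.1.2 j = ∑ i, c i t • B t h i := by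
    intro t h
    simp only [c, dif_pos h]
    exact (Module.Basis.sum_repr _ _).symm
  have hcs : ∀ i, ContMDiffOn J 𝓘(ℝ, ℂ) k (c i) (A ∩ g ⁻¹' W.dom b ∩ U) :=
    contMDiffOn_repr_of_basis (hgs.continuousOn.mono hA') B
      (fun i => ((hθ (f t₀) i).mono fun t h => ⟨h.1.1, hd t h⟩).congr
        fun t h => Module.Basis.map_apply _ _ _)
      (W.frame_isSmoothAlong (hgs.mono hA') b (fun t h => h.1.2) j) hc
  refine (isSmoothAlong_frame_sum (hfs.mono hA') hd hcs).congr fun t h => ?_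
  rw [hc t h, map_sum]
  simp [B]

end VectorBundle

/-- Antilinearity replaces the coefficients by their conjugates, and the images of the frames are
$C^k$ by definition. -/
theorem RealVectorBundle.tau_isSmoothAlong {t : SmoothInvolution I N}
    (V : RealVectorBundle.{v} k t) {A : Set T} {f : T → N} (hfs : ContMDiffOn J I ∞ f A)
    {σ : ∀ s ∈ A, V.fiber (f s)} (hσ : V.IsSmoothAlong k J A f σ) :
    V.IsSmoothAlong k J A (fun s => t (f s)) (fun s h => V.tau (f s) (t (f s)) rfl (σ s h)) := by
  refine .of_local fun t₀ ht₀ => ?_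
  obtain ⟨U, hU, htU, hUd⟩ :=
    exists_open_of_continuousOn hfs.continuousOn (V.isOpen_dom (f t₀)) ht₀ (V.mem_dom _)
  obtain ⟨c, hc, he⟩ := (hσ.mono Set.inter_subset_left).contMDiffOn_repr hUd
  refine ⟨U, hU, htU, (isSmoothAlong_sum (σ := fun i s h => starRingEnd ℂ (c i s) •
    V.tau (f s) (t (f s)) rfl (V.frame (f t₀) (f s) (hUd s h) i)) fun i =>
      ((V.tau_smooth (f t₀) i).comp (hfs.mono Set.inter_subset_left) hUd).smul
        fun s h => contMDiffWithinAt_conj (hc i s h)).congr fun s h => ?_⟩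
  rw [he s h, map_sum]
  simp only [map_smulₛₗ]

theorem RealVectorBundle.Iso.homSmooth {t : SmoothInvolution I N}
    {V W : RealVectorBundle.{v} k t} (φ : RealVectorBundle.Iso V W) {A : Set T} {f : T → N}
    (hfs : ContMDiffOn J I ∞ f A) :
    HomSmooth V.toPreVectorBundle W.toPreVectorBundle k J A f f
      (fun s _ => (φ.equiv (f s)).toLinearMap) :=
  fun b j => (φ.smooth b j).comp (hfs.mono Set.inter_subset_left) fun _ h => h.2

end VectorBundleCalculus

/-! ### Local sections of submersions -/

/-- A submersion has smooth local sections through each point. -/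
theorem exists_local_section_of_isSubmersion {EM : Type*} [NormedAddCommGroup EM] [NormedSpace ℝ EM]
    {M : Type*} [TopologicalSpace M] [ChartedSpace EM M] [IsManifold 𝓘(ℝ, EM) ∞ M]
    {EY : Type*} [NormedAddCommGroup EY] [NormedSpace ℝ EY]
    {Y : Type*} [TopologicalSpace Y] [ChartedSpace EY Y] [IsManifold 𝓘(ℝ, EY) ∞ Y]
    {π : Y → M} (hπ : Manifold.IsSubmersion 𝓘(ℝ, EY) 𝓘(ℝ, EM) ∞ π) (y₀ : Y) :
    ∃ (U : Set M) (s : M → Y), IsOpen U ∧ π y₀ ∈ U ∧ ContMDiffOn 𝓘(ℝ, EM) 𝓘(ℝ, EY) ∞ s U ∧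
      s (π y₀) = y₀ ∧ ∀ m ∈ U, π (s m) = m := by
  have h := hπ.isSubmersionAt y₀
  have hy₀ := h.mem_domChart_source
  have hm₀ := h.mem_codChart_source
  have hw := h.writtenInCharts
  have hφ := h.domChart_mem_maximalAtlas
  have hψ := h.codChart_mem_maximalAtlas
  have hφψ := h.source_subset_preimage_source
  generalize h.equiv = e at *
  generalize h.domChart = φ at *
  generalize h.codChart = ψ at *
  replace hw : ∀ z ∈ φ.target, ψ (π (φ.symm z)) = (e z).1 := by
    intro z hz
    have := hw (x := z) (show z ∈ (φ.extend 𝓘(ℝ, EY)).target by simpa using hz)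
    simpa using this
  -- In the charts the submersion is a product projection through `e`. Freezing the complementary
  -- coordinate at its value for `y₀` gives a section of that projection.
  let j : EM → EY := fun a => e.symm (a, (e (φ y₀)).2)
  have hj : ContDiff ℝ ∞ j := e.symm.contDiff.comp (contDiff_id.prodMk contDiff_const)
  have hφ0 : j (ψ (π y₀)) = φ y₀ := by
    have := hw (φ y₀) (φ.map_source hy₀)
    rw [φ.left_inv hy₀] at this
    simp [j, this]
  have hψs := contMDiffOn_of_mem_maximalAtlas hψ
  have hjψ : ContMDiffOn 𝓘(ℝ, EM) 𝓘(ℝ, EY) ∞ (fun m => j (ψ m)) ψ.source :=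
    hj.contMDiff.comp_contMDiffOn hψs
  have hsub : ∀ m ∈ ψ.source ∩ (fun m => j (ψ m)) ⁻¹' φ.target, j (ψ m) ∈ φ.target :=
    fun m hm => hm.2
  refine ⟨ψ.source ∩ (fun m => j (ψ m)) ⁻¹' φ.target, fun m => φ.symm (j (ψ m)),
    hjψ.continuousOn.isOpen_inter_preimage ψ.open_source φ.open_target,
    ⟨hm₀, ?_⟩, ?_, ?_, ?_⟩
  · change j (ψ (π y₀)) ∈ φ.target
    rw [hφ0]
    exact φ.map_source hy₀
  · exact (contMDiffOn_symm_of_mem_maximalAtlas hφ).comp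
      (hjψ.mono Set.inter_subset_left) hsub
  · simp only [hφ0]
    exact φ.left_inv hy₀
  · intro m hm
    -- The chart `ψ` is injective on its source, so it suffices that `j` is a section in
    -- coordinates.
    refine ψ.injOn (hφψ (φ.map_target hm.2)) hm.1 ?_
    rw [hw _ hm.2]
    simp [j]

/-! ### Units, Real structures and smooth actions in a bundle gerbe -/

section GerbeAlgebra

variable {EM : Type*} [NormedAddCommGroup EM] [NormedSpace ℝ EM]
  {M : Type u} [TopologicalSpace M] [ChartedSpace EM M]
  {EY : Type*} [NormedAddCommGroup EY] [NormedSpace ℝ EY]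
  {Y : Type*} [TopologicalSpace Y] [ChartedSpace EY Y]
  {EX : Type*} [NormedAddCommGroup EX] [NormedSpace ℝ EX]
  {X : Type*} [TopologicalSpace X] [ChartedSpace EX X]
  {τ : SmoothInvolution 𝓘(ℝ, EM) M}
  {E' H' : Type*} [NormedAddCommGroup E'] [NormedSpace ℝ E'] [TopologicalSpace H']
  {J : ModelWithCorners ℝ E' H'} {T : Type*} [TopologicalSpace T] [ChartedSpace H' T]
  {A : Set T} {k : ℕ∞}

namespace BundleGerbe

variable (G : BundleGerbe.{u, w} EM M EY Y)

/-- The definition of a gerbe contains no unit. For any $p$ over the diagonal $pp=zp$ for some $z$,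
and then $z^{-1}p$ is idempotent. -/
theorem exists_idempotent (y : Y) : ∃ p : G.P.fiber ⟨(y, y), rfl⟩, G.mul rfl rfl p p = p := by
  obtain ⟨z, hz, -⟩ := G.P.torsor ⟨(y, y), rfl⟩ (G.P.sec ⟨(y, y), rfl⟩ ⟨(y, y), rfl⟩)
    (G.mul rfl rfl (G.P.sec ⟨(y, y), rfl⟩ ⟨(y, y), rfl⟩) (G.P.sec ⟨(y, y), rfl⟩ ⟨(y, y), rfl⟩))
  refine ⟨z⁻¹ • G.P.sec ⟨(y, y), rfl⟩ ⟨(y, y), rfl⟩, ?_⟩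
  rw [G.smul_mul, G.mul_smul, ← hz, inv_smul_smul]

/-- The neutral element of the fibre of `P` over `(y, y)`. -/
def one (y : Y) : G.P.fiber ⟨(y, y), rfl⟩ := (G.exists_idempotent y).choose

variable {G}

@[simp] theorem one_mul_one (y : Y) : G.mul rfl rfl (G.one y) (G.one y) = G.one y :=
  (G.exists_idempotent y).choose_spec

/-- The square of $z\cdot 1$ is $z^2\cdot 1$, and $z^2=z$ forces $z=1$. -/
theorem eq_one {y : Y} {p : G.P.fiber ⟨(y, y), rfl⟩} (h : G.mul rfl rfl p p = p) :
    p = G.one y := by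
  obtain ⟨z, rfl, -⟩ := G.P.torsor ⟨(y, y), rfl⟩ (G.one y) p
  rw [G.smul_mul, G.mul_smul, one_mul_one, smul_smul] at h
  have hz : z * z = z := PreCircleBundle.smul_right_cancel h
  rw [show z = 1 from mul_eq_left.1 hz, one_smul]

theorem inv_smul_eq_one {y : Y} {p : G.P.fiber ⟨(y, y), rfl⟩} {z : Circle}
    (h : G.mul rfl rfl p p = z • p) : z⁻¹ • p = G.one y := by
  apply eq_one
  rw [G.smul_mul, G.mul_smul, h, inv_smul_smul]

/-- If $1\cdot p=zp$, then associativity and $1\cdot 1=1$ give $zp=z^2p$, hence $z=1$. The right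
unit law is proved in the same way. -/
theorem one_mul {y₁ y₂ : Y} (h : G.proj y₁ = G.proj y₂) (p : G.P.fiber ⟨(y₁, y₂), h⟩) :
    G.mul rfl h (G.one y₁) p = p := by
  have h1 := PreCircleBundle.quot_smul p (G.mul rfl h (G.one y₁) p)
  set z := PreCircleBundle.quot p (G.mul rfl h (G.one y₁) p)
  have h2 := G.mul_assoc rfl rfl h (G.one y₁) (G.one y₁) p
  rw [one_mul_one, ← h1, G.mul_smul, ← h1, smul_smul] at h2
  have h3 := PreCircleBundle.smul_right_cancel h2
  rw [← h1, left_eq_mul.1 h3, one_smul]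

theorem mul_one {y₁ y₂ : Y} (h : G.proj y₁ = G.proj y₂) (p : G.P.fiber ⟨(y₁, y₂), h⟩) :
    G.mul h rfl p (G.one y₂) = p := by
  have h1 := PreCircleBundle.quot_smul p (G.mul h rfl p (G.one y₂))
  set z := PreCircleBundle.quot p (G.mul h rfl p (G.one y₂))
  have h2 := G.mul_assoc h rfl rfl p (G.one y₂) (G.one y₂)
  rw [one_mul_one, ← h1, G.smul_mul, ← h1, smul_smul] at h2
  have h3 : z * z = z := PreCircleBundle.smul_right_cancel h2
  rw [← h1, show z = 1 from mul_eq_left.1 h3, one_smul]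

/-- The axiom `mul_smooth` covers only products of the given local sections. Equivariance in both
factors extends it to all smooth sections along maps. -/
theorem mul_isSmoothAlong {y₁ y₂ y₃ : T → Y} (hy₁ : ContMDiffOn J 𝓘(ℝ, EY) ∞ y₁ A)
    (hy₂ : ContMDiffOn J 𝓘(ℝ, EY) ∞ y₂ A) (hy₃ : ContMDiffOn J 𝓘(ℝ, EY) ∞ y₃ A)
    {h₁₂ : ∀ t ∈ A, G.proj (y₁ t) = G.proj (y₂ t)} {h₂₃ : ∀ t ∈ A, G.proj (y₂ t) = G.proj (y₃ t)}
    {p : ∀ t (h : t ∈ A), G.P.fiber ⟨(y₁ t, y₂ t), h₁₂ t h⟩}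
    {q : ∀ t (h : t ∈ A), G.P.fiber ⟨(y₂ t, y₃ t), h₂₃ t h⟩}
    (hp : G.P.IsSmoothAlong J A (fun t => (y₁ t, y₂ t)) h₁₂ p)
    (hq : G.P.IsSmoothAlong J A (fun t => (y₂ t, y₃ t)) h₂₃ q) :
    G.P.IsSmoothAlong J A (fun t => (y₁ t, y₃ t)) (fun t h => (h₁₂ t h).trans (h₂₃ t h))
      (fun t h => G.mul (h₁₂ t h) (h₂₃ t h) (p t h) (q t h)) := by
  refine .of_local fun t₀ ht₀ => ?_
  obtain ⟨U, hU, htU, hUd⟩ := G.P.exists_open_dom (hy₁.prodMk hy₂).continuousOn h₁₂ ht₀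
  obtain ⟨U', hU', htU', hUd'⟩ := G.P.exists_open_dom (hy₂.prodMk hy₃).continuousOn h₂₃ ht₀
  have hs : A ∩ (U ∩ U') ⊆ A := Set.inter_subset_left
  obtain ⟨c, hc, he⟩ := (hp.mono hs).exists_coeff fun t h => hUd t ⟨h.1, h.2.1⟩
  obtain ⟨d, hd, he'⟩ := (hq.mono hs).exists_coeff fun t h => hUd' t ⟨h.1, h.2.2⟩
  refine ⟨U ∩ U', hU.inter hU', ⟨htU, htU'⟩, ?_⟩
  refine ((((G.mul_smooth ⟨_, h₁₂ t₀ ht₀⟩ ⟨_, h₂₃ t₀ ht₀⟩).comp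
    (g := fun t => (y₁ t, y₂ t, y₃ t)) ((hy₁.prodMk (hy₂.prodMk hy₃)).mono hs)
    fun t h => ⟨⟨h₁₂ t h.1, h₂₃ t h.1⟩, hUd t ⟨h.1, h.2.1⟩, hUd' t ⟨h.1, h.2.2⟩⟩).smul hd).smul
      hc).congr fun t h => ?_
  rw [he t h, he' t h, G.smul_mul, G.mul_smul]

/-- A local section $s$ over the diagonal satisfies $ss=cs$ with $c$ smooth, and the unit is
$c^{-1}s$. -/
theorem one_isSmoothAlong {y : T → Y} (hy : ContMDiffOn J 𝓘(ℝ, EY) ∞ y A) :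
    G.P.IsSmoothAlong J A (fun t => (y t, y t)) (fun _ _ => rfl) (fun t _ => G.one (y t)) := by
  refine .of_local fun t₀ ht₀ => ?_
  have hyy := hy.prodMk hy
  obtain ⟨U, hU, htU, hUd⟩ := G.P.exists_open_dom hyy.continuousOn
    (hf := fun _ _ => rfl) ht₀
  have hyU := hy.mono (Set.inter_subset_left : A ∩ U ⊆ A)
  have hyyU := hyy.mono (Set.inter_subset_left : A ∩ U ⊆ A)
  have hs := G.P.sec_isSmoothAlong hyyU (fun _ _ => rfl) ⟨(y t₀, y t₀), rfl⟩ hUd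
  have hm := G.mul_isSmoothAlong hyU hyU hyU hs hs
  obtain ⟨c, hc, he⟩ := CircleBundle.exists_quot hyyU.continuousOn hs hm
  refine ⟨U, hU, htU, (hs.smul fun t h => contMDiffWithinAt_circle_inv (hc t h)).congr
    fun t h => ?_⟩
  exact (inv_smul_eq_one (he t h)).symm

end BundleGerbe

namespace RealBundleGerbe

variable {G : RealBundleGerbe.{u, w} τ EY Y}

/-- The end points are free variables with equations, so that the axiom applies at points that are
only provably conjugate, such as $s_{\bar i}(\tau m)$ or $y=\tau(\tau y)$. The other primed variants
serve the same purpose. -/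
theorem tau_mul' {y₁ y₂ y₃ y₁' y₂' y₃' : Y} (e₁ : y₁' = G.tauY y₁) (e₂ : y₂' = G.tauY y₂)
    (e₃ : y₃' = G.tauY y₃) (h₁₂ : G.proj y₁ = G.proj y₂) (h₂₃ : G.proj y₂ = G.proj y₃)
    (h₁₂' : G.proj y₁' = G.proj y₂') (h₂₃' : G.proj y₂' = G.proj y₃')
    (p : G.P.fiber ⟨(y₁, y₂), h₁₂⟩) (q : G.P.fiber ⟨(y₂, y₃), h₂₃⟩) :
    G.tauP.tau ⟨(y₁, y₃), h₁₂.trans h₂₃⟩ ⟨(y₁', y₃'), h₁₂'.trans h₂₃'⟩ (Prod.ext e₁ e₃)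
        (G.mul h₁₂ h₂₃ p q) =
      G.mul h₁₂' h₂₃' (G.tauP.tau ⟨(y₁, y₂), h₁₂⟩ ⟨(y₁', y₂'), h₁₂'⟩ (Prod.ext e₁ e₂) p)
        (G.tauP.tau ⟨(y₂, y₃), h₂₃⟩ ⟨(y₂', y₃'), h₂₃'⟩ (Prod.ext e₂ e₃) q) := by
  subst e₁ e₂ e₃
  exact G.tau_mul h₁₂ h₂₃ p q

theorem tau_one {y y' : Y} (e : y' = G.tauY y) :
    G.tauP.tau ⟨(y, y), rfl⟩ ⟨(y', y'), rfl⟩ (Prod.ext e e) (G.one y) = G.one y' := by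
  apply BundleGerbe.eq_one
  rw [← tau_mul' e e e, BundleGerbe.one_mul_one]

end RealBundleGerbe

namespace RealModule

variable {G : RealBundleGerbe.{u, w} τ EY Y} (V : RealModule.{u, w, v} k G)

theorem tau_act' {y₁ y₂ y₁' y₂' : Y} (e₁ : y₁' = G.tauY y₁) (e₂ : y₂' = G.tauY y₂)
    (h : G.proj y₁ = G.proj y₂) (h' : G.proj y₁' = G.proj y₂') (p : G.P.fiber ⟨(y₁, y₂), h⟩)
    (x : V.fiber y₂) :
    V.tau y₁ y₁' e₁ (V.act h p x) =
      V.act h' (G.tauP.tau ⟨(y₁, y₂), h⟩ ⟨(y₁', y₂'), h'⟩ (Prod.ext e₁ e₂) p)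
        (V.tau y₂ y₂' e₂ x) := by
  subst e₁ e₂
  exact V.tau_act h p x

-- An invertible idempotent operator is the identity.
@[simp] theorem act_one (y : Y) (x : V.fiber y) : V.act rfl (G.one y) x = x := by
  refine (V.act rfl (G.one y)).injective ?_
  rw [← V.mul_act, BundleGerbe.one_mul_one]

/-- The action of a smooth section of `P` is smooth. -/
theorem act_homSmooth {y₁ y₂ : T → Y} (hy₁ : ContMDiffOn J 𝓘(ℝ, EY) ∞ y₁ A)
    (hy₂ : ContMDiffOn J 𝓘(ℝ, EY) ∞ y₂ A)
    {h : ∀ t ∈ A, G.proj (y₁ t) = G.proj (y₂ t)}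
    {p : ∀ t (ht : t ∈ A), G.P.fiber ⟨(y₁ t, y₂ t), h t ht⟩}
    (hp : G.P.IsSmoothAlong J A (fun t => (y₁ t, y₂ t)) h p) :
    PreVectorBundle.HomSmooth V.toPreVectorBundle V.toPreVectorBundle k J A y₂ y₁
      (fun t ht => (V.act (h t ht) (p t ht)).toLinearMap) := by
  refine .of_local fun t₀ ht₀ => ?_
  obtain ⟨U, hU, htU, hUd⟩ := G.P.exists_open_dom (hy₁.prodMk hy₂).continuousOn h ht₀
  have hs : A ∩ U ⊆ A := Set.inter_subset_left
  obtain ⟨c, hc, he⟩ := (hp.mono hs).exists_coeff hUd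
  refine ⟨U, hU, htU, fun b j => ?_⟩
  have hs' : A ∩ U ∩ y₂ ⁻¹' V.dom b ⊆ A ∩ U := Set.inter_subset_left
  refine (((V.act_smooth ⟨_, h t₀ ht₀⟩ b j).comp (g := fun t => (y₁ t, y₂ t))
    ((hy₁.prodMk hy₂).mono (hs'.trans hs)) fun t ht => ⟨h t ht.1.1, hUd t ht.1, ht.2⟩).circle_smul
      (hc.mono hs')).congr fun t ht => ?_
  exact (congrArg (fun q => V.act (h t ht.1.1) q (V.frame b (y₂ t) ht.2 j)) (he t ht.1)).trans
    (V.smul_act _ _ _ _)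

end RealModule

end GerbeAlgebra

/-! ### Division in the bundle of a stable isomorphism -/

section StableIsoAlgebra

variable {EM : Type*} [NormedAddCommGroup EM] [NormedSpace ℝ EM]
  {M : Type u} [TopologicalSpace M] [ChartedSpace EM M]
  {EY : Type*} [NormedAddCommGroup EY] [NormedSpace ℝ EY]
  {Y : Type*} [TopologicalSpace Y] [ChartedSpace EY Y]
  {EX : Type*} [NormedAddCommGroup EX] [NormedSpace ℝ EX]
  {X : Type*} [TopologicalSpace X] [ChartedSpace EX X]
  {τ : SmoothInvolution 𝓘(ℝ, EM) M}
  {E' H' : Type*} [NormedAddCommGroup E'] [NormedSpace ℝ E'] [TopologicalSpace H']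
  {J : ModelWithCorners ℝ E' H'} {T : Type*} [TopologicalSpace T] [ChartedSpace H' T]
  {A : Set T}
  {G : RealBundleGerbe.{u, w} τ EY Y} {G' : RealBundleGerbe.{u, w'} τ EX X}

namespace RealStableIso

variable (S : RealStableIso.{u, w, w', v} G G')

theorem act_isSmoothAlong {y₁ y₂ : T → Y} {x₁ x₂ : T → X}
    (hy₁ : ContMDiffOn J 𝓘(ℝ, EY) ∞ y₁ A) (hy₂ : ContMDiffOn J 𝓘(ℝ, EY) ∞ y₂ A)
    (hx₁ : ContMDiffOn J 𝓘(ℝ, EX) ∞ x₁ A) (hx₂ : ContMDiffOn J 𝓘(ℝ, EX) ∞ x₂ A)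
    {hy : ∀ t ∈ A, G.proj (y₁ t) = G.proj (y₂ t)} {hx : ∀ t ∈ A, G'.proj (x₁ t) = G'.proj (x₂ t)}
    {h₁ : ∀ t ∈ A, G.proj (y₁ t) = G'.proj (x₁ t)} {h₂ : ∀ t ∈ A, G.proj (y₂ t) = G'.proj (x₂ t)}
    {p : ∀ t (h : t ∈ A), G.P.fiber ⟨(y₁ t, y₂ t), hy t h⟩}
    {r : ∀ t (h : t ∈ A), S.R.fiber ⟨(y₁ t, x₁ t), h₁ t h⟩}
    {q : ∀ t (h : t ∈ A), G'.P.fiber ⟨(x₁ t, x₂ t), hx t h⟩}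
    (hp : G.P.IsSmoothAlong J A (fun t => (y₁ t, y₂ t)) hy p)
    (hr : S.R.IsSmoothAlong J A (fun t => (y₁ t, x₁ t)) h₁ r)
    (hq : G'.P.IsSmoothAlong J A (fun t => (x₁ t, x₂ t)) hx q) :
    S.R.IsSmoothAlong J A (fun t => (y₂ t, x₂ t)) h₂
      (fun t h => S.act (hy t h) (hx t h) (h₁ t h) (h₂ t h) (p t h) (r t h) (q t h)) := by
  refine .of_local fun t₀ ht₀ => ?_
  obtain ⟨U, hU, htU, hUd⟩ := G.P.exists_open_dom (hy₁.prodMk hy₂).continuousOn hy ht₀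
  obtain ⟨U', hU', htU', hUd'⟩ := S.R.exists_open_dom (hy₁.prodMk hx₁).continuousOn h₁ ht₀
  obtain ⟨U'', hU'', htU'', hUd''⟩ := G'.P.exists_open_dom (hx₁.prodMk hx₂).continuousOn hx ht₀
  have hs : A ∩ (U ∩ (U' ∩ U'')) ⊆ A := Set.inter_subset_left
  obtain ⟨c, hc, he⟩ := (hp.mono hs).exists_coeff fun t h => hUd t ⟨h.1, h.2.1⟩
  obtain ⟨d, hd, he'⟩ := (hr.mono hs).exists_coeff fun t h => hUd' t ⟨h.1, h.2.2.1⟩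
  obtain ⟨e, hee, he''⟩ := (hq.mono hs).exists_coeff fun t h => hUd'' t ⟨h.1, h.2.2.2⟩
  refine ⟨U ∩ (U' ∩ U''), hU.inter (hU'.inter hU''), ⟨htU, htU', htU''⟩, ?_⟩
  refine (((((S.act_smooth ⟨_, hy t₀ ht₀⟩ ⟨_, h₁ t₀ ht₀⟩ ⟨_, hx t₀ ht₀⟩).comp
    (g := fun t => ((y₁ t, y₂ t), (x₁ t, x₂ t)))
    (((hy₁.prodMk hy₂).prodMk (hx₁.prodMk hx₂)).mono hs)
    fun t h => ⟨⟨hy t h.1, hx t h.1, h₁ t h.1, h₂ t h.1⟩, hUd t ⟨h.1, h.2.1⟩,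
      hUd' t ⟨h.1, h.2.2.1⟩, hUd'' t ⟨h.1, h.2.2.2⟩⟩).smul hee).smul hd).smul
      fun t h => contMDiffWithinAt_circle_inv (hc t h)).congr fun t h => ?_
  rw [he t h, he' t h, he'' t h, S.act_smul_left, S.act_smul_middle, S.act_smul_right]

theorem tau_act' {y₁ y₂ y₁' y₂' : Y} {x₁ x₂ x₁' x₂' : X} (ey₁ : y₁' = G.tauY y₁)
    (ey₂ : y₂' = G.tauY y₂) (ex₁ : x₁' = G'.tauY x₁) (ex₂ : x₂' = G'.tauY x₂)
    (hy : G.proj y₁ = G.proj y₂) (hx : G'.proj x₁ = G'.proj x₂) (h₁ : G.proj y₁ = G'.proj x₁)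
    (h₂ : G.proj y₂ = G'.proj x₂) (hy' : G.proj y₁' = G.proj y₂') (hx' : G'.proj x₁' = G'.proj x₂')
    (h₁' : G.proj y₁' = G'.proj x₁') (h₂' : G.proj y₂' = G'.proj x₂') (p r q) :
    S.tau.tau ⟨(y₂, x₂), h₂⟩ ⟨(y₂', x₂'), h₂'⟩ (Prod.ext ey₂ ex₂) (S.act hy hx h₁ h₂ p r q) =
      S.act hy' hx' h₁' h₂'
        (G.tauP.tau ⟨(y₁, y₂), hy⟩ ⟨(y₁', y₂'), hy'⟩ (Prod.ext ey₁ ey₂) p)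
        (S.tau.tau ⟨(y₁, x₁), h₁⟩ ⟨(y₁', x₁'), h₁'⟩ (Prod.ext ey₁ ex₁) r)
        (G'.tauP.tau ⟨(x₁, x₂), hx⟩ ⟨(x₁', x₂'), hx'⟩ (Prod.ext ex₁ ex₂) q) := by
  subst ey₁ ey₂ ex₁ ex₂
  exact S.tau_act hy hx h₁ h₂ p r q

/-- With `r₁` and `q` fixed, `act` is an anti-equivariant map between circle torsors, hence a
bijection. Start from any `p` and correct it by the inverse of the discrepancy. -/
theorem exists_solution {y₁ y₂ : Y} {x₁ x₂ : X} (hy : G.proj y₁ = G.proj y₂)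
    (hx : G'.proj x₁ = G'.proj x₂) (h₁ : G.proj y₁ = G'.proj x₁) (h₂ : G.proj y₂ = G'.proj x₂)
    (r₁ : S.R.fiber ⟨(y₁, x₁), h₁⟩) (q : G'.P.fiber ⟨(x₁, x₂), hx⟩)
    (r₂ : S.R.fiber ⟨(y₂, x₂), h₂⟩) : ∃ p, S.act hy hx h₁ h₂ p r₁ q = r₂ := by
  obtain ⟨z, hz, -⟩ := S.R.torsor _ (S.act hy hx h₁ h₂ (G.P.sec ⟨(y₁, y₂), hy⟩ ⟨(y₁, y₂), hy⟩) r₁ q) r₂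
  exact ⟨z⁻¹ • G.P.sec ⟨(y₁, y₂), hy⟩ ⟨(y₁, y₂), hy⟩, by rw [S.act_smul_left, inv_inv, hz]⟩

/-- The element `p` for which `act p r₁ q = r₂`. -/
def solve {y₁ y₂ : Y} {x₁ x₂ : X} (hy : G.proj y₁ = G.proj y₂)
    (hx : G'.proj x₁ = G'.proj x₂) (h₁ : G.proj y₁ = G'.proj x₁) (h₂ : G.proj y₂ = G'.proj x₂)
    (r₁ : S.R.fiber ⟨(y₁, x₁), h₁⟩) (q : G'.P.fiber ⟨(x₁, x₂), hx⟩)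
    (r₂ : S.R.fiber ⟨(y₂, x₂), h₂⟩) : G.P.fiber ⟨(y₁, y₂), hy⟩ :=
  (S.exists_solution hy hx h₁ h₂ r₁ q r₂).choose

variable {y₁ y₂ y₃ : Y} {x₁ x₂ x₃ : X} (hy : G.proj y₁ = G.proj y₂)
    (hx : G'.proj x₁ = G'.proj x₂) (h₁ : G.proj y₁ = G'.proj x₁) (h₂ : G.proj y₂ = G'.proj x₂)

theorem act_solve (r₁ q r₂) :
    S.act hy hx h₁ h₂ (S.solve hy hx h₁ h₂ r₁ q r₂) r₁ q = r₂ :=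
  (S.exists_solution hy hx h₁ h₂ r₁ q r₂).choose_spec

/-- Uniqueness of the solution. Each identity for `solve` below is proved by checking that the other
side solves the same equation. -/
theorem solve_eq {p r₁ q r₂} (h : S.act hy hx h₁ h₂ p r₁ q = r₂) :
    S.solve hy hx h₁ h₂ r₁ q r₂ = p := by
  have h' := S.act_solve hy hx h₁ h₂ r₁ q r₂
  obtain ⟨z, hz, -⟩ := G.P.torsor _ p (S.solve hy hx h₁ h₂ r₁ q r₂)
  rw [← hz, S.act_smul_left, h] at h'
  have hz1 : z⁻¹ = 1 :=
    PreCircleBundle.smul_right_cancel (h'.trans (one_smul _ _).symm)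
  rw [← hz, inv_eq_one.1 hz1, one_smul]

/-- Carrying `r₁` to `r₂` and then to `r₃` carries `r₁` to `r₃`. This is the cocycle condition
behind the descent. -/
theorem solve_mul (hy' : G.proj y₂ = G.proj y₃) (hx' : G'.proj x₂ = G'.proj x₃)
    (h₃ : G.proj y₃ = G'.proj x₃) (r₁ q r₂ q' r₃) :
    G.mul hy hy' (S.solve hy hx h₁ h₂ r₁ q r₂) (S.solve hy' hx' h₂ h₃ r₂ q' r₃) =
      S.solve (hy.trans hy') (hx.trans hx') h₁ h₃ r₁ (G'.mul hx hx' q q') r₃ := by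
  symm
  apply S.solve_eq
  rw [S.act_mul hy hy' hx hx' h₁ h₂ h₃, S.act_solve, S.act_solve]

theorem smul_solve (z : Circle) (r₁ q r₂) :
    S.solve hy hx h₁ h₂ (z • r₁) q r₂ = z • S.solve hy hx h₁ h₂ r₁ q r₂ := by
  apply S.solve_eq
  rw [S.act_smul_left, S.act_smul_middle, inv_smul_smul, S.act_solve]

theorem solve_smul (z : Circle) (r₁ q r₂) :
    S.solve hy hx h₁ h₂ r₁ (z • q) r₂ = z • S.solve hy hx h₁ h₂ r₁ q r₂ := by
  apply S.solve_eq
  rw [S.act_smul_left, S.act_smul_right, inv_smul_smul, S.act_solve]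

theorem tau_solve {y₁' y₂' : Y} {x₁' x₂' : X} (ey₁ : y₁' = G.tauY y₁)
    (ey₂ : y₂' = G.tauY y₂) (ex₁ : x₁' = G'.tauY x₁) (ex₂ : x₂' = G'.tauY x₂)
    (hy' : G.proj y₁' = G.proj y₂') (hx' : G'.proj x₁' = G'.proj x₂')
    (h₁' : G.proj y₁' = G'.proj x₁') (h₂' : G.proj y₂' = G'.proj x₂') (r₁ q r₂) :
    G.tauP.tau ⟨(y₁, y₂), hy⟩ ⟨(y₁', y₂'), hy'⟩ (Prod.ext ey₁ ey₂) (S.solve hy hx h₁ h₂ r₁ q r₂) =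
      S.solve hy' hx' h₁' h₂'
        (S.tau.tau ⟨(y₁, x₁), h₁⟩ ⟨(y₁', x₁'), h₁'⟩ (Prod.ext ey₁ ex₁) r₁)
        (G'.tauP.tau ⟨(x₁, x₂), hx⟩ ⟨(x₁', x₂'), hx'⟩ (Prod.ext ex₁ ex₂) q)
        (S.tau.tau ⟨(y₂, x₂), h₂⟩ ⟨(y₂', x₂'), h₂'⟩ (Prod.ext ey₂ ex₂) r₂) := by
  symm
  apply S.solve_eq
  rw [← S.tau_act' ey₁ ey₂ ex₁ ex₂ hy hx h₁ h₂, S.act_solve]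

/-- Locally, act with any smooth section of $P$, compare the result with `r₂`, and divide the
section by this smooth quotient: it is the construction of `exists_solution` carried out in
families. -/
theorem solve_isSmoothAlong {y₁ y₂ : T → Y} {x₁ x₂ : T → X}
    (hy₁ : ContMDiffOn J 𝓘(ℝ, EY) ∞ y₁ A) (hy₂ : ContMDiffOn J 𝓘(ℝ, EY) ∞ y₂ A)
    (hx₁ : ContMDiffOn J 𝓘(ℝ, EX) ∞ x₁ A) (hx₂ : ContMDiffOn J 𝓘(ℝ, EX) ∞ x₂ A)
    {hy : ∀ t ∈ A, G.proj (y₁ t) = G.proj (y₂ t)} {hx : ∀ t ∈ A, G'.proj (x₁ t) = G'.proj (x₂ t)}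
    {h₁ : ∀ t ∈ A, G.proj (y₁ t) = G'.proj (x₁ t)} {h₂ : ∀ t ∈ A, G.proj (y₂ t) = G'.proj (x₂ t)}
    {r₁ : ∀ t (h : t ∈ A), S.R.fiber ⟨(y₁ t, x₁ t), h₁ t h⟩}
    {q : ∀ t (h : t ∈ A), G'.P.fiber ⟨(x₁ t, x₂ t), hx t h⟩}
    {r₂ : ∀ t (h : t ∈ A), S.R.fiber ⟨(y₂ t, x₂ t), h₂ t h⟩}
    (hr₁ : S.R.IsSmoothAlong J A (fun t => (y₁ t, x₁ t)) h₁ r₁)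
    (hq : G'.P.IsSmoothAlong J A (fun t => (x₁ t, x₂ t)) hx q)
    (hr₂ : S.R.IsSmoothAlong J A (fun t => (y₂ t, x₂ t)) h₂ r₂) :
    G.P.IsSmoothAlong J A (fun t => (y₁ t, y₂ t)) hy
      (fun t h => S.solve (hy t h) (hx t h) (h₁ t h) (h₂ t h) (r₁ t h) (q t h) (r₂ t h)) := by
  refine .of_local fun t₀ ht₀ => ?_
  obtain ⟨U, hU, htU, hUd⟩ := G.P.exists_open_dom (hy₁.prodMk hy₂).continuousOn hy ht₀
  have hs : A ∩ U ⊆ A := Set.inter_subset_left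
  have hp := G.P.sec_isSmoothAlong ((hy₁.prodMk hy₂).mono hs) (fun t h => hy t h.1)
    ⟨_, hy t₀ ht₀⟩ hUd
  have ha := S.act_isSmoothAlong (hy₁.mono hs) (hy₂.mono hs) (hx₁.mono hs) (hx₂.mono hs)
    (h₂ := fun t h => h₂ t h.1) hp (hr₁.mono hs) (hq.mono hs)
  obtain ⟨c, hc, he⟩ := CircleBundle.exists_quot ((hy₂.prodMk hx₂).continuousOn.mono hs) ha
    (hr₂.mono hs)
  refine ⟨U, hU, htU, (hp.smul fun t h => contMDiffWithinAt_circle_inv (hc t h)).congr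
    fun t h => ?_⟩
  apply S.solve_eq
  rw [S.act_smul_left, inv_inv, he t h]

end RealStableIso

end StableIsoAlgebra

/-! ### The descended vector bundle and its frames -/

section Descent

variable {EM : Type*} [NormedAddCommGroup EM] [NormedSpace ℝ EM]
  {M : Type u} [TopologicalSpace M] [ChartedSpace EM M]
  {EY : Type*} [NormedAddCommGroup EY] [NormedSpace ℝ EY]
  {Y : Type*} [TopologicalSpace Y] [ChartedSpace EY Y]
  {EX : Type*} [NormedAddCommGroup EX] [NormedSpace ℝ EX]
  {X : Type*} [TopologicalSpace X] [ChartedSpace EX X]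
  {τ : SmoothInvolution 𝓘(ℝ, EM) M}
  {E' H' : Type*} [NormedAddCommGroup E'] [NormedSpace ℝ E'] [TopologicalSpace H']
  {J : ModelWithCorners ℝ E' H'} {T : Type*} [TopologicalSpace T] [ChartedSpace H' T]
  {A : Set T} {k : ℕ∞}
  {G : RealBundleGerbe.{u, w} τ EY Y} {G' : RealBundleGerbe.{u, w'} τ EX X}

theorem RealBundleGerbe.proj_eq_of_tau {y y' : Y} {x x' : X} (ey : y' = G.tauY y)
    (ex : x' = G'.tauY x) (h : G.proj y = G'.proj x) : G.proj y' = G'.proj x' := by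
  rw [ey, ex, G.proj_tauY, G'.proj_tauY, h]

namespace RealStableIso

variable (S : RealStableIso.{u, w, w', u'} G G')

/-- A smooth local section of `Y ×_M X → X` near `x₀` with a smooth section of `R` along it, which lies
in the domain of one of the frames of `V`. -/
structure LocalLift (V : PreVectorBundle.{v} Y) (x₀ : X) where
  dom : Set X
  isOpen_dom : IsOpen dom
  mem_dom : x₀ ∈ dom
  y : X → Y
  y_smooth : ContMDiffOn 𝓘(ℝ, EX) 𝓘(ℝ, EY) ∞ y dom
  proj_y : ∀ x ∈ dom, G.proj (y x) = G'.proj x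
  r : ∀ x (h : x ∈ dom), S.R.fiber ⟨(y x, x), proj_y x h⟩
  r_smooth : S.R.IsSmoothAlong 𝓘(ℝ, EX) dom (fun x => (y x, x)) proj_y r
  b : Y
  y_mem : ∀ x ∈ dom, y x ∈ V.dom b

/-- Composing $X\to M$ with a local section of $Y\to M$ gives `y`. A local section of $R$ along
$(y(x),x)$ gives `r`, after shrinking to its domain and to the domain of a frame of $V$. -/
theorem nonempty_localLift [IsManifold 𝓘(ℝ, EM) ∞ M] [IsManifold 𝓘(ℝ, EY) ∞ Y]
    [IsManifold 𝓘(ℝ, EX) ∞ X] (V : PreVectorBundle.{v} Y) (x₀ : X) :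
    Nonempty (S.LocalLift V x₀) := by
  obtain ⟨y₀, hy₀⟩ := G.proj_surjective (G'.proj x₀)
  obtain ⟨U, s, hU, hyU, hs, -, hps⟩ :=
    exists_local_section_of_isSubmersion G.proj_submersion y₀
  have hX : ContMDiff 𝓘(ℝ, EX) 𝓘(ℝ, EM) ∞ G'.proj := G'.proj_submersion.contMDiff
  let D : Set X := G'.proj ⁻¹' U
  have hD : IsOpen D := hU.preimage hX.continuous
  have hxD : x₀ ∈ D := by simpa [D, hy₀] using hyU
  have hy : ContMDiffOn 𝓘(ℝ, EX) 𝓘(ℝ, EY) ∞ (fun x => s (G'.proj x)) D :=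
    hs.comp hX.contMDiffOn fun x hx => hx
  have hp : ∀ x ∈ D, G.proj (s (G'.proj x)) = G'.proj x := fun x hx => hps _ hx
  have hyx := hy.prodMk (contMDiffOn_id (I := 𝓘(ℝ, EX)) (n := ∞) (s := D))
  obtain ⟨U', hU', hxU', hUd'⟩ := S.R.exists_open_dom hyx.continuousOn hp hxD
  obtain ⟨U'', hU'', hxU'', hUd''⟩ := exists_open_of_continuousOn hy.continuousOn
    (V.isOpen_dom (s (G'.proj x₀))) hxD (V.mem_dom _)
  have hs : D ∩ (U' ∩ U'') ⊆ D := Set.inter_subset_left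
  exact ⟨{
    dom := D ∩ (U' ∩ U'')
    isOpen_dom := hD.inter (hU'.inter hU'')
    mem_dom := ⟨hxD, hxU', hxU''⟩
    y := fun x => s (G'.proj x)
    y_smooth := hy.mono hs
    proj_y := fun x hx => hp x hx.1
    r := fun x hx => S.R.sec ⟨(s (G'.proj x₀), x₀), hp x₀ hxD⟩ ⟨(s (G'.proj x), x), hp x hx.1⟩
    r_smooth := S.R.sec_isSmoothAlong (hyx.mono hs) (fun x hx => hp x hx.1)
      ⟨(s (G'.proj x₀), x₀), hp x₀ hxD⟩ fun x hx => hUd' x ⟨hx.1, hx.2.1⟩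
    b := s (G'.proj x₀)
    y_mem := fun x hx => hUd'' x ⟨hx.1, hx.2.2⟩ }⟩

/-- A choice of a point of `Y` over each point of `X`. -/
def baseY (_ : RealStableIso.{u, w, w', u'} G G') (x : X) : Y :=
  (G.proj_surjective (G'.proj x)).choose

theorem proj_baseY (x : X) : G.proj (S.baseY x) = G'.proj x :=
  (G.proj_surjective (G'.proj x)).choose_spec

/-- A choice of a point of `R` over each point of `X`. -/
def baseR (x : X) : S.R.fiber ⟨(S.baseY x, x), S.proj_baseY x⟩ :=
  S.R.sec ⟨(S.baseY x, x), S.proj_baseY x⟩ ⟨(S.baseY x, x), S.proj_baseY x⟩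

variable (V : RealModule.{u, w, v} k G)

/-- The isomorphism of the fibre of the descended module with a fibre of the given module. -/
def descentEquiv {y : Y} {x : X} (h : G.proj y = G'.proj x) (r : S.R.fiber ⟨(y, x), h⟩) :
    V.fiber (S.baseY x) ≃ₗ[ℂ] V.fiber y :=
  V.act (h.trans (S.proj_baseY x).symm)
    -- The element of $P$ that carries `r` to the base point of $R$ while the point `x` stays fixed.
    (S.solve (h.trans (S.proj_baseY x).symm) rfl h (S.proj_baseY x) r (G'.one x) (S.baseR x))

/-- The action of `Q` on the fibres of the descended module. -/
def descentAct {x₁ x₂ : X} (hx : G'.proj x₁ = G'.proj x₂) (q : G'.P.fiber ⟨(x₁, x₂), hx⟩) :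
    V.fiber (S.baseY x₂) ≃ₗ[ℂ] V.fiber (S.baseY x₁) :=
  V.act ((S.proj_baseY x₁).trans (hx.trans (S.proj_baseY x₂).symm))
    (S.solve _ hx (S.proj_baseY x₁) (S.proj_baseY x₂) (S.baseR x₁) q (S.baseR x₂))

/-- The Real structure on the fibres of the descended module. -/
def descentTau {x x' : X} (e : x' = G'.tauY x) :
    V.fiber (S.baseY x) →ₛₗ[starRingEnd ℂ] V.fiber (S.baseY x') :=
  (S.descentEquiv V (RealBundleGerbe.proj_eq_of_tau rfl e (S.proj_baseY x))
    (S.tau.tau ⟨(S.baseY x, x), S.proj_baseY x⟩ ⟨(G.tauY (S.baseY x), x'),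
      RealBundleGerbe.proj_eq_of_tau rfl e (S.proj_baseY x)⟩ (Prod.ext rfl e) (S.baseR x))).symm.toLinearMap.comp
    (V.tau (S.baseY x) (G.tauY (S.baseY x)) rfl)

/-- Both sides are the action of one element of $P$, which solves for the base point over `x₂` from
`r₁`: the left passes through `r₂` with $q\cdot 1$, the right through the base point over `x₁` with
$1\cdot q$. -/
theorem act_solve_descentEquiv {y₁ y₂ : Y} {x₁ x₂ : X} (hy : G.proj y₁ = G.proj y₂)
    (hx : G'.proj x₁ = G'.proj x₂) (h₁ : G.proj y₁ = G'.proj x₁) (h₂ : G.proj y₂ = G'.proj x₂)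
    (r₁ q r₂) (ξ : V.fiber (S.baseY x₂)) :
    V.act hy (S.solve hy hx h₁ h₂ r₁ q r₂) (S.descentEquiv V h₂ r₂ ξ) =
      S.descentEquiv V h₁ r₁ (S.descentAct V hx q ξ) := by
  unfold descentEquiv descentAct
  rw [← V.mul_act, ← V.mul_act, S.solve_mul, S.solve_mul, BundleGerbe.one_mul, BundleGerbe.mul_one]

/-- Every `p` is the solution of the equation that defines `act p r q`, so the previous lemma covers
all `p`. This is the equivariance demanded of an intertwiner. -/
theorem act_descentEquiv {y₁ y₂ : Y} {x₁ x₂ : X} (hy : G.proj y₁ = G.proj y₂)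
    (hx : G'.proj x₁ = G'.proj x₂) (h₁ : G.proj y₁ = G'.proj x₁) (h₂ : G.proj y₂ = G'.proj x₂)
    (p r q) (ξ : V.fiber (S.baseY x₂)) :
    V.act hy p (S.descentEquiv V h₂ (S.act hy hx h₁ h₂ p r q) ξ) =
      S.descentEquiv V h₁ r (S.descentAct V hx q ξ) := by
  rw [← act_solve_descentEquiv (hy := hy) (h₂ := h₂) (r₂ := S.act hy hx h₁ h₂ p r q),
    S.solve_eq hy hx h₁ h₂ rfl]

/-- Replacing one lift of `x` by another changes the identification by the action of $P$. The
arbitrary base point drops out, so this formula is what all smoothness proofs for the descent use.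
-/
theorem descentEquiv_symm {y₁ y₂ : Y} {x : X} (hy : G.proj y₁ = G.proj y₂)
    (h₁ : G.proj y₁ = G'.proj x) (h₂ : G.proj y₂ = G'.proj x) (r₁ r₂) (η : V.fiber y₂) :
    S.descentEquiv V h₁ r₁ ((S.descentEquiv V h₂ r₂).symm η) =
      V.act hy (S.solve hy rfl h₁ h₂ r₁ (G'.one x) r₂) η := by
  obtain ⟨ξ, rfl⟩ := (S.descentEquiv V h₂ r₂).surjective η
  rw [LinearEquiv.symm_apply_apply]
  unfold descentEquiv
  rw [← V.mul_act, S.solve_mul, BundleGerbe.one_mul_one]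

theorem descentEquiv_smul {y : Y} {x : X} (h : G.proj y = G'.proj x) (z : Circle) (r)
    (ξ : V.fiber (S.baseY x)) :
    S.descentEquiv V h (z • r) ξ = (z : ℂ) • S.descentEquiv V h r ξ := by
  unfold descentEquiv
  rw [S.smul_solve, V.smul_act]

/-- The conjugate of the base point over `x` need not be the base point over `x'`. `descentTau`
corrects for this by construction at the base lift, and `descentEquiv_symm` together with
`tau_solve` spreads the relation to all lifts. -/
theorem descentEquiv_tau {y y' : Y} {x x' : X} (ey : y' = G.tauY y) (ex : x' = G'.tauY x)
    (h : G.proj y = G'.proj x) (h' : G.proj y' = G'.proj x') (r : S.R.fiber ⟨(y, x), h⟩)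
    (ξ : V.fiber (S.baseY x)) :
    S.descentEquiv V h' (S.tau.tau ⟨(y, x), h⟩ ⟨(y', x'), h'⟩ (Prod.ext ey ex) r)
      (S.descentTau V ex ξ) = V.tau y y' ey (S.descentEquiv V h r ξ) := by
  have hb := RealBundleGerbe.proj_eq_of_tau rfl ex (S.proj_baseY x)
  refine (S.descentEquiv_symm V (h'.trans hb.symm) h' hb _ _ _).trans ?_
  unfold descentEquiv
  rw [V.tau_act' ey rfl (h.trans (S.proj_baseY x).symm) (h'.trans hb.symm),
    S.tau_solve _ _ _ _ ey rfl ex ex (h'.trans hb.symm) rfl h' hb, RealBundleGerbe.tau_one ex]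

variable [IsManifold 𝓘(ℝ, EM) ∞ M] [IsManifold 𝓘(ℝ, EY) ∞ Y] [IsManifold 𝓘(ℝ, EX) ∞ X]

/-- A choice of local lifts. -/
def localLift (V : PreVectorBundle.{v} Y) (x₀ : X) : S.LocalLift V x₀ :=
  (S.nonempty_localLift V x₀).some

/-- The vector bundle underlying the descended module. -/
def descentBundle : PreVectorBundle.{v} X where
  fiber x := V.fiber (S.baseY x)
  dom x₀ := (S.localLift V.toPreVectorBundle x₀).dom
  isOpen_dom x₀ := (S.localLift V.toPreVectorBundle x₀).isOpen_dom
  mem_dom x₀ := (S.localLift V.toPreVectorBundle x₀).mem_dom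
  idx x₀ := V.idx (S.localLift V.toPreVectorBundle x₀).b
  frame x₀ x h := (V.frame (S.localLift V.toPreVectorBundle x₀).b _
    ((S.localLift V.toPreVectorBundle x₀).y_mem x h)).map
      (S.descentEquiv V ((S.localLift V.toPreVectorBundle x₀).proj_y x h)
        ((S.localLift V.toPreVectorBundle x₀).r x h)).symm

/-- The isomorphism of the fibre of the descended bundle with a fibre of the given module. -/
def descentIso {y : Y} {x : X} (h : G.proj y = G'.proj x) (r : S.R.fiber ⟨(y, x), h⟩) :
    (S.descentBundle V).fiber x ≃ₗ[ℂ] V.fiber y :=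
  S.descentEquiv V h r

theorem descentIso_symm {y₁ y₂ : Y} {x : X} (hy : G.proj y₁ = G.proj y₂)
    (h₁ : G.proj y₁ = G'.proj x) (h₂ : G.proj y₂ = G'.proj x) (r₁ r₂) (η : V.fiber y₂) :
    S.descentIso V h₁ r₁ ((S.descentIso V h₂ r₂).symm η) =
      V.act hy (S.solve hy rfl h₁ h₂ r₁ (G'.one x) r₂) η :=
  S.descentEquiv_symm V hy h₁ h₂ r₁ r₂ η

theorem descentBundle_frame (x₀ x : X) (h : x ∈ (S.descentBundle V).dom x₀)
    (j : (S.descentBundle V).idx x₀) :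
    (S.descentBundle V).frame x₀ x h j =
      (S.descentIso V ((S.localLift V.toPreVectorBundle x₀).proj_y x h)
        ((S.localLift V.toPreVectorBundle x₀).r x h)).symm
        (V.frame (S.localLift V.toPreVectorBundle x₀).b _
          ((S.localLift V.toPreVectorBundle x₀).y_mem x h) j) :=
  (Module.Basis.map_apply (V.frame (S.localLift V.toPreVectorBundle x₀).b _
    ((S.localLift V.toPreVectorBundle x₀).y_mem x h))
      (S.descentEquiv V ((S.localLift V.toPreVectorBundle x₀).proj_y x h)
        ((S.localLift V.toPreVectorBundle x₀).r x h)).symm j :)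

section Sections

variable {f : T → X} {y : T → Y} (hfs : ContMDiffOn J 𝓘(ℝ, EX) ∞ f A)
  (hys : ContMDiffOn J 𝓘(ℝ, EY) ∞ y A) {h : ∀ t ∈ A, G.proj (y t) = G'.proj (f t)}
  {r : ∀ t (ht : t ∈ A), S.R.fiber ⟨(y t, f t), h t ht⟩}
  (hr : S.R.IsSmoothAlong J A (fun t => (y t, f t)) h r)

include hfs hys hr

/-- On a frame coming from a local lift, the map is the action of a `solve` section of $P$ on a
frame of $V$, and that section is smooth. -/
theorem descentEquiv_homSmooth :
    PreVectorBundle.HomSmooth (S.descentBundle V) V.toPreVectorBundle k J A f y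
      (fun t ht => (S.descentIso V (h t ht) (r t ht)).toLinearMap) := by
  intro b j
  set L := S.localLift V.toPreVectorBundle b with hL
  have hs : A ∩ f ⁻¹' L.dom ⊆ A := Set.inter_subset_left
  have hLs : ContMDiffOn J 𝓘(ℝ, EY) ∞ (fun t => L.y (f t)) (A ∩ f ⁻¹' L.dom) :=
    L.y_smooth.comp (hfs.mono hs) fun t ht => ht.2
  have hp := S.solve_isSmoothAlong (hys.mono hs) hLs (hfs.mono hs) (hfs.mono hs)
    (hy := fun t ht => (h t ht.1).trans (L.proj_y _ ht.2).symm)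
    (h₂ := fun t ht => L.proj_y _ ht.2) (hr.mono hs) (BundleGerbe.one_isSmoothAlong (hfs.mono hs))
    (L.r_smooth.comp (hfs.mono hs) fun t ht => ht.2)
  refine ((V.act_homSmooth (hys.mono hs) hLs hp).apply hLs.continuousOn
    (V.frame_isSmoothAlong hLs L.b (fun t ht => L.y_mem _ ht.2) j)).congr fun t ht => ?_
  exact (congrArg (S.descentIso V (h t ht.1) (r t ht.1)) (S.descentBundle_frame V b _ ht.2 j)).trans
    (S.descentIso_symm V _ _ _ _ _ _)

/-- The coordinates in a descended frame are the coordinates in $V$ after transport to the lift of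
that frame, which is an action of a smooth section of $P$. `VectorBundle.homSmooth_symm` is not
available at this stage: smoothness of the descended frames is itself deduced from this lemma. -/
theorem descentEquiv_symm_isSmoothAlong {σ : ∀ t ∈ A, V.fiber (y t)}
    (hσ : V.IsSmoothAlong k J A y σ) :
    (S.descentBundle V).IsSmoothAlong k J A f
      (fun t ht => (S.descentIso V (h t ht) (r t ht)).symm (σ t ht)) := by
  refine PreVectorBundle.isSmoothAlong_of_coeff hfs.continuousOn fun b U hU hd => ?_
  set L := S.localLift V.toPreVectorBundle b with hL
  have hs : A ∩ U ⊆ A := Set.inter_subset_left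
  have hLs : ContMDiffOn J 𝓘(ℝ, EY) ∞ (fun t => L.y (f t)) (A ∩ U) :=
    L.y_smooth.comp (hfs.mono hs) hd
  have hp := S.solve_isSmoothAlong hLs (hys.mono hs) (hfs.mono hs) (hfs.mono hs)
    (hy := fun t ht => (L.proj_y _ (hd t ht)).trans (h t ht.1).symm)
    (h₁ := fun t ht => L.proj_y _ (hd t ht))
    (L.r_smooth.comp (hfs.mono hs) hd) (BundleGerbe.one_isSmoothAlong (hfs.mono hs)) (hr.mono hs)
  obtain ⟨c, hc, he⟩ := ((V.act_homSmooth hLs (hys.mono hs) hp).apply (hys.mono hs).continuousOn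
    (hσ.mono hs)).contMDiffOn_repr (b := L.b) fun t ht => L.y_mem _ (hd t ht)
  refine ⟨c, hc, fun t ht => ?_⟩
  apply (S.descentIso V (L.proj_y _ (hd t ht)) (L.r _ (hd t ht))).injective
  refine (S.descentIso_symm V _ _ _ _ _ _).trans ((he t ht).trans ?_)
  refine Eq.trans ?_ (map_sum _ _ _).symm
  refine Finset.sum_congr rfl fun i _ => ?_
  refine Eq.trans ?_ (map_smul _ _ _).symm
  congr 1
  exact ((LinearEquiv.symm_apply_eq _).1 (S.descentBundle_frame V b _ (hd t ht) i).symm)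

end Sections

end RealStableIso

end Descent

/-! ### The module structure and Real structure of the descent -/

section DescentModule

variable {EM : Type*} [NormedAddCommGroup EM] [NormedSpace ℝ EM]
  {M : Type u} [TopologicalSpace M] [ChartedSpace EM M]
  {EY : Type*} [NormedAddCommGroup EY] [NormedSpace ℝ EY]
  {Y : Type*} [TopologicalSpace Y] [ChartedSpace EY Y]
  {EX : Type*} [NormedAddCommGroup EX] [NormedSpace ℝ EX]
  {X : Type*} [TopologicalSpace X] [ChartedSpace EX X]
  {τ : SmoothInvolution 𝓘(ℝ, EM) M} {k : ℕ∞}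
  {G : RealBundleGerbe.{u, w} τ EY Y} {G' : RealBundleGerbe.{u, w'} τ EX X}

namespace RealStableIso

variable (S : RealStableIso.{u, w, w', u'} G G') (V : RealModule.{u, w, v} k G)

/-- Transported into $V$, the two conjugations become those of $R$ and $V$ by `descentEquiv_tau`,
and these are involutive. -/
theorem descentTau_descentTau {x x' : X} (e : x' = G'.tauY x) (e' : x = G'.tauY x')
    (ξ : V.fiber (S.baseY x)) : S.descentTau V e' (S.descentTau V e ξ) = ξ := by
  have hb := RealBundleGerbe.proj_eq_of_tau (G := G) (G' := G') rfl e (S.proj_baseY x)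
  apply (S.descentEquiv V (S.proj_baseY x) (S.baseR x)).injective
  have ey : S.baseY x = G.tauY (G.tauY (S.baseY x)) := (G.tauY.invol _).symm
  have h1 := S.descentEquiv_tau V rfl e (S.proj_baseY x) hb (S.baseR x) ξ
  have h2 := S.descentEquiv_tau V ey e' hb (S.proj_baseY x) (S.tau.tau
    ⟨(S.baseY x, x), S.proj_baseY x⟩ ⟨(G.tauY (S.baseY x), x'), hb⟩ (Prod.ext rfl e) (S.baseR x))
    (S.descentTau V e ξ)
  rw [S.tau.tau_tau, h1, V.tau_tau] at h2
  exact h2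

theorem descentTau_descentAct {x₁ x₂ x₁' x₂' : X} (e₁ : x₁' = G'.tauY x₁) (e₂ : x₂' = G'.tauY x₂)
    (hx : G'.proj x₁ = G'.proj x₂) (hx' : G'.proj x₁' = G'.proj x₂')
    (q : G'.P.fiber ⟨(x₁, x₂), hx⟩) (ξ : V.fiber (S.baseY x₂)) :
    S.descentTau V e₁ (S.descentAct V hx q ξ) =
      S.descentAct V hx' (G'.tauP.tau ⟨(x₁, x₂), hx⟩ ⟨(x₁', x₂'), hx'⟩ (Prod.ext e₁ e₂) q)
        (S.descentTau V e₂ ξ) := by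
  have hb₁ := RealBundleGerbe.proj_eq_of_tau (G := G) (G' := G') rfl e₁ (S.proj_baseY x₁)
  have hb₂ := RealBundleGerbe.proj_eq_of_tau (G := G) (G' := G') rfl e₂ (S.proj_baseY x₂)
  have hy : G.proj (S.baseY x₁) = G.proj (S.baseY x₂) :=
    (S.proj_baseY x₁).trans (hx.trans (S.proj_baseY x₂).symm)
  have hy' := hb₁.trans (hx'.trans hb₂.symm)
  set r₁ := S.tau.tau ⟨(S.baseY x₁, x₁), S.proj_baseY x₁⟩ ⟨(G.tauY (S.baseY x₁), x₁'), hb₁⟩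
    (Prod.ext rfl e₁) (S.baseR x₁) with hr₁
  set r₂ := S.tau.tau ⟨(S.baseY x₂, x₂), S.proj_baseY x₂⟩ ⟨(G.tauY (S.baseY x₂), x₂'), hb₂⟩
    (Prod.ext rfl e₂) (S.baseR x₂) with hr₂
  -- In $V$ at the conjugate of the base point, both sides become the conjugate of the action of one
  -- `solve`.
  apply (S.descentEquiv V hb₁ r₁).injective
  rw [hr₁, S.descentEquiv_tau V rfl e₁, ← S.act_solve_descentEquiv V hy' hx' hb₁ hb₂ _ _ r₂, hr₂,
    S.descentEquiv_tau V rfl e₂, ← S.act_solve_descentEquiv V hy hx (S.proj_baseY x₁) (S.proj_baseY x₂)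
      (S.baseR x₁) q (S.baseR x₂), V.tau_act' rfl rfl hy hy',
    S.tau_solve hy hx (S.proj_baseY x₁) (S.proj_baseY x₂) rfl rfl e₁ e₂ hy' hx' hb₁ hb₂]

theorem smul_descentAct {x₁ x₂ : X} (hx : G'.proj x₁ = G'.proj x₂) (z : Circle)
    (q : G'.P.fiber ⟨(x₁, x₂), hx⟩) (ξ : V.fiber (S.baseY x₂)) :
    S.descentAct V hx (z • q) ξ = (z : ℂ) • S.descentAct V hx q ξ := by
  unfold descentAct
  rw [S.solve_smul, V.smul_act]

theorem mul_descentAct {x₁ x₂ x₃ : X} (hx : G'.proj x₁ = G'.proj x₂) (hx' : G'.proj x₂ = G'.proj x₃)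
    (q : G'.P.fiber ⟨(x₁, x₂), hx⟩) (q' : G'.P.fiber ⟨(x₂, x₃), hx'⟩) (ξ : V.fiber (S.baseY x₃)) :
    S.descentAct V (hx.trans hx') (G'.mul hx hx' q q') ξ =
      S.descentAct V hx q (S.descentAct V hx' q' ξ) := by
  unfold descentAct
  rw [← V.mul_act, S.solve_mul]

variable [IsManifold 𝓘(ℝ, EM) ∞ M] [IsManifold 𝓘(ℝ, EY) ∞ Y] [IsManifold 𝓘(ℝ, EX) ∞ X]

/-- The descent of a Real bundle gerbe module along a Real stable isomorphism. -/
def descent : RealModule.{u, w', v} k G' where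
  toPreVectorBundle := S.descentBundle V
  frame_smooth b j := by
    set L := S.localLift V.toPreVectorBundle b with hL
    exact (S.descentEquiv_symm_isSmoothAlong V contMDiffOn_id L.y_smooth L.r_smooth
      (V.frame_isSmoothAlong L.y_smooth L.b L.y_mem j)).congr
        fun x h => S.descentBundle_frame V b x h j
  tau x x' e := S.descentTau V e
  tau_tau x x' h h' ξ := S.descentTau_descentTau V h h' ξ
  tau_smooth b j := by
    set L := S.localLift V.toPreVectorBundle b with hL
    have hτ : ContMDiffOn 𝓘(ℝ, EX) 𝓘(ℝ, EY) ∞ (fun x => G.tauY (L.y x)) L.dom :=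
      G.tauY.smooth.comp_contMDiffOn L.y_smooth
    -- The conjugate of a lift is a lift along `tauY`, and the conjugated descended frame is the
    -- descent, along that lift, of the conjugated frame of $V$.
    refine (S.descentEquiv_symm_isSmoothAlong V (G'.tauY.smooth.contMDiffOn (s := L.dom)) hτ
      (S.tau.isSmoothAlong (L.y_smooth.prodMk contMDiffOn_id) L.r_smooth)
      (V.tau_isSmoothAlong L.y_smooth (V.frame_isSmoothAlong L.y_smooth L.b L.y_mem j))).congr
        fun x h => ?_
    refine (LinearEquiv.eq_symm_apply _).2 ?_
    refine (S.descentEquiv_tau V rfl rfl (L.proj_y x h) _ (L.r x h) _).trans ?_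
    congr 1
    exact (LinearEquiv.eq_symm_apply _).1 (S.descentBundle_frame V b x h j)
  act hx q := S.descentAct V hx q
  smul_act hx z q ξ := S.smul_descentAct V hx z q ξ
  mul_act h₁₂ h₂₃ p q ξ := S.mul_descentAct V h₁₂ h₂₃ p q ξ
  act_smooth a b j := by
    refine .of_local fun t₀ ht₀ => ?_
    -- A lift near the first point reads off the result in $V$, and the lift of the frame `b` serves
    -- at the second point. Between them the action of $Q$ turns into that of a smooth section of
    -- $P$.
    set L₁ := S.localLift V.toPreVectorBundle t₀.1
    set L := S.localLift V.toPreVectorBundle b with hL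
    refine ⟨L₁.dom ×ˢ Set.univ, L₁.isOpen_dom.prod isOpen_univ, ⟨L₁.mem_dom, trivial⟩, ?_⟩
    set A := {t : X × X | G'.proj t.1 = G'.proj t.2 ∧ t ∈ G'.P.dom a ∧
      t.2 ∈ (S.descentBundle V).dom b} ∩ L₁.dom ×ˢ Set.univ with hA
    have hx₁ : ContMDiffOn (𝓘(ℝ, EX).prod 𝓘(ℝ, EX)) 𝓘(ℝ, EX) ∞ (Prod.fst : X × X → X) A :=
      contMDiffOn_fst
    have hx₂ : ContMDiffOn (𝓘(ℝ, EX).prod 𝓘(ℝ, EX)) 𝓘(ℝ, EX) ∞ (Prod.snd : X × X → X) A :=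
      contMDiffOn_snd
    have hy₁ : ContMDiffOn (𝓘(ℝ, EX).prod 𝓘(ℝ, EX)) 𝓘(ℝ, EY) ∞ (fun t : X × X => L₁.y t.1) A :=
      L₁.y_smooth.comp hx₁ fun t h => h.2.1
    have hy₂ : ContMDiffOn (𝓘(ℝ, EX).prod 𝓘(ℝ, EX)) 𝓘(ℝ, EY) ∞ (fun t : X × X => L.y t.2) A :=
      L.y_smooth.comp hx₂ fun t h => h.1.2.2
    have hr₁ := L₁.r_smooth.comp hx₁ fun t h => h.2.1
    have hr₂ := L.r_smooth.comp hx₂ fun t h => h.1.2.2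
    have hq := G'.P.sec_isSmoothAlong (hx₁.prodMk hx₂) (fun t h => h.1.1) a fun t h => h.1.2.1
    have hp := S.solve_isSmoothAlong hy₁ hy₂ hx₁ hx₂
      (hy := fun t h => (L₁.proj_y _ h.2.1).trans (h.1.1.trans (L.proj_y _ h.1.2.2).symm)) hr₁ hq hr₂
    refine (S.descentEquiv_symm_isSmoothAlong V hx₁ hy₁ hr₁
      ((V.act_homSmooth hy₁ hy₂ hp).apply hy₂.continuousOn
        (V.frame_isSmoothAlong hy₂ L.b (fun t h => L.y_mem _ h.1.2.2) j))).congr fun t h => ?_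
    refine (LinearEquiv.eq_symm_apply _).2 ?_
    refine (S.act_solve_descentEquiv V
      ((L₁.proj_y _ h.2.1).trans (h.1.1.trans (L.proj_y _ h.1.2.2).symm)) h.1.1 _ (L.proj_y _ h.1.2.2) _ _
        (L.r _ h.1.2.2) _).symm.trans
      ?_
    refine congrArg (V.act _ _) ?_
    exact (LinearEquiv.eq_symm_apply _).1 (S.descentBundle_frame V b t.2 h.1.2.2 j)
  tau_act {x₁ x₂} hx q ξ := S.descentTau_descentAct V rfl rfl hx (G'.tauP.maps (x₁, x₂) hx) q ξ

theorem induces_descent (S : RealStableIso.{u, w, w', v} G G') (V : RealModule.{u, w, u'} k G) :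
    S.Induces V (S.descent V) := by
  refine ⟨fun y x h r => S.descentIso V h r, fun y x h z r ξ => S.descentEquiv_smul V h z r ξ,
    fun y₁ y₂ x₁ x₂ hy hx h₁ h₂ p r q ξ => S.act_descentEquiv V hy hx h₁ h₂ p r q ξ,
    fun y x h r ξ => (S.descentEquiv_tau V rfl rfl h (S.tau.maps (y, x) h) r ξ).symm,
    fun a b j => ?_⟩
  set A := {t : Y × X | G.proj t.1 = G'.proj t.2 ∧ t ∈ S.R.dom a ∧ t.2 ∈ (S.descent V).dom b}
  have hy : ContMDiffOn (𝓘(ℝ, EY).prod 𝓘(ℝ, EX)) 𝓘(ℝ, EY) ∞ (Prod.fst : Y × X → Y) A :=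
    contMDiffOn_fst
  have hx : ContMDiffOn (𝓘(ℝ, EY).prod 𝓘(ℝ, EX)) 𝓘(ℝ, EX) ∞ (Prod.snd : Y × X → X) A :=
    contMDiffOn_snd
  have hr := S.R.sec_isSmoothAlong (hy.prodMk hx) (fun t h => h.1) a fun t h => h.2.1
  exact (S.descentEquiv_homSmooth V hx hy hr).apply hx.continuousOn
    ((S.descent V).frame_isSmoothAlong hx b (fun t h => h.2.2) j)

end RealStableIso

end DescentModule

/-! ### Intertwiners and uniqueness of the induced module -/

section Intertwiners

variable {EM : Type*} [NormedAddCommGroup EM] [NormedSpace ℝ EM]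
  {M : Type u} [TopologicalSpace M] [ChartedSpace EM M]
  {EY : Type*} [NormedAddCommGroup EY] [NormedSpace ℝ EY]
  {Y : Type*} [TopologicalSpace Y] [ChartedSpace EY Y]
  {EX : Type*} [NormedAddCommGroup EX] [NormedSpace ℝ EX]
  {X : Type*} [TopologicalSpace X] [ChartedSpace EX X]
  {τ : SmoothInvolution 𝓘(ℝ, EM) M} {k : ℕ∞}
  {E' H' : Type*} [NormedAddCommGroup E'] [NormedSpace ℝ E'] [TopologicalSpace H']
  {J : ModelWithCorners ℝ E' H'} {T : Type*} [TopologicalSpace T] [ChartedSpace H' T]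
  {A : Set T}
  {G : RealBundleGerbe.{u, w} τ EY Y} {G' : RealBundleGerbe.{u, w'} τ EX X}

namespace RealStableIso

/-- The data of an isomorphism `R_(y,x) ⊗ W_x ≃ V_y` that is compatible with the actions and the Real
structures. -/
structure Intertwiner (S : RealStableIso.{u, w, w', v} G G') (V : RealModule.{u, w, u'} k G)
    (W : RealModule.{u, w', u'} k G') where
  map : ∀ (y : Y) (x : X) (h : G.proj y = G'.proj x),
    S.R.fiber ⟨(y, x), h⟩ → (W.fiber x ≃ₗ[ℂ] V.fiber y)
  smul : ∀ y x h (z : Circle) r ξ, map y x h (z • r) ξ = (z : ℂ) • map y x h r ξ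
  act : ∀ y₁ y₂ x₁ x₂ (hy : G.proj y₁ = G.proj y₂) (hx : G'.proj x₁ = G'.proj x₂)
    (h₁ : G.proj y₁ = G'.proj x₁) (h₂ : G.proj y₂ = G'.proj x₂) p r q ξ,
    V.act hy p (map y₂ x₂ h₂ (S.act hy hx h₁ h₂ p r q) ξ) = map y₁ x₁ h₁ r (W.act hx q ξ)
  tau : ∀ y x (h : G.proj y = G'.proj x) r ξ,
    V.tau y (G.tauY y) rfl (map y x h r ξ) =
      map (G.tauY y) (G'.tauY x) (S.tau.maps (y, x) h)
        (S.tau.tau ⟨(y, x), h⟩ ⟨(G.tauY y, G'.tauY x), S.tau.maps (y, x) h⟩ rfl r)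
        (W.tau x (G'.tauY x) rfl ξ)
  smooth : ∀ a b j, V.IsSmoothAlong k (𝓘(ℝ, EY).prod 𝓘(ℝ, EX))
    {t : Y × X | G.proj t.1 = G'.proj t.2 ∧ t ∈ S.R.dom a ∧ t.2 ∈ W.dom b} (fun t => t.1)
    (fun t ht => map t.1 t.2 ht.1 (S.R.sec a ⟨(t.1, t.2), ht.1⟩) (W.frame b t.2 ht.2.2 j))

variable {S : RealStableIso.{u, w, w', v} G G'} {V : RealModule.{u, w, u'} k G}
  {W : RealModule.{u, w', u'} k G'}

theorem induces_iff : S.Induces V W ↔ Nonempty (S.Intertwiner V W) :=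
  ⟨fun ⟨ρ, h₁, h₂, h₃, h₄⟩ => ⟨⟨ρ, h₁, h₂, h₃, h₄⟩⟩, fun ⟨ρ⟩ => ⟨ρ.map, ρ.smul, ρ.act, ρ.tau, ρ.smooth⟩⟩

namespace Intertwiner

variable (ρ : S.Intertwiner V W)

/-- The axiom `act` with `q` the unit, which acts trivially on $W$: for fixed `x`, the dependence of
an intertwiner on the lift is dictated by $V$ alone. -/
theorem act_solve {y₁ y₂ : Y} {x : X} (hy : G.proj y₁ = G.proj y₂)
    (h₁ : G.proj y₁ = G'.proj x) (h₂ : G.proj y₂ = G'.proj x) (r₁ r₂) (ξ : W.fiber x) :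
    V.act hy (S.solve hy rfl h₁ h₂ r₁ (G'.one x) r₂) (ρ.map y₂ x h₂ r₂ ξ) = ρ.map y₁ x h₁ r₁ ξ := by
  have := ρ.act y₁ y₂ x x hy rfl h₁ h₂ (S.solve hy rfl h₁ h₂ r₁ (G'.one x) r₂) r₁ (G'.one x) ξ
  rwa [S.act_solve, W.act_one] at this

theorem homSmooth {f : T → X} {y : T → Y} (hfs : ContMDiffOn J 𝓘(ℝ, EX) ∞ f A)
    (hys : ContMDiffOn J 𝓘(ℝ, EY) ∞ y A) {h : ∀ t ∈ A, G.proj (y t) = G'.proj (f t)}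
    {r : ∀ t (ht : t ∈ A), S.R.fiber ⟨(y t, f t), h t ht⟩}
    (hr : S.R.IsSmoothAlong J A (fun t => (y t, f t)) h r) :
    PreVectorBundle.HomSmooth W.toPreVectorBundle V.toPreVectorBundle k J A f y
      (fun t ht => (ρ.map (y t) (f t) (h t ht) (r t ht)).toLinearMap) := by
  refine .of_local fun t₀ ht₀ => ?_
  obtain ⟨U, hU, htU, hUd⟩ := S.R.exists_open_dom (hys.prodMk hfs).continuousOn h ht₀
  have hs : A ∩ U ⊆ A := Set.inter_subset_left
  obtain ⟨c, hc, he⟩ := (hr.mono hs).exists_coeff hUd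
  refine ⟨U, hU, htU, fun b j => ?_⟩
  have hs' : A ∩ U ∩ f ⁻¹' W.dom b ⊆ A ∩ U := Set.inter_subset_left
  refine (((ρ.smooth ⟨_, h t₀ ht₀⟩ b j).comp (g := fun t => (y t, f t))
    ((hys.prodMk hfs).mono (hs'.trans hs)) fun t ht => ⟨h t ht.1.1, hUd t ht.1, ht.2⟩).circle_smul
      (hc.mono hs')).congr fun t ht => ?_
  exact (congrArg (fun q => ρ.map (y t) (f t) (h t ht.1.1) q (W.frame b (f t) ht.2 j))
    (he t ht.1)).trans (ρ.smul _ _ _ _ _ _)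

/-- Intertwiners can be composed with isomorphisms. -/
def trans {V' : RealModule.{u, w, u'} k G} (φ : RealModule.Iso V V') : S.Intertwiner V' W where
  map y x h r := (ρ.map y x h r).trans (φ.equiv y)
  smul y x h z r ξ := by simp [ρ.smul]
  act y₁ y₂ x₁ x₂ hy hx h₁ h₂ p r q ξ := by
    simp only [LinearEquiv.trans_apply]
    rw [← φ.map_act, ρ.act]
  tau y x h r ξ := by
    simp only [LinearEquiv.trans_apply]
    rw [← φ.map_tau, ρ.tau]
  smooth a b j := (φ.homSmooth contMDiffOn_fst).apply continuous_fst.continuousOn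
    (ρ.smooth a b j)

/-- The direct sum of two intertwiners. -/
def sum {V' : RealModule.{u, w, u'} k G} {W' : RealModule.{u, w', u'} k G'}
    (ρ' : S.Intertwiner V' W') : S.Intertwiner (V.sum V') (W.sum W') where
  map y x h r := (ρ.map y x h r).prodCongr (ρ'.map y x h r)
  smul y x h z r ξ := Prod.ext (ρ.smul y x h z r ξ.1) (ρ'.smul y x h z r ξ.2)
  act y₁ y₂ x₁ x₂ hy hx h₁ h₂ p r q ξ :=
    Prod.ext (ρ.act y₁ y₂ x₁ x₂ hy hx h₁ h₂ p r q ξ.1) (ρ'.act y₁ y₂ x₁ x₂ hy hx h₁ h₂ p r q ξ.2)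
  tau y x h r ξ := Prod.ext (ρ.tau y x h r ξ.1) (ρ'.tau y x h r ξ.2)
  smooth := by
    rintro a b (j | j)
    · refine (((ρ.smooth a b j).mono fun t ht => ⟨ht.1, ht.2.1, ht.2.2.1⟩).pair
        (PreVectorBundle.isSmoothAlong_zero V'.toPreVectorBundle _ _)).congr fun t ht => ?_
      exact (congrArg ((ρ.map t.1 t.2 ht.1 _).prodCongr (ρ'.map t.1 t.2 ht.1 _))
        (PreVectorBundle.sum_frame_inl W.toPreVectorBundle W'.toPreVectorBundle b t.2 ht.2.2 j)).trans
          (Prod.ext rfl (map_zero (ρ'.map t.1 t.2 ht.1 _)))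
    · refine ((PreVectorBundle.isSmoothAlong_zero V.toPreVectorBundle _ _).pair
        ((ρ'.smooth a b j).mono fun t ht => ⟨ht.1, ht.2.1, ht.2.2.2⟩)).congr fun t ht => ?_
      exact (congrArg ((ρ.map t.1 t.2 ht.1 _).prodCongr (ρ'.map t.1 t.2 ht.1 _))
        (PreVectorBundle.sum_frame_inr W.toPreVectorBundle W'.toPreVectorBundle b t.2 ht.2.2 j)).trans
          (Prod.ext (map_zero (ρ.map t.1 t.2 ht.1 _)) rfl)

variable {W' : RealModule.{u, w', u'} k G'} (ρ' : S.Intertwiner V W')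

/-- The comparison of the fibres of two modules that are induced by the same module. -/
def compareEquiv (x : X) : W.fiber x ≃ₗ[ℂ] W'.fiber x :=
  (ρ.map (S.baseY x) x (S.proj_baseY x) (S.baseR x)).trans
    (ρ'.map (S.baseY x) x (S.proj_baseY x) (S.baseR x)).symm

/-- Both intertwiners change with the lift by the same operator on $V$ (`Intertwiner.act_solve`), so
the comparison made at the base lift is valid at every lift. -/
theorem map_compareEquiv {y : Y} {x : X} (h : G.proj y = G'.proj x) (r) (ξ : W.fiber x) :
    ρ'.map y x h r (ρ.compareEquiv ρ' x ξ) = ρ.map y x h r ξ := by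
  have hy := h.trans (S.proj_baseY x).symm
  rw [← ρ'.act_solve hy h (S.proj_baseY x) r (S.baseR x),
    ← ρ.act_solve hy h (S.proj_baseY x) r (S.baseR x)]
  simp [compareEquiv]

theorem compareEquiv_eq {y : Y} {x : X} (h : G.proj y = G'.proj x) (r) (ξ : W.fiber x) :
    ρ.compareEquiv ρ' x ξ = (ρ'.map y x h r).symm (ρ.map y x h r ξ) :=
  (LinearEquiv.eq_symm_apply _).2 (ρ.map_compareEquiv ρ' h r ξ)

variable [IsManifold 𝓘(ℝ, EM) ∞ M] [IsManifold 𝓘(ℝ, EY) ∞ Y] [IsManifold 𝓘(ℝ, EX) ∞ X]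

/-- Independence of the lift allows the discontinuous base lift to be replaced near `x₀` by a smooth
one. The comparison is then a smooth map followed by the inverse of a smooth map. -/
theorem compareEquiv_smooth (b : X) (j : W.idx b) :
    W'.IsSmoothAlong k 𝓘(ℝ, EX) (W.dom b) (fun x => x)
      (fun x h => ρ.compareEquiv ρ' x (W.frame b x h j)) := by
  refine .of_local fun x₀ hx₀ => ?_
  let L := S.localLift V.toPreVectorBundle x₀
  refine ⟨L.dom, L.isOpen_dom, L.mem_dom, ?_⟩
  have hs : W.dom b ∩ L.dom ⊆ L.dom := Set.inter_subset_right
  have hx : ContMDiffOn 𝓘(ℝ, EX) 𝓘(ℝ, EX) ∞ (fun x => x) (W.dom b ∩ L.dom) := contMDiffOn_id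
  have hy := L.y_smooth.mono hs
  have h1 := ρ.homSmooth hx hy (L.r_smooth.mono hs)
  have h2 := VectorBundle.homSmooth_symm (V := W'.toVectorBundle) (W := V.toVectorBundle) hx hy
    (ρ'.homSmooth hx hy (L.r_smooth.mono hs))
  exact (h2.apply hy.continuousOn (h1.apply hx.continuousOn (W.frame_isSmoothAlong hx b
    (fun x h => h.1) j))).congr fun x h => ρ.compareEquiv_eq ρ' (L.proj_y x h.2) (L.r x h.2) _

/-- Two modules that are induced by the same module are isomorphic. -/
def compareIso : RealModule.Iso W W' where
  equiv := ρ.compareEquiv ρ'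
  smooth := ρ.compareEquiv_smooth ρ'
  symm_smooth := ρ'.compareEquiv_smooth ρ
  map_tau x x' e ξ := by
    subst e
    have h := S.proj_baseY x
    apply (ρ'.map (G.tauY (S.baseY x)) (G'.tauY x) (S.tau.maps (S.baseY x, x) h)
      (S.tau.tau ⟨(S.baseY x, x), h⟩ ⟨(G.tauY (S.baseY x), G'.tauY x),
        S.tau.maps (S.baseY x, x) h⟩ rfl (S.baseR x))).injective
    rw [map_compareEquiv, ← ρ.tau, ← ρ'.tau, map_compareEquiv]
  map_act {x₁ x₂} hx q ξ := by
    have h := S.proj_baseY x₁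
    apply (ρ'.map (S.baseY x₁) x₁ h (S.baseR x₁)).injective
    -- Both intertwiners turn the action of `q` into a change of lift, with the same $y$ over both
    -- points. Any element of $P_{(y,y)}$ would do in place of the unit.
    rw [map_compareEquiv, ← ρ.act _ _ _ _ rfl hx h (h.trans hx) (G.one _),
      ← ρ'.act _ _ _ _ rfl hx h (h.trans hx) (G.one _), map_compareEquiv]

end Intertwiner

end RealStableIso

end Intertwiners

/-! ### Dual circle bundles on the exchanged fibre product -/

section SwapDual

variable {E H : Type*} [NormedAddCommGroup E] [NormedSpace ℝ E] [TopologicalSpace H]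
  {N : Type*} [TopologicalSpace N] [ChartedSpace H N] {I : ModelWithCorners ℝ E H}
  {F K : Type*} [NormedAddCommGroup F] [NormedSpace ℝ F] [TopologicalSpace K]
  {N' : Type*} [TopologicalSpace N'] [ChartedSpace K N'] {I' : ModelWithCorners ℝ F K}
  {E' H' : Type*} [NormedAddCommGroup E'] [NormedSpace ℝ E'] [TopologicalSpace H']
  {J : ModelWithCorners ℝ E' H'} {T : Type*} [TopologicalSpace T] [ChartedSpace H' T]
  {A : Set T} {S : Set (N × N')} {S' : Set (N' × N)}

/-- The dual of a family of torsors over a subset of a product, with the factors of the product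
exchanged. -/
def PreCircleBundle.swapDual (L : PreCircleBundle.{w} S) (h : ∀ s ∈ S', (s.2, s.1) ∈ S) :
    PreCircleBundle.{w} S' where
  fiber s := L.fiber ⟨(s.1.2, s.1.1), h _ s.2⟩
  -- The dual torsor has the same points, with the circle acting through inversion.
  mulAction s := MulAction.compHom (L.fiber ⟨(s.1.2, s.1.1), h _ s.2⟩)
    (invMonoidHom : Circle →* Circle)
  torsor s p q := by
    obtain ⟨z, hz, hu⟩ := L.torsor ⟨(s.1.2, s.1.1), h _ s.2⟩ p q
    refine ⟨z⁻¹, ?_, fun z' hz' => inv_eq_iff_eq_inv.1 (hu z'⁻¹ hz')⟩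
    change z⁻¹⁻¹ • p = q
    rw [inv_inv]
    exact hz
  dom a := {s | (s.2, s.1) ∈ L.dom ⟨(a.1.2, a.1.1), h _ a.2⟩}
  isOpen_dom a := (L.isOpen_dom _).preimage continuous_swap
  mem_dom a := L.mem_dom ⟨(a.1.2, a.1.1), h _ a.2⟩
  sec a s := L.sec ⟨(a.1.2, a.1.1), h _ a.2⟩ ⟨(s.1.2, s.1.1), h _ s.2⟩

namespace PreCircleBundle

variable {L : PreCircleBundle.{w} S} {h : ∀ s ∈ S', (s.2, s.1) ∈ S}

/-- The section is unchanged as a family of points; only its coefficients are inverted. -/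
theorem IsSmoothAlong.swapDual {f : T → N × N'} {hf : ∀ t ∈ A, f t ∈ S}
    {σ : ∀ (t : T) (ht : t ∈ A), L.fiber ⟨f t, hf t ht⟩} (hσ : L.IsSmoothAlong J A f hf σ)
    (h' : ∀ s ∈ S, (s.2, s.1) ∈ S') :
    (L.swapDual h).IsSmoothAlong J A (fun t => ((f t).2, (f t).1)) (fun t ht => h' _ (hf t ht))
      σ := by
  intro a t₀ ht₀ hd
  obtain ⟨g, hg, he⟩ := hσ ⟨(a.1.2, a.1.1), h _ a.2⟩ t₀ ht₀ hd
  refine ⟨fun t => (g t)⁻¹, contMDiffWithinAt_circle_inv hg, ?_⟩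
  filter_upwards [he] with t ht hA
  rw [ht hA]
  change _ = (g t)⁻¹⁻¹ • L.sec _ _
  rw [inv_inv]

end PreCircleBundle

/-- The dual of a principal `U(1)`-bundle over a subset of a product, with the factors of the product
exchanged. -/
def CircleBundle.swapDual (L : CircleBundle.{w} (I.prod I') S) (h : ∀ s ∈ S', (s.2, s.1) ∈ S)
    (h' : ∀ s ∈ S, (s.2, s.1) ∈ S') : CircleBundle.{w} (I'.prod I) S' where
  toPreCircleBundle := L.toPreCircleBundle.swapDual h
  sec_smooth b := by
    have := (L.sec_smooth ⟨(b.1.2, b.1.1), h _ b.2⟩).comp (J' := I'.prod I)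
      (g := fun s : N' × N => (s.2, s.1))
      (B := S' ∩ (L.toPreCircleBundle.swapDual h).dom b)
      (contMDiffOn_snd.prodMk contMDiffOn_fst) fun s hs => ⟨h _ hs.1, hs.2⟩
    exact PreCircleBundle.IsSmoothAlong.swapDual (h := h) this h'

/-- The dual of a Real structure. -/
def CircleBundle.RealStructure.swapDual {L : CircleBundle.{w} (I.prod I') S} {t : N → N}
    {t' : N' → N'} (τ : L.RealStructure (fun s => (t s.1, t' s.2)))
    (h : ∀ s ∈ S', (s.2, s.1) ∈ S) (h' : ∀ s ∈ S, (s.2, s.1) ∈ S') :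
    (L.swapDual h h').RealStructure (fun s => (t' s.1, t s.2)) where
  maps s hs := h' _ (τ.maps _ (h _ hs))
  tau s s' e p := τ.tau ⟨(s.1.2, s.1.1), h _ s.2⟩ ⟨(s'.1.2, s'.1.1), h _ s'.2⟩
    (Prod.ext (congrArg Prod.snd e) (congrArg Prod.fst e)) p
  tau_smul s s' e z p := τ.tau_smul _ _ _ z⁻¹ p
  tau_tau s s' e e' p := τ.tau_tau _ _ _ _ p
  tau_smooth b := by
    have := (τ.tau_smooth ⟨(b.1.2, b.1.1), h _ b.2⟩).comp (J' := I'.prod I)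
      (g := fun s : N' × N => (s.2, s.1))
      (B := S' ∩ (L.toPreCircleBundle.swapDual h).dom b)
      (contMDiffOn_snd.prodMk contMDiffOn_fst) fun s hs => ⟨h _ hs.1, hs.2⟩
    exact PreCircleBundle.IsSmoothAlong.swapDual (h := h) this h'

end SwapDual

/-! ### Inverse stable isomorphisms and the bijection on classes -/

section Symmetry

variable {EM : Type*} [NormedAddCommGroup EM] [NormedSpace ℝ EM]
  {M : Type u} [TopologicalSpace M] [ChartedSpace EM M]
  {EY : Type*} [NormedAddCommGroup EY] [NormedSpace ℝ EY]
  {Y : Type*} [TopologicalSpace Y] [ChartedSpace EY Y]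
  {EX : Type*} [NormedAddCommGroup EX] [NormedSpace ℝ EX]
  {X : Type*} [TopologicalSpace X] [ChartedSpace EX X]
  {τ : SmoothInvolution 𝓘(ℝ, EM) M} {k : ℕ∞}
  {G : RealBundleGerbe.{u, w} τ EY Y} {G' : RealBundleGerbe.{u, w'} τ EX X}

namespace RealStableIso

/-- The inverse of a Real stable isomorphism. -/
def symm (S : RealStableIso.{u, w, w', v} G G') : RealStableIso.{u, w', w, v} G' G where
  R := S.R.swapDual (fun _ h => h.symm) (fun _ h => h.symm)
  tau := S.tau.swapDual (fun _ h => h.symm) (fun _ h => h.symm)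
  act hx hy h₁ h₂ q r p := S.act hy hx h₁.symm h₂.symm p r q
  -- `act` is covariant in $Q$ and contravariant in $P$. Passing to the dual action inverts both, as
  -- the exchange of the two gerbes requires.
  act_smul_left hx hy h₁ h₂ z q r p := by
    refine (S.act_smul_right hy hx h₁.symm h₂.symm z p r q).trans ?_
    exact congrArg (· • S.act hy hx h₁.symm h₂.symm p r q) (inv_inv z).symm
  act_smul_middle hx hy h₁ h₂ z q r p := S.act_smul_middle hy hx h₁.symm h₂.symm z⁻¹ p r q
  act_smul_right hx hy h₁ h₂ z q r p := S.act_smul_left hy hx h₁.symm h₂.symm z p r q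
  act_mul hx hx' hy hy' h₁ h₂ h₃ q q' r p p' :=
    S.act_mul hy hy' hx hx' h₁.symm h₂.symm h₃.symm p p' r q q'
  act_smooth a b c := by
    exact PreCircleBundle.IsSmoothAlong.swapDual (h := fun _ h => h.symm)
      (f := fun t : (X × X) × Y × Y => (t.2.2, t.1.2)) (hf := fun t ht => ht.1.2.2.2.symm)
      ((S.act_smooth c ⟨(b.1.2, b.1.1), b.2.symm⟩ a).comp
      (g := fun t : (X × X) × Y × Y => (t.2, t.1)) (contMDiffOn_snd.prodMk contMDiffOn_fst)
      fun t ht => ⟨⟨ht.1.2.1, ht.1.1, ht.1.2.2.1.symm, ht.1.2.2.2.symm⟩,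
        ht.2.2.2, ht.2.2.1, ht.2.1⟩) fun _ h => h.symm
  tau_act hx hy h₁ h₂ q r p := S.tau_act hy hx h₁.symm h₂.symm p r q

namespace Intertwiner

variable {S : RealStableIso.{u, w, w', v} G G'} {V : RealModule.{u, w, u'} k G}
  {W : RealModule.{u, w', u'} k G'}

/-- The inverse of an intertwiner. -/
def symm (ρ : S.Intertwiner V W) : S.symm.Intertwiner W V where
  map x y h r := (ρ.map y x h.symm r).symm
  smul x y h z r η := by
    refine (LinearEquiv.symm_apply_eq _).2 ?_
    refine Eq.trans ?_ (ρ.smul y x h.symm z⁻¹ r _).symm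
    rw [map_smul, LinearEquiv.apply_symm_apply, smul_smul]
    simp
  act x₁ x₂ y₁ y₂ hx hy h₁ h₂ q r p η := by
    refine (LinearEquiv.eq_symm_apply _).2 ?_
    refine (ρ.act y₁ y₂ x₁ x₂ hy hx h₁.symm h₂.symm p r q _).symm.trans ?_
    exact congrArg (V.act hy p) (LinearEquiv.apply_symm_apply _ _)
  tau x y h r η := by
    refine (LinearEquiv.eq_symm_apply _).2 ?_
    refine (ρ.tau y x h.symm r _).symm.trans ?_
    exact congrArg (V.tau y _ rfl) (LinearEquiv.apply_symm_apply _ _)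
  smooth a b j := by
    set A := {t : X × Y | G'.proj t.1 = G.proj t.2 ∧ t ∈ S.symm.R.dom a ∧ t.2 ∈ V.dom b}
    have hx : ContMDiffOn (𝓘(ℝ, EX).prod 𝓘(ℝ, EY)) 𝓘(ℝ, EX) ∞ (Prod.fst : X × Y → X) A :=
      contMDiffOn_fst
    have hy : ContMDiffOn (𝓘(ℝ, EX).prod 𝓘(ℝ, EY)) 𝓘(ℝ, EY) ∞ (Prod.snd : X × Y → Y) A :=
      contMDiffOn_snd
    have hr := S.R.sec_isSmoothAlong (hy.prodMk hx) (fun t h => h.1.symm)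
      ⟨(a.1.2, a.1.1), a.2.symm⟩ fun t h => h.2.1
    have h1 := VectorBundle.homSmooth_symm (V := W.toVectorBundle) (W := V.toVectorBundle) hx hy
      (ρ.homSmooth hx hy hr)
    exact h1.apply hy.continuousOn (V.frame_isSmoothAlong hy b (fun t h => h.2.2) j)

/-- The intertwiner with a given inverse. -/
def ofSymm (ρ : S.symm.Intertwiner W V) : S.Intertwiner V W where
  map y x h r := (ρ.map x y h.symm r).symm
  smul y x h z r ξ := by
    refine (LinearEquiv.symm_apply_eq _).2 ?_
    -- In the dual bundle $z^{-1}$ acts as $z$ does on $R$.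
    have h1 := ρ.smul x y h.symm z⁻¹ r ((z : ℂ) • (ρ.map x y h.symm r).symm ξ)
    refine Eq.trans ?_ (Eq.trans (congrArg (fun c : Circle =>
      ρ.map x y h.symm (c • r) ((z : ℂ) • (ρ.map x y h.symm r).symm ξ)) (inv_inv z).symm) h1).symm
    rw [map_smul, LinearEquiv.apply_symm_apply, smul_smul]
    simp
  act y₁ y₂ x₁ x₂ hy hx h₁ h₂ p r q ξ := by
    refine (LinearEquiv.eq_symm_apply _).2 ?_
    refine (ρ.act x₁ x₂ y₁ y₂ hx hy h₁.symm h₂.symm q r p _).symm.trans ?_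
    exact congrArg (W.act hx q) (LinearEquiv.apply_symm_apply _ _)
  tau y x h r ξ := by
    refine (LinearEquiv.eq_symm_apply _).2 ?_
    refine (ρ.tau x y h.symm r _).symm.trans ?_
    exact congrArg (W.tau x _ rfl) (LinearEquiv.apply_symm_apply _ _)
  smooth a b j := by
    set A := {t : Y × X | G.proj t.1 = G'.proj t.2 ∧ t ∈ S.R.dom a ∧ t.2 ∈ W.dom b}
    have hy : ContMDiffOn (𝓘(ℝ, EY).prod 𝓘(ℝ, EX)) 𝓘(ℝ, EY) ∞ (Prod.fst : Y × X → Y) A :=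
      contMDiffOn_fst
    have hx : ContMDiffOn (𝓘(ℝ, EY).prod 𝓘(ℝ, EX)) 𝓘(ℝ, EX) ∞ (Prod.snd : Y × X → X) A :=
      contMDiffOn_snd
    have hr := (S.R.sec_isSmoothAlong (hy.prodMk hx) (fun t h => h.1) a fun t h => h.2.1).swapDual
      (h := fun _ h => h.symm) (S' := {s : X × Y | G'.proj s.1 = G.proj s.2}) (fun _ h => h.symm)
    have h1 := VectorBundle.homSmooth_symm (V := V.toVectorBundle) (W := W.toVectorBundle) hy hx
      (ρ.homSmooth (h := fun t h => h.1.symm) hy hx hr)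
    exact h1.apply hx.continuousOn (W.frame_isSmoothAlong hx b (fun t h => h.2.2) j)

end Intertwiner

/-- Intertwiners are fibrewise invertible. Hence each statement about $W$ for given $V$ also gives
the statement about $V$ for given $W$. -/
theorem induces_symm_iff {S : RealStableIso.{u, w, w', v} G G'} {V : RealModule.{u, w, u'} k G}
    {W : RealModule.{u, w', u'} k G'} : S.symm.Induces W V ↔ S.Induces V W := by
  rw [induces_iff, induces_iff]
  exact ⟨fun ⟨ρ⟩ => ⟨ρ.ofSymm⟩, fun ⟨ρ⟩ => ⟨ρ.symm⟩⟩

section Equivalence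

variable (S : RealStableIso.{u, w, w', v} G G') (V V' : RealModule.{u, w, u'} k G)
  (W W' : RealModule.{u, w', u'} k G')

variable {S V V' W W'} in
theorem Induces.congr_left (h : S.Induces V W) (e : V ≈ V') : S.Induces V' W := by
  obtain ⟨ρ⟩ := induces_iff.1 h
  obtain ⟨φ⟩ := e
  exact induces_iff.2 ⟨ρ.trans φ⟩

variable {S V V' W W'} in
theorem Induces.congr_right (h : S.Induces V W) (e : W ≈ W') : S.Induces V W' :=
  induces_symm_iff.1 ((induces_symm_iff.2 h).congr_left e)

variable [IsManifold 𝓘(ℝ, EM) ∞ M] [IsManifold 𝓘(ℝ, EY) ∞ Y] [IsManifold 𝓘(ℝ, EX) ∞ X]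

variable {S V V' W W'} in
theorem Induces.equiv_right (h : S.Induces V W) (h' : S.Induces V W') : W ≈ W' := by
  obtain ⟨ρ⟩ := induces_iff.1 h
  obtain ⟨ρ'⟩ := induces_iff.1 h'
  exact ⟨ρ.compareIso ρ'⟩

variable {S V V' W W'} in
theorem Induces.equiv_left (h : S.Induces V W) (h' : S.Induces V' W) : V ≈ V' :=
  (induces_symm_iff.2 h).equiv_right (induces_symm_iff.2 h')

/-- Up to isomorphism, each $V$ induces exactly one $W$ and conversely, so the relation is the graph
of a bijection, computed by descent. It is closed under direct sums. -/
theorem exists_addEquiv (k : ℕ∞) : ∃ Φ : Rmod.{u, w, u'} k G ≃+ Rmod.{u, w', u'} k G',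
    ∀ (V : RealModule.{u, w, u'} k G) (W : RealModule.{u, w', u'} k G'),
      Φ (Rmod.mk V) = Rmod.mk W ↔ S.Induces V W := by
  let F : Rmod.{u, w, u'} k G → Rmod.{u, w', u'} k G' :=
    Quotient.map (fun V => S.descent V) fun V V' e =>
      ((S.induces_descent V).congr_left e).equiv_right (S.induces_descent V')
  have hF : ∀ V W, F (Rmod.mk V) = Rmod.mk W ↔ S.Induces V W := fun V W =>
    ⟨fun h => (S.induces_descent V).congr_right (Quotient.exact h),
      fun h => Quotient.sound ((S.induces_descent V).equiv_right h)⟩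
  have hb : Function.Bijective F := by
    constructor
    · rintro ⟨V⟩ ⟨V'⟩ h
      -- Both modules induce the descent of `V'`, so uniqueness for the inverse stable isomorphism
      -- identifies them.
      exact Quotient.sound (((hF V _).1 h).equiv_left ((hF V' (S.descent V')).1 rfl))
    · rintro ⟨W⟩
      exact ⟨Rmod.mk (S.symm.descent W), (hF _ W).2
        (induces_symm_iff.1 (S.symm.induces_descent W))⟩
  have hadd : ∀ a b, F (a + b) = F a + F b := by
    rintro ⟨V⟩ ⟨V'⟩
    obtain ⟨ρ⟩ := induces_iff.1 (S.induces_descent V)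
    obtain ⟨ρ'⟩ := induces_iff.1 (S.induces_descent V')
    exact (hF (V.sum V') ((S.descent V).sum (S.descent V'))).2 (induces_iff.2 ⟨ρ.sum ρ'⟩)
  exact ⟨{ Equiv.ofBijective F hb with map_add' := hadd }, hF⟩

end Equivalence

end RealStableIso

end Symmetry

/-! ### Functoriality of the Grothendieck group -/

/-- An isomorphism of commutative monoids extends to their Grothendieck groups. -/
theorem exists_grothendieck_addEquiv {A B : Type*} [AddCommMonoid A] [AddCommMonoid B]
    (Φ : A ≃+ B) : ∃ Ψ : Algebra.GrothendieckAddGroup A ≃+ Algebra.GrothendieckAddGroup B,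
      ∀ a, Ψ (Algebra.GrothendieckAddGroup.of a) = Algebra.GrothendieckAddGroup.of (Φ a) := by
  let L := Algebra.GrothendieckAddGroup.lift
    ((Algebra.GrothendieckAddGroup.of (M := B)).comp Φ.toAddMonoidHom)
  let L' := Algebra.GrothendieckAddGroup.lift
    ((Algebra.GrothendieckAddGroup.of (M := A)).comp Φ.symm.toAddMonoidHom)
  have hL : ∀ a, L (Algebra.GrothendieckAddGroup.of a) = Algebra.GrothendieckAddGroup.of (Φ a) :=
    fun a => DFunLike.congr_fun (Algebra.GrothendieckAddGroup.lift.symm_apply_apply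
      ((Algebra.GrothendieckAddGroup.of (M := B)).comp Φ.toAddMonoidHom)) a
  have hL' : ∀ b, L' (Algebra.GrothendieckAddGroup.of b) =
      Algebra.GrothendieckAddGroup.of (Φ.symm b) :=
    fun b => DFunLike.congr_fun (Algebra.GrothendieckAddGroup.lift.symm_apply_apply
      ((Algebra.GrothendieckAddGroup.of (M := A)).comp Φ.symm.toAddMonoidHom)) b
  refine ⟨L.toAddEquiv L' ?_ ?_, hL⟩
  -- Homomorphisms out of the Grothendieck group are determined by their values on the monoid.
  · refine Algebra.GrothendieckAddGroup.lift.symm.injective (AddMonoidHom.ext fun a => ?_)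
    change L' (L (Algebra.GrothendieckAddGroup.of a)) = Algebra.GrothendieckAddGroup.of a
    rw [hL, hL', Φ.symm_apply_apply]
  · refine Algebra.GrothendieckAddGroup.lift.symm.injective (AddMonoidHom.ext fun b => ?_)
    change L (L' (Algebra.GrothendieckAddGroup.of b)) = Algebra.GrothendieckAddGroup.of b
    rw [hL', hL, Φ.apply_symm_apply]

/-! ### Pull-back of circle bundles -/

section Pullback

variable {E H : Type*} [NormedAddCommGroup E] [NormedSpace ℝ E] [TopologicalSpace H]
  {N : Type*} [TopologicalSpace N] [ChartedSpace H N] {I : ModelWithCorners ℝ E H}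
  {F K : Type*} [NormedAddCommGroup F] [NormedSpace ℝ F] [TopologicalSpace K]
  {N' : Type*} [TopologicalSpace N'] [ChartedSpace K N'] {I' : ModelWithCorners ℝ F K}
  {E' H' : Type*} [NormedAddCommGroup E'] [NormedSpace ℝ E'] [TopologicalSpace H']
  {J : ModelWithCorners ℝ E' H'} {T : Type*} [TopologicalSpace T] [ChartedSpace H' T]
  {A : Set T} {S : Set N} {S' : Set N'}

/-- The identification of two fibres over equal points. -/
def PreVectorBundle.castEquiv (V : PreVectorBundle.{v} N) {n n' : N} (h : n = n') :
    V.fiber n ≃ₗ[ℂ] V.fiber n' := h ▸ LinearEquiv.refl ℂ (V.fiber n)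

/-- Smoothness along a map depends only on the values of the map. -/
theorem PreVectorBundle.IsSmoothAlong.congr_map {V : PreVectorBundle.{v} N} {k : ℕ∞} {f f' : T → N}
    (σ : ∀ t ∈ A, ∀ n, n = f t → V.fiber n)
    (hσ : V.IsSmoothAlong k J A f (fun t ht => σ t ht (f t) rfl)) (hf : ∀ t ∈ A, f' t = f t) :
    V.IsSmoothAlong k J A f' (fun t ht => σ t ht (f' t) (hf t ht)) := by
  intro a t₀ ht₀ hd
  obtain ⟨c, hc, he⟩ := hσ a t₀ ht₀ (hf t₀ ht₀ ▸ hd)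
  refine ⟨c, hc, ?_⟩
  filter_upwards [he] with t h1 hA
  have key : ∀ n (e : n = f t) (hn : n ∈ V.dom a), σ t hA n e = ∑ i, c i t • V.frame a n hn i := by
    rintro n rfl hn
    exact h1 hA hn
  exact key _ _

/-- The pull-back of a family of torsors along a map. -/
def PreCircleBundle.pullback (L : PreCircleBundle.{w} S) (f : N' → N) (hf : Continuous f)
    (h : ∀ s ∈ S', f s ∈ S) : PreCircleBundle.{w} S' where
  fiber s := L.fiber ⟨f s.1, h _ s.2⟩
  torsor _ p q := L.torsor _ p q
  dom a := f ⁻¹' L.dom ⟨f a.1, h _ a.2⟩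
  isOpen_dom _ := (L.isOpen_dom _).preimage hf
  mem_dom a := L.mem_dom ⟨f a.1, h _ a.2⟩
  sec a s := L.sec ⟨f a.1, h _ a.2⟩ ⟨f s.1, h _ s.2⟩

theorem PreCircleBundle.IsSmoothAlong.pullback {L : PreCircleBundle.{w} S} {f : N' → N}
    {hf : Continuous f} {h : ∀ s ∈ S', f s ∈ S} {g : T → N'} {hg : ∀ t ∈ A, g t ∈ S'}
    {σ : ∀ (t : T) (ht : t ∈ A), L.fiber ⟨f (g t), h _ (hg t ht)⟩}
    (hσ : L.IsSmoothAlong J A (fun t => f (g t)) (fun t ht => h _ (hg t ht)) σ) :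
    (L.pullback f hf h).IsSmoothAlong J A g hg σ :=
  fun a => hσ ⟨f a.1, h _ a.2⟩

/-- The pull-back of a principal `U(1)`-bundle along a smooth map. -/
def CircleBundle.pullback (L : CircleBundle.{w} I S) (f : N' → N) (hf : ContMDiff I' I ∞ f)
    (h : ∀ s ∈ S', f s ∈ S) : CircleBundle.{w} I' S' where
  toPreCircleBundle := L.toPreCircleBundle.pullback f hf.continuous h
  sec_smooth b := PreCircleBundle.IsSmoothAlong.pullback (h := h)
    ((L.sec_smooth ⟨f b.1, h _ b.2⟩).comp hf.contMDiffOn fun _ hs => ⟨h _ hs.1, hs.2⟩)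

/-- The pull-back of a Real structure. -/
def CircleBundle.RealStructure.pullback {L : CircleBundle.{w} I S} {t : N → N}
    (τ : L.RealStructure t) (t' : N' → N') {f : N' → N} (hf : ContMDiff I' I ∞ f)
    (h : ∀ s ∈ S', f s ∈ S) (ht : ∀ s, f (t' s) = t (f s)) (h' : ∀ s ∈ S', t' s ∈ S') :
    (L.pullback f hf h).RealStructure t' where
  maps := h'
  tau s s' e p := τ.tau ⟨f s.1, h _ s.2⟩ ⟨f s'.1, h _ s'.2⟩ ((congrArg f e).trans (ht s.1)) p
  tau_smul s s' e z p := τ.tau_smul _ _ _ z p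
  tau_tau s s' e e' p := τ.tau_tau _ _ _ _ p
  tau_smooth b := by
    intro a t₀ ht₀ hd
    have h1 := (τ.tau_smooth ⟨f b.1, h _ b.2⟩).comp (J' := I')
      (B := S' ∩ (L.toPreCircleBundle.pullback f hf.continuous h).dom b)
      hf.contMDiffOn fun s hs => ⟨h _ hs.1, hs.2⟩
    obtain ⟨g, hg, he⟩ := h1 ⟨f a.1, h _ a.2⟩ t₀ ht₀
      (Set.mem_of_eq_of_mem (ht t₀).symm hd)
    refine ⟨g, hg, ?_⟩
    filter_upwards [he] with s hs hA
    -- The points `f (t' s)` and `t (f s)` are only provably equal. Generalising the end point lets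
    -- the equation be substituted.
    have key : ∀ (n : N) (hn : n ∈ S) (e : n = t (f s)),
        τ.tau ⟨f s, h _ hA.1⟩ ⟨n, hn⟩ e (L.sec ⟨f b.1, h _ b.2⟩ ⟨f s, h _ hA.1⟩) =
          g s • L.sec ⟨f a.1, h _ a.2⟩ ⟨n, hn⟩ := by
      rintro n hn rfl
      exact hs hA
    exact key _ _ _

end Pullback

/-! ### The trivial gerbe and Real trivialisations -/

section Trivial

variable {EM : Type*} [NormedAddCommGroup EM] [NormedSpace ℝ EM]
  {M : Type u} [TopologicalSpace M] [ChartedSpace EM M] [IsManifold 𝓘(ℝ, EM) ∞ M]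
  {EY : Type*} [NormedAddCommGroup EY] [NormedSpace ℝ EY]
  {Y : Type*} [TopologicalSpace Y] [ChartedSpace EY Y]

/-- The trivial `U(1)`-bundle. -/
def CircleBundle.trivial {E H : Type*} [NormedAddCommGroup E] [NormedSpace ℝ E] [TopologicalSpace H]
    {N : Type*} [TopologicalSpace N] [ChartedSpace H N] (I : ModelWithCorners ℝ E H) (S : Set N) :
    CircleBundle.{0} I S where
  fiber _ := Circle
  torsor _ p q := ⟨q * p⁻¹, inv_mul_cancel_right q p, fun _ h => eq_mul_inv_of_mul_eq h⟩
  dom _ := Set.univ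
  isOpen_dom _ := isOpen_univ
  mem_dom _ := Set.mem_univ _
  sec _ _ := 1
  sec_smooth _ _ _ _ _ := ⟨fun _ => 1, contMDiffWithinAt_const,
    Filter.Eventually.of_forall fun _ _ => (one_mul (1 : Circle)).symm⟩

/-- The trivial Real bundle gerbe over `M`, with `Y = M`. -/
def trivialGerbe (τ : SmoothInvolution 𝓘(ℝ, EM) M) : RealBundleGerbe.{u, 0} τ EM M where
  proj := id
  proj_surjective := Function.surjective_id
  proj_submersion := Manifold.IsSubmersion.id
  P := CircleBundle.trivial _ _
  mul _ _ (p : Circle) (q : Circle) := p * q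
  smul_mul _ _ z (p : Circle) (q : Circle) := mul_assoc z p q
  mul_smul _ _ z (p : Circle) (q : Circle) := mul_left_comm p z q
  mul_assoc _ _ _ (p : Circle) (q : Circle) (r : Circle) := mul_assoc p q r
  mul_smooth _ _ _ _ _ _ := ⟨fun _ => 1, contMDiffWithinAt_const,
    Filter.Eventually.of_forall fun _ _ => rfl⟩
  tauY := τ
  proj_tauY _ := rfl
  tauP :=
    { maps := fun _ h => congrArg τ h
      tau := fun _ _ _ p => ((p : Circle)⁻¹ : Circle)
      tau_smul := fun _ _ _ z (p : Circle) => mul_inv z p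
      tau_tau := fun _ _ _ _ (p : Circle) => inv_inv p
      tau_smooth := fun _ _ _ _ _ => ⟨fun _ => 1, contMDiffWithinAt_const,
        Filter.Eventually.of_forall fun _ _ => (inv_one (G := Circle)).trans (one_mul 1).symm⟩ }
  tau_mul _ _ (p : Circle) (q : Circle) := mul_inv p q

variable {τ : SmoothInvolution 𝓘(ℝ, EM) M} {k : ℕ∞} {G : RealBundleGerbe.{u, w} τ EY Y}

/-- A Real vector bundle over `M` as a module over the trivial gerbe. -/
def RealVectorBundle.toModule (V : RealVectorBundle.{v} k τ) :
    RealModule.{u, 0, v} k (trivialGerbe τ) where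
  toRealVectorBundle := V
  -- With $Y=M$ the fibre product is the diagonal, so the action is a scalar, after a transport
  -- between fibres over provably equal points.
  act {m₁ m₂} (h : m₁ = m₂) (p : Circle) := (V.castEquiv h.symm).trans
    (LinearEquiv.smulOfNeZero ℂ (V.fiber m₁) (p : ℂ) (Circle.coe_ne_zero p))
  smul_act {m₁ m₂} (h : m₁ = m₂) z (p : Circle) x := by
    subst h
    change ((z * p : Circle) : ℂ) • x = (z : ℂ) • (p : ℂ) • x
    rw [Circle.coe_mul, mul_smul]
  mul_act {m₁ m₂ m₃} (h : m₁ = m₂) (h' : m₂ = m₃) (p : Circle) (q : Circle) x := by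
    subst h h'
    change ((p * q : Circle) : ℂ) • x = (p : ℂ) • (q : ℂ) • x
    rw [Circle.coe_mul, mul_smul]
  act_smooth a b j := by
    have h1 := VectorBundle.frame_isSmoothAlong (V := V.toVectorBundle)
      (J := 𝓘(ℝ, EM).prod 𝓘(ℝ, EM)) (f := fun t : M × M => t.2)
      (A := {t : M × M | (trivialGerbe τ).proj t.1 = (trivialGerbe τ).proj t.2 ∧
        t ∈ (trivialGerbe τ).P.dom a ∧ t.2 ∈ V.dom b}) contMDiffOn_snd b (fun t h => h.2.2) j
    refine (PreVectorBundle.IsSmoothAlong.congr_map (f' := fun t : M × M => t.1)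
      (fun t ht n e => V.frame b n (e ▸ ht.2.2) j) h1 (fun t ht => ht.1)).congr ?_
    rintro ⟨m₁, m₂⟩ ⟨h, h₂, h₃⟩
    obtain rfl : m₁ = m₂ := h
    exact one_smul ℂ _
  tau_act {m₁ m₂} (h : m₁ = m₂) (p : Circle) x := by
    subst h
    change V.tau m₁ (τ m₁) rfl ((p : ℂ) • x) = ((p⁻¹ : Circle) : ℂ) • V.tau m₁ (τ m₁) rfl x
    rw [map_smulₛₗ, Circle.coe_inv_eq_conj]

theorem RealVectorBundle.toModule_act (V : RealVectorBundle.{v} k τ) (m : M) (p : Circle)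
    (x : V.fiber m) : V.toModule.act (y₁ := m) (y₂ := m) rfl p x = (p : ℂ) • x := rfl

/-- Modules over the trivial gerbe are Real vector bundles. -/
def RealModule.isoToModule (V : RealModule.{u, 0, v} k (trivialGerbe τ)) :
    RealModule.Iso V (RealVectorBundle.toModule V.toRealVectorBundle) where
  toIso := .refl V.toRealVectorBundle
  map_act {m₁ m₂} (h : m₁ = m₂) (p : Circle) x := by
    subst h
    -- The number 1 is idempotent, hence the unit of the gerbe and acts as the identity. By
    -- equivariance $p=p\cdot 1$ then acts as the scalar $p$.
    have h1 : (1 : Circle) = (trivialGerbe τ).one m₁ :=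
      BundleGerbe.eq_one (G := (trivialGerbe τ).toBundleGerbe) (mul_one (1 : Circle))
    have h2 := V.smul_act (y₁ := m₁) rfl p ((trivialGerbe τ).one m₁) x
    rw [V.act_one] at h2
    refine Eq.trans ?_ h2
    refine congrArg (fun q => V.act rfl q x) ?_
    rw [← h1]
    exact (mul_one p).symm

/-- The action of the trivial gerbe is forced to be scalar multiplication, so it is no additional
structure, and linear maps commute with it automatically. -/
theorem exists_trivialGerbe_addEquiv (τ : SmoothInvolution 𝓘(ℝ, EM) M) (k : ℕ∞) :
    ∃ Φ : RVect.{v} k τ ≃+ Rmod.{u, 0, v} k (trivialGerbe τ),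
      ∀ V, Φ (RVect.mk V) = Rmod.mk V.toModule := by
  let F : RVect.{v} k τ → Rmod.{u, 0, v} k (trivialGerbe τ) :=
    Quotient.map (fun V : RealVectorBundle.{v} k τ => V.toModule) (by
      intro V W e
      obtain ⟨φ⟩ : Nonempty (RealVectorBundle.Iso V W) := e
      refine ⟨⟨φ, fun {m₁ m₂} h p x => ?_⟩⟩
      obtain rfl : m₁ = m₂ := h
      exact map_smul (φ.equiv m₁) _ x)
  have hb : Function.Bijective F := by
    constructor
    · rintro ⟨V⟩ ⟨W⟩ h
      obtain ⟨φ⟩ := Quotient.exact h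
      exact Quotient.sound ⟨φ.toIso⟩
    · rintro ⟨V⟩
      have e : V.toRealVectorBundle.toModule ≈ V := ⟨V.isoToModule.symm⟩
      exact ⟨RVect.mk V.toRealVectorBundle, Quotient.sound e⟩
  have hadd : ∀ a b, F (a + b) = F a + F b := by
    rintro ⟨V⟩ ⟨W⟩
    exact Quotient.sound ⟨(RealModule.isoToModule (V.toModule.sum W.toModule)).symm⟩
  exact ⟨{ Equiv.ofBijective F hb with map_add' := hadd }, fun _ => rfl⟩

namespace RealTrivialisation

variable (S : RealTrivialisation.{u, w, w'} G)

/-- A Real trivialisation as a Real stable isomorphism from the trivial gerbe. -/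
def toStableIso : RealStableIso.{u, 0, w, w'} (trivialGerbe τ) G where
  R := S.R.pullback (fun s => s.2) contMDiff_snd (fun _ _ => trivial)
  tau := S.tau.pullback _ contMDiff_snd (fun _ _ => trivial) (fun _ => rfl)
    (fun s (h : s.1 = G.proj s.2) => (congrArg τ h).trans (G.proj_tauY s.2).symm)
  -- The inverse appears because a stable isomorphism is contravariant in its first gerbe.
  act _ hx _ _ (z : Circle) r q := z⁻¹ • S.act hx r q
  act_smul_left _ hx _ _ z (p : Circle) r q := by
    change (z * p)⁻¹ • S.act hx r q = z⁻¹ • p⁻¹ • S.act hx r q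
    rw [mul_inv, mul_smul]
  act_smul_middle _ hx _ _ z (p : Circle) r q := by
    refine (congrArg (p⁻¹ • ·) (S.smul_act hx z r q)).trans ?_
    exact smul_comm p⁻¹ z (S.act hx r q)
  act_smul_right _ hx _ _ z (p : Circle) r q := by
    refine (congrArg (p⁻¹ • ·) (S.act_smul hx z r q)).trans ?_
    exact smul_comm p⁻¹ z (S.act hx r q)
  act_mul _ _ hx hx' _ _ _ (p : Circle) (p' : Circle) r q q' := by
    refine Eq.trans ?_ (congrArg (p'⁻¹ • ·) (S.smul_act hx' p⁻¹ (S.act hx r q) q')).symm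
    refine Eq.trans ?_ (mul_smul p'⁻¹ p⁻¹ (S.act hx' (S.act hx r q) q'))
    exact congrArg₂ (· • ·) (mul_inv_rev p p') (S.act_mul hx hx' r q q')
  act_smooth a b c := by
    have h1 := ((S.act_smooth ⟨b.1.2, trivial⟩ c).comp (g := fun t : (M × M) × (Y × Y) => t.2)
      (B := {t |
      ((trivialGerbe τ).proj t.1.1 = (trivialGerbe τ).proj t.1.2 ∧ G.proj t.2.1 = G.proj t.2.2 ∧
        (trivialGerbe τ).proj t.1.1 = G.proj t.2.1 ∧ (trivialGerbe τ).proj t.1.2 = G.proj t.2.2) ∧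
        t.1 ∈ (trivialGerbe τ).P.dom a ∧ t.2.1 ∈ S.R.dom ⟨b.1.2, trivial⟩ ∧ t.2 ∈ G.P.dom c})
      (J' := (𝓘(ℝ, EM).prod 𝓘(ℝ, EM)).prod (𝓘(ℝ, EY).prod 𝓘(ℝ, EY)))
      contMDiffOn_snd fun t ht => ⟨ht.1.2.1, ht.2.2.1, ht.2.2.2⟩).smul
      (contMDiffOn_const (c := (((1 : Circle)⁻¹ : Circle) : ℂ)))
    exact PreCircleBundle.IsSmoothAlong.pullback (L := S.R.toPreCircleBundle)
      (S := Set.univ) (f := fun s : M × Y => s.2)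
      (S' := {s | (trivialGerbe τ).proj s.1 = G.proj s.2}) (hf := continuous_snd)
      (h := fun _ _ => trivial) (g := fun t : (M × M) × (Y × Y) => (t.1.2, t.2.2)) h1
  tau_act _ hx _ _ (p : Circle) r q := by
    refine (S.tau.tau_smul _ _ _ p⁻¹ (S.act hx r q)).trans ?_
    exact congrArg (p⁻¹⁻¹ • ·) (S.tau_act hx r q)

variable {S} {V : RealModule.{u, w, v} k G} {W : RealVectorBundle.{v} k τ}

/-- The pulled-back bundle has fibre $R_y$ over $(m,y)$, so both sides ask for the same family
$R_y\otimes V_y\simeq W_{\pi(y)}$. They differ only in the scalar from the trivial gerbe. -/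
theorem induces_toStableIso_iff : S.toStableIso.Induces W.toModule V ↔ S.Induces V W := by
  constructor
  · rintro ⟨ρ, h1, h2, h3, h4⟩
    refine ⟨fun y m h r => ρ m y h.symm r, fun y m h z r ξ => h1 m y h.symm z r ξ, ?_, ?_, ?_⟩
    · intro y₁ y₂ m hy h₂ r p ξ
      refine (h2 m m y₁ y₂ rfl hy (hy.trans h₂).symm h₂.symm (1 : Circle) r p ξ).symm.trans ?_
      refine (W.toModule_act m 1 _).trans ?_
      refine (congrArg (· • _) Circle.coe_one).trans ((one_smul ℂ _).trans ?_)
      refine congrArg (fun r => ρ m y₂ h₂.symm r ξ) ?_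
      exact (congrArg (· • S.act hy r p) inv_one).trans (one_smul Circle _)
    · intro y m h h' r ξ
      exact h3 m y h.symm r ξ
    · intro a b j
      have hp : ContMDiff 𝓘(ℝ, EY) 𝓘(ℝ, EM) ∞ G.proj := G.proj_submersion.contMDiff
      exact (h4 ⟨(G.proj a.1, a.1), rfl⟩ b j).comp (g := fun y : Y => (G.proj y, y))
        (hp.contMDiffOn.prodMk contMDiffOn_id) fun y hy => ⟨rfl, hy.1, hy.2⟩
  · rintro ⟨ρ, h1, h2, h3, h4⟩
    refine ⟨fun m y h r => ρ y m h.symm r, fun m y h z r ξ => h1 y m h.symm z r ξ, ?_, ?_, ?_⟩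
    · intro m₁ m₂ y₁ y₂ hm hy e₁ e₂ p r q ξ
      obtain rfl : m₁ = m₂ := hm
      change Circle at p
      refine (W.toModule_act m₁ p _).trans ?_
      refine Eq.trans ?_ (h2 y₁ y₂ m₁ hy e₂.symm r q ξ).symm
      -- The scalar `p` acting on $W$ moves into $R$ and cancels the $p^{-1}$ in the definition of
      -- `act`.
      refine (h1 y₂ m₁ e₂.symm p _ ξ).symm.trans ?_
      refine congrArg (fun r => ρ y₂ m₁ e₂.symm r ξ) ?_
      exact smul_inv_smul p (S.act hy r q)
    · intro m y h r ξ
      exact h3 y m h.symm _ r ξ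
    · intro a b j
      -- The section has values over `t.1`, but `h4` speaks of the fibres over the projection of
      -- `t.2`; the two agree on the fibre product.
      refine PreVectorBundle.IsSmoothAlong.congr_map (f := fun t : M × Y => G.proj t.2)
        (fun t ht n e => ρ t.2 n e.symm (S.R.sec ⟨a.1.2, trivial⟩ ⟨t.2, trivial⟩)
          (V.frame b t.2 ht.2.2 j)) ?_ fun t ht => ht.1
      exact (h4 ⟨a.1.2, trivial⟩ b j).comp (g := fun t : M × Y => t.2) contMDiffOn_snd
        fun t ht => ⟨ht.2.1, ht.2.2⟩

/-- `toStableIso` starts at the trivial gerbe, so the desired map is the inverse of the composite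
from Real vector bundles through its modules. -/
theorem exists_addEquiv [IsManifold 𝓘(ℝ, EY) ∞ Y] (S : RealTrivialisation.{u, w, w'} G) (k : ℕ∞) :
    ∃ Φ : Rmod.{u, w, v} k G ≃+ RVect.{v} k τ,
      ∀ (V : RealModule.{u, w, v} k G) (W : RealVectorBundle.{v} k τ),
        Φ (Rmod.mk V) = RVect.mk W ↔ S.Induces V W := by
  obtain ⟨Φ, hΦ⟩ := S.toStableIso.exists_addEquiv k
  obtain ⟨Φ', hΦ'⟩ := exists_trivialGerbe_addEquiv τ k
  refine ⟨(Φ'.trans Φ).symm, fun V W => ?_⟩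
  rw [AddEquiv.symm_apply_eq, AddEquiv.trans_apply, hΦ', eq_comm, hΦ, induces_toStableIso_iff]

end RealTrivialisation

end Trivial

/-- Smoothness along a map depends only on the values of the map. -/
theorem PreCircleBundle.IsSmoothAlong.congr_map {N : Type*} [TopologicalSpace N]
    {E' H' : Type*} [NormedAddCommGroup E'] [NormedSpace ℝ E'] [TopologicalSpace H']
    {J : ModelWithCorners ℝ E' H'} {T : Type*} [TopologicalSpace T] [ChartedSpace H' T]
    {A : Set T} {S : Set N} {L : PreCircleBundle.{w} S} {f f' : T → N}
    (σ : ∀ t ∈ A, ∀ n (hn : n ∈ S), n = f t → L.fiber ⟨n, hn⟩) {hf : ∀ t ∈ A, f t ∈ S}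
    (hσ : L.IsSmoothAlong J A f hf (fun t ht => σ t ht (f t) (hf t ht) rfl))
    (hff : ∀ t ∈ A, f' t = f t) {hf' : ∀ t ∈ A, f' t ∈ S} :
    L.IsSmoothAlong J A f' hf' (fun t ht => σ t ht (f' t) (hf' t ht) (hff t ht)) := by
  intro a t₀ ht₀ hd
  obtain ⟨c, hc, he⟩ := hσ a t₀ ht₀ (hff t₀ ht₀ ▸ hd)
  refine ⟨c, hc, ?_⟩
  filter_upwards [he] with t h1 hA
  have key : ∀ n (hn : n ∈ S) (e : n = f t), σ t hA n hn e = c t • L.sec a ⟨n, hn⟩ := by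
    rintro n hn rfl
    exact h1 hA
  exact key _ _ _

/-! ### Refinement of Dixmier-Douady data and the transition quotients -/

section DDData

variable {EM : Type*} [NormedAddCommGroup EM] [NormedSpace ℝ EM]
  {M : Type u} [TopologicalSpace M] [ChartedSpace EM M]
  {EY : Type*} [NormedAddCommGroup EY] [NormedSpace ℝ EY]
  {Y : Type*} [TopologicalSpace Y] [ChartedSpace EY Y]
  {τ : SmoothInvolution 𝓘(ℝ, EM) M}
  {E' H' : Type*} [NormedAddCommGroup E'] [NormedSpace ℝ E'] [TopologicalSpace H']
  {J : ModelWithCorners ℝ E' H'} {T : Type*} [TopologicalSpace T] [ChartedSpace H' T]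
  {A : Set T}
  {G : RealBundleGerbe.{u, w} τ EY Y}

/-- The restriction of a Real cocycle to a refinement. -/
def RealCocycle.refine {𝒰 𝒲 : RealCover τ} (g : RealCocycle 𝒰) (r : 𝒲.Refinement 𝒰) :
    RealCocycle 𝒲 where
  g i j k := g.g (r.map i) (r.map j) (r.map k)
  smooth i j k := (g.smooth _ _ _).mono fun _ h =>
    ⟨⟨r.subset _ h.1.1, r.subset _ h.1.2⟩, r.subset _ h.2⟩
  real i j k m hi hj hk := by
    rw [r.map_bar, r.map_bar, r.map_bar]
    exact g.real _ _ _ m (r.subset _ hi) (r.subset _ hj) (r.subset _ hk)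
  cocycle i j k l m hi hj hk hl :=
    g.cocycle _ _ _ _ m (r.subset _ hi) (r.subset _ hj) (r.subset _ hk) (r.subset _ hl)

/-- The trivial Real cochain. -/
def RealCochain.one (𝒰 : RealCover τ) : RealCochain 𝒰 where
  c _ _ _ := 1
  smooth _ _ := contMDiffOn_const
  real _ _ _ _ _ := inv_one.symm

namespace RealDDData

variable {𝒰 : RealCover τ} {g : RealCocycle 𝒰}

/-- Restriction to a refinement, followed by multiplication with a Real cochain. -/
def refine (d : RealDDData G 𝒰 g) {𝒲 : RealCover τ} (r : 𝒲.Refinement 𝒰) (e : RealCochain 𝒲)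
    (g' : RealCocycle 𝒲)
    (h : ∀ i j k m, m ∈ 𝒲.U i → m ∈ 𝒲.U j → m ∈ 𝒲.U k → g'.g i j k m =
      g.g (r.map i) (r.map j) (r.map k) m * (e.c j k m * (e.c i k m)⁻¹ * e.c i j m)) :
    RealDDData G 𝒲 g' where
  s i := d.s (r.map i)
  s_smooth i := (d.s_smooth _).mono (r.subset i)
  proj_s hm := d.proj_s (r.subset _ hm)
  s_real {i m} hm := by
    rw [r.map_bar]
    exact d.s_real (r.subset _ hm)
  σ {i j m} hi hj := e.c i j m • d.σ (r.subset _ hi) (r.subset _ hj)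
  σ_smooth i j := ((d.σ_smooth (r.map i) (r.map j)).mono
    fun m h => ⟨r.subset _ h.1, r.subset _ h.2⟩).smul (e.smooth i j)
  σ_real {i j m} hi hj := by
    rw [G.tauP.tau_smul, e.real i j m hi hj]
    congr 1
    -- The refinement map commutes with `bar` only up to a proved equality of indices, on which the
    -- fibres depend. The indices are generalised and then substituted.
    have key : ∀ i' j' (hi' : i' = 𝒰.bar (r.map i)) (hj' : j' = 𝒰.bar (r.map j))
        (h1 : τ m ∈ 𝒰.U i') (h2 : τ m ∈ 𝒰.U j')
        (e' : ((d.s i' (τ m), d.s j' (τ m)) : Y × Y) =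
          (G.tauY (d.s (r.map i) m), G.tauY (d.s (r.map j) m))),
        d.σ h1 h2 = G.tauP.tau ⟨(d.s (r.map i) m, d.s (r.map j) m),
          (d.proj_s (r.subset _ hi)).trans (d.proj_s (r.subset _ hj)).symm⟩
          ⟨(d.s i' (τ m), d.s j' (τ m)), (d.proj_s h1).trans (d.proj_s h2).symm⟩ e'
          (d.σ (r.subset _ hi) (r.subset _ hj)) := by
      rintro i' j' rfl rfl h1 h2 e'
      exact d.σ_real (r.subset _ hi) (r.subset _ hj)
    exact key _ _ (r.map_bar i) (r.map_bar j) _ _ _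
  mul_σ {i j k m} hi hj hk := by
    rw [G.smul_mul, G.mul_smul, d.mul_σ, h i j k m hi hj hk]
    simp only [smul_smul]
    congr 1
    apply Additive.ofMul.injective
    simp only [ofMul_mul, ofMul_inv]
    abel

variable (d : RealDDData G 𝒰 g)

/-- The section `σ_ij`, with its two end points over points of the base that are merely equal. -/
def transition {i j : 𝒰.ι} {m m' : M} (e : m = m') (hi : m ∈ 𝒰.U i) (hj : m' ∈ 𝒰.U j) :
    G.P.fiber ⟨(d.s i m, d.s j m'), (d.proj_s hi).trans (e.trans (d.proj_s hj).symm)⟩ := by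
  subst e
  exact d.σ hi hj

variable {d}

theorem mul_transition {i j k : 𝒰.ι} {m m' m'' : M} (e : m = m') (e' : m' = m'')
    (hi : m ∈ 𝒰.U i) (hj : m' ∈ 𝒰.U j) (hk : m'' ∈ 𝒰.U k) :
    G.mul ((d.proj_s hi).trans (e.trans (d.proj_s hj).symm))
      ((d.proj_s hj).trans (e'.trans (d.proj_s hk).symm)) (d.transition e hi hj)
      (d.transition e' hj hk) = g.g i j k m • d.transition (e.trans e') hi hk := by
  subst e e'
  exact d.mul_σ hi hj hk

theorem tau_transition {i j : 𝒰.ι} {m m' : M} (e : m = m') (hi : m ∈ 𝒰.U i) (hj : m' ∈ 𝒰.U j) :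
    G.tauP.tau ⟨(d.s i m, d.s j m'), (d.proj_s hi).trans (e.trans (d.proj_s hj).symm)⟩
      ⟨(d.s (𝒰.bar i) (τ m), d.s (𝒰.bar j) (τ m')), (d.proj_s (𝒰.tau_mem hi)).trans
        ((congrArg τ e).trans (d.proj_s (𝒰.tau_mem hj)).symm)⟩
      (Prod.ext (d.s_real hi) (d.s_real hj)) (d.transition e hi hj) =
      d.transition (congrArg τ e) (𝒰.tau_mem hi) (𝒰.tau_mem hj) := by
  subst e
  exact (d.σ_real hi hj).symm

theorem transition_isSmoothAlong {i j : 𝒰.ι} {m m' : T → M}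
    (hm : ContMDiffOn J 𝓘(ℝ, EM) ∞ m A) (e : ∀ t ∈ A, m t = m' t)
    (hi : ∀ t ∈ A, m t ∈ 𝒰.U i) (hj : ∀ t ∈ A, m' t ∈ 𝒰.U j) :
    G.P.IsSmoothAlong J A (fun t => (d.s i (m t), d.s j (m' t)))
      (fun t h => (d.proj_s (hi t h)).trans ((e t h).trans (d.proj_s (hj t h)).symm))
      (fun t h => d.transition (e t h) (hi t h) (hj t h)) := by
  have h1 := (d.σ_smooth i j).comp hm fun t h => ⟨hi t h, (e t h) ▸ hj t h⟩
  intro a t₀ ht₀ hd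
  obtain ⟨c, hc, he⟩ := h1 a t₀ ht₀
    (Set.mem_of_eq_of_mem (congrArg (fun x => (d.s i (m t₀), d.s j x)) (e t₀ ht₀)) hd)
  refine ⟨c, hc, ?_⟩
  filter_upwards [he] with t h2 hA
  have key : ∀ n (hn : n ∈ 𝒰.U j) (e' : m t = n), d.transition e' (hi t hA) hn =
      c t • G.P.sec a ⟨(d.s i (m t), d.s j n), (d.proj_s (hi t hA)).trans
        (e'.trans (d.proj_s hn).symm)⟩ := by
    rintro n hn rfl
    exact h2 hA
  exact key _ _ _

/-- Both base points are the image of `y`. They stay separate variables because conjugation produces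
$\tau m$, which equals the image of the conjugate of $y$ only provably. -/
theorem eq_of_proj {i j : 𝒰.ι} {m m' : M} (hi : m ∈ 𝒰.U i) (hj : m' ∈ 𝒰.U j) {y : Y}
    (hp : G.proj (d.s i m) = G.proj y) (hp' : G.proj (d.s j m') = G.proj y) : m = m' :=
  (d.proj_s hi).symm.trans (hp.trans (hp'.symm.trans (d.proj_s hj)))

variable (d)

/-- The quotient of `σ_ij p'` by `p`, for elements `p` and `p'` of the fibres of `P` over `(s_i, y)` and
`(s_j, y)`. -/
def quot {i j : 𝒰.ι} {m m' : M} (hi : m ∈ 𝒰.U i) (hj : m' ∈ 𝒰.U j) {y : Y}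
    (hp : G.proj (d.s i m) = G.proj y) (hp' : G.proj (d.s j m') = G.proj y)
    (p : G.P.fiber ⟨(d.s i m, y), hp⟩) (p' : G.P.fiber ⟨(d.s j m', y), hp'⟩) : Circle :=
  PreCircleBundle.quot p (G.mul ((d.proj_s hi).trans
    ((d.eq_of_proj hi hj hp hp').trans (d.proj_s hj).symm)) hp'
    (d.transition (d.eq_of_proj hi hj hp hp') hi hj) p')

variable {d}

section

variable {i j k : 𝒰.ι} {m m' m'' : M} {hi : m ∈ 𝒰.U i} {hj : m' ∈ 𝒰.U j} {hk : m'' ∈ 𝒰.U k} {y : Y}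
  {hp : G.proj (d.s i m) = G.proj y} {hp' : G.proj (d.s j m') = G.proj y}
  {hp'' : G.proj (d.s k m'') = G.proj y}
  {p : G.P.fiber ⟨(d.s i m, y), hp⟩} {p' : G.P.fiber ⟨(d.s j m', y), hp'⟩}
  {p'' : G.P.fiber ⟨(d.s k m'', y), hp''⟩}

theorem quot_smul : d.quot hi hj hp hp' p p' • p = G.mul ((d.proj_s hi).trans
    ((d.eq_of_proj hi hj hp hp').trans (d.proj_s hj).symm)) hp'
    (d.transition (d.eq_of_proj hi hj hp hp') hi hj) p' :=
  PreCircleBundle.quot_smul _ _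

theorem quot_eq {z : Circle} (h : G.mul ((d.proj_s hi).trans
    ((d.eq_of_proj hi hj hp hp').trans (d.proj_s hj).symm)) hp'
    (d.transition (d.eq_of_proj hi hj hp hp') hi hj) p' = z • p) :
    d.quot hi hj hp hp' p p' = z :=
  PreCircleBundle.quot_eq h.symm

/-- Evaluate $\sigma_{ij}\sigma_{jk}p''$ in both bracketings: one gives the product of quotients,
the other $g_{ijk}\sigma_{ik}p''$. The quotients are thus multiplicative up to the Dixmier-Douady
cocycle. -/
theorem quot_mul_quot : d.quot hi hj hp hp' p p' * d.quot hj hk hp' hp'' p' p'' =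
    g.g i j k m * d.quot hi hk hp hp'' p p'' := by
  have e := d.eq_of_proj hi hj hp hp'
  have e' := d.eq_of_proj hj hk hp' hp''
  refine PreCircleBundle.smul_right_cancel (L := G.P.toPreCircleBundle) (p := p) ?_
  have h1 := G.mul_assoc ((d.proj_s hi).trans (e.trans (d.proj_s hj).symm))
    ((d.proj_s hj).trans (e'.trans (d.proj_s hk).symm)) hp''
    (d.transition e hi hj) (d.transition e' hj hk) p''
  rw [mul_transition, G.smul_mul, ← quot_smul (p := p), ← quot_smul (p := p'), G.mul_smul,
    ← quot_smul (p := p), smul_smul, smul_smul] at h1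
  rw [h1, mul_comm]

theorem quot_smul_left (z : Circle) :
    d.quot hi hj hp hp' (z • p) p' = z⁻¹ * d.quot hi hj hp hp' p p' := by
  apply quot_eq
  rw [smul_smul, mul_right_comm, inv_mul_cancel, one_mul, quot_smul]

theorem quot_smul_right (z : Circle) :
    d.quot hi hj hp hp' p (z • p') = z * d.quot hi hj hp hp' p p' := by
  apply quot_eq
  rw [G.mul_smul, ← quot_smul (p := p), smul_smul]

/-- The transition $\sigma_{ij}$ multiplies on the left, so by associativity it commutes with
multiplication on the right. Hence $P$ and $Q$ act on the glued bundle. -/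
theorem quot_mul_right {y' : Y} (hy : G.proj y = G.proj y') (q : G.P.fiber ⟨(y, y'), hy⟩) :
    d.quot hi hj (hp.trans hy) (hp'.trans hy) (G.mul hp hy p q) (G.mul hp' hy p' q) =
      d.quot hi hj hp hp' p p' := by
  apply quot_eq
  rw [← G.smul_mul, quot_smul, G.mul_assoc]

theorem quot_tau {y' : Y} (ey : y' = G.tauY y)
    (ht : G.proj (d.s (𝒰.bar i) (τ m)) = G.proj y')
    (ht' : G.proj (d.s (𝒰.bar j) (τ m')) = G.proj y') :
    d.quot (𝒰.tau_mem hi) (𝒰.tau_mem hj) ht ht'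
      (G.tauP.tau ⟨(d.s i m, y), hp⟩ ⟨(d.s (𝒰.bar i) (τ m), y'), ht⟩ (Prod.ext (d.s_real hi) ey) p)
      (G.tauP.tau ⟨(d.s j m', y), hp'⟩ ⟨(d.s (𝒰.bar j) (τ m'), y'), ht'⟩
        (Prod.ext (d.s_real hj) ey) p') = (d.quot hi hj hp hp' p p')⁻¹ := by
  have e := d.eq_of_proj hi hj hp hp'
  apply quot_eq
  rw [← tau_transition e hi hj, ← RealBundleGerbe.tau_mul' (d.s_real hi) (d.s_real hj) ey,
    ← G.tauP.tau_smul, quot_smul]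

end

theorem exists_smooth_quot {i j : 𝒰.ι} {m m' : T → M} (hm : ContMDiffOn J 𝓘(ℝ, EM) ∞ m A)
    {hi : ∀ t ∈ A, m t ∈ 𝒰.U i} {hj : ∀ t ∈ A, m' t ∈ 𝒰.U j} {y : T → Y}
    (hy : ContMDiffOn J 𝓘(ℝ, EY) ∞ y A)
    {hp : ∀ t ∈ A, G.proj (d.s i (m t)) = G.proj (y t)}
    {hp' : ∀ t ∈ A, G.proj (d.s j (m' t)) = G.proj (y t)}
    {p : ∀ t (ht : t ∈ A), G.P.fiber ⟨(d.s i (m t), y t), hp t ht⟩}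
    {p' : ∀ t (ht : t ∈ A), G.P.fiber ⟨(d.s j (m' t), y t), hp' t ht⟩}
    (hps : G.P.IsSmoothAlong J A (fun t => (d.s i (m t), y t)) hp p)
    (hps' : G.P.IsSmoothAlong J A (fun t => (d.s j (m' t), y t)) hp' p') :
    ∃ c : T → Circle, ContMDiffOn J 𝓘(ℝ, ℂ) ∞ (fun t => (c t : ℂ)) A ∧
      ∀ t ht, d.quot (hi t ht) (hj t ht) (hp t ht) (hp' t ht) (p t ht) (p' t ht) = c t := by
  have e : ∀ t ∈ A, m t = m' t := fun t ht => d.eq_of_proj (hi t ht) (hj t ht) (hp t ht) (hp' t ht)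
  have hm' : ContMDiffOn J 𝓘(ℝ, EM) ∞ m' A := hm.congr fun t ht => (e t ht).symm
  have hs : ContMDiffOn J 𝓘(ℝ, EY) ∞ (fun t => d.s i (m t)) A := (d.s_smooth i).comp hm hi
  have hs' : ContMDiffOn J 𝓘(ℝ, EY) ∞ (fun t => d.s j (m' t)) A := (d.s_smooth j).comp hm' hj
  obtain ⟨c, hc, he⟩ := CircleBundle.exists_quot (hs.prodMk hy).continuousOn hps
    (G.mul_isSmoothAlong hs hs' hy (d.transition_isSmoothAlong hm e hi hj) hps')
  exact ⟨c, hc, fun t ht => quot_eq (he t ht)⟩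

end RealDDData

end DDData

/-! ### Fibres of the comparison bundle of two gerbes with one cocycle -/

section Comparison

variable {EM : Type*} [NormedAddCommGroup EM] [NormedSpace ℝ EM]
  {M : Type u} [TopologicalSpace M] [ChartedSpace EM M]
  {EY : Type*} [NormedAddCommGroup EY] [NormedSpace ℝ EY]
  {Y : Type*} [TopologicalSpace Y] [ChartedSpace EY Y]
  {EX : Type*} [NormedAddCommGroup EX] [NormedSpace ℝ EX]
  {X : Type*} [TopologicalSpace X] [ChartedSpace EX X]
  {τ : SmoothInvolution 𝓘(ℝ, EM) M}
  {E' H' : Type*} [NormedAddCommGroup E'] [NormedSpace ℝ E'] [TopologicalSpace H']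
  {J : ModelWithCorners ℝ E' H'} {T : Type*} [TopologicalSpace T] [ChartedSpace H' T]
  {A : Set T}
  {G : RealBundleGerbe.{u, w} τ EY Y} {G' : RealBundleGerbe.{u, w'} τ EX X}
  {𝒰 : RealCover τ} {g : RealCocycle 𝒰}

/-- A point of `P_(s_i, y)^* ⊗ Q_(t_i, x)`. -/
structure Pairing (d : RealDDData G 𝒰 g) (d' : RealDDData G' 𝒰 g) (y : Y) (x : X) where
  i : 𝒰.ι
  m : M
  mem : m ∈ 𝒰.U i
  hy : G.proj (d.s i m) = G.proj y
  hx : G'.proj (d'.s i m) = G'.proj x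
  p : G.P.fiber ⟨(d.s i m, y), hy⟩
  q : G'.P.fiber ⟨(d'.s i m, x), hx⟩

namespace Pairing

variable {d : RealDDData G 𝒰 g} {d' : RealDDData G' 𝒰 g} {y : Y} {x : X}

/-- The circle acts on the factor of $Q$. Its action on the factor of $P$ is inverse to this up to
the identification, by `smul_left_equiv`. -/
instance : MulAction Circle (Pairing d d' y x) where
  smul z s := { s with q := z • s.q }
  one_smul s := congrArg (fun q => { s with q := q }) (one_smul Circle s.q)
  mul_smul z z' s := congrArg (fun q => { s with q := q }) (mul_smul z z' s.q)

/-- The quotient of two points under the identification of `P_(s_i, y)^* ⊗ Q_(t_i, x)` with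
`P_(s_j, y)^* ⊗ Q_(t_j, x)`. -/
def ratio (s t : Pairing d d' y x) : Circle :=
  d'.quot s.mem t.mem s.hx t.hx s.q t.q * (d.quot s.mem t.mem s.hy t.hy s.p t.p)⁻¹

/-- The equality of the two cocycles enters here: the failure of multiplicativity is $g_{ijk}$ for
both gerbes, and it cancels because $P$ enters dually. -/
theorem ratio_mul_ratio (s t r : Pairing d d' y x) : ratio s t * ratio t r = ratio s r := by
  have h := RealDDData.quot_mul_quot (d := d) (hi := s.mem) (hj := t.mem) (hk := r.mem)
    (p := s.p) (p' := t.p) (p'' := r.p)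
  have h' := RealDDData.quot_mul_quot (d := d') (hi := s.mem) (hj := t.mem) (hk := r.mem)
    (p := s.q) (p' := t.q) (p'' := r.q)
  unfold ratio
  rw [mul_mul_mul_comm, h', ← mul_inv, h, mul_inv, mul_mul_mul_comm, mul_inv_cancel, one_mul]

theorem ratio_self (s : Pairing d d' y x) : ratio s s = 1 :=
  mul_eq_left.1 (ratio_mul_ratio s s s)

theorem ratio_smul_right (s t : Pairing d d' y x) (z : Circle) :
    ratio s (z • t) = z * ratio s t :=
  (congrArg (· * _) (RealDDData.quot_smul_right z)).trans (mul_assoc _ _ _)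

theorem ratio_smul_left (s t : Pairing d d' y x) (z : Circle) :
    ratio (z • s) t = z⁻¹ * ratio s t :=
  (congrArg (· * _) (RealDDData.quot_smul_left z)).trans (mul_assoc _ _ _)

/-- The points that are identified. -/
instance setoid (d : RealDDData G 𝒰 g) (d' : RealDDData G' 𝒰 g) (y : Y) (x : X) :
    Setoid (Pairing d d' y x) where
  r s t := ratio s t = 1
  iseqv := ⟨ratio_self, fun {s t} h => by
      have := ratio_mul_ratio t s t
      rwa [h, mul_one, ratio_self] at this,
    fun {s t r} h h' => by rw [← ratio_mul_ratio s t r, h, h', one_mul]⟩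

theorem equiv_iff {s t : Pairing d d' y x} : s ≈ t ↔ ratio s t = 1 := Iff.rfl

/-- The action of `P` and `Q`. -/
def act {y₁ y₂ : Y} {x₁ x₂ : X} (hy : G.proj y₁ = G.proj y₂) (hx : G'.proj x₁ = G'.proj x₂)
    (p : G.P.fiber ⟨(y₁, y₂), hy⟩) (s : Pairing d d' y₁ x₁) (q : G'.P.fiber ⟨(x₁, x₂), hx⟩) :
    Pairing d d' y₂ x₂ :=
  ⟨s.i, s.m, s.mem, s.hy.trans hy, s.hx.trans hx, G.mul s.hy hy s.p p, G'.mul s.hx hx s.q q⟩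

theorem ratio_act {y₁ y₂ : Y} {x₁ x₂ : X} (hy : G.proj y₁ = G.proj y₂)
    (hx : G'.proj x₁ = G'.proj x₂) (p : G.P.fiber ⟨(y₁, y₂), hy⟩) (s t : Pairing d d' y₁ x₁)
    (q : G'.P.fiber ⟨(x₁, x₂), hx⟩) : ratio (act hy hx p s q) (act hy hx p t q) = ratio s t :=
  congrArg₂ (fun a b => a * b⁻¹) (RealDDData.quot_mul_right hx q) (RealDDData.quot_mul_right hy p)

/-- The Real structure. -/
def conj {y' : Y} {x' : X} (ey : y' = G.tauY y) (ex : x' = G'.tauY x) (s : Pairing d d' y x) :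
    Pairing d d' y' x' where
  i := 𝒰.bar s.i
  m := τ s.m
  mem := 𝒰.tau_mem s.mem
  hy := by rw [ey, d.s_real s.mem, G.proj_tauY, G.proj_tauY, s.hy]
  hx := by rw [ex, d'.s_real s.mem, G'.proj_tauY, G'.proj_tauY, s.hx]
  p := G.tauP.tau ⟨(d.s s.i s.m, y), s.hy⟩ ⟨(d.s (𝒰.bar s.i) (τ s.m), y'), _⟩
    (Prod.ext (d.s_real s.mem) ey) s.p
  q := G'.tauP.tau ⟨(d'.s s.i s.m, x), s.hx⟩ ⟨(d'.s (𝒰.bar s.i) (τ s.m), x'), _⟩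
    (Prod.ext (d'.s_real s.mem) ex) s.q

theorem ratio_conj {y' : Y} {x' : X} (ey : y' = G.tauY y) (ex : x' = G'.tauY x)
    (s t : Pairing d d' y x) : ratio (conj ey ex s) (conj ey ex t) = (ratio s t)⁻¹ :=
  (congrArg₂ (fun a b => a * b⁻¹) (RealDDData.quot_tau ex _ _)
    (RealDDData.quot_tau ey _ _)).trans (mul_inv _ _).symm

theorem conj_smul {y' : Y} {x' : X} (ey : y' = G.tauY y) (ex : x' = G'.tauY x) (z : Circle)
    (s : Pairing d d' y x) : conj ey ex (z • s) = z⁻¹ • conj ey ex s :=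
  congrArg (fun q => ({ conj ey ex s with q := q } : Pairing d d' y' x'))
    (G'.tauP.tau_smul _ _ _ z s.q)

theorem conj_conj {y' : Y} {x' : X} (ey : y' = G.tauY y) (ex : x' = G'.tauY x)
    (ey' : y = G.tauY y') (ex' : x = G'.tauY x') (s : Pairing d d' y x) :
    conj ey' ex' (conj ey ex s) = s := by
  obtain ⟨i, m, hm, hy, hx, p, q⟩ := s
  -- Conjugating twice returns to the index and the point of the base only up to proved equalities,
  -- so both are generalised before substitution.
  have key : ∀ (j : 𝒰.ι) (n : M) (_ : j = i) (_ : n = m) (a : {q : Y × Y | G.proj q.1 = G.proj q.2})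
      (b : {q : X × X | G'.proj q.1 = G'.proj q.2}) (hm' : n ∈ 𝒰.U j)
      (hy' : G.proj (d.s j n) = G.proj y) (hx' : G'.proj (d'.s j n) = G'.proj x) (ea ea' eb eb'),
      (⟨j, n, hm', hy', hx', G.tauP.tau a ⟨(d.s j n, y), hy'⟩ ea'
        (G.tauP.tau ⟨(d.s i m, y), hy⟩ a ea p), G'.tauP.tau b ⟨(d'.s j n, x), hx'⟩ eb'
        (G'.tauP.tau ⟨(d'.s i m, x), hx⟩ b eb q)⟩ : Pairing d d' y x) =
        ⟨i, m, hm, hy, hx, p, q⟩ := by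
    rintro j n rfl rfl a b hm' hy' hx' ea ea' eb eb'
    rw [G.tauP.tau_tau, G'.tauP.tau_tau]
  exact key _ _ (𝒰.bar_bar i) (τ.invol m) _ _ _ _ _ _ _ _ _

theorem exists_pairing (d : RealDDData G 𝒰 g) (d' : RealDDData G' 𝒰 g) {y : Y} {x : X}
    (h : G.proj y = G'.proj x) : Nonempty (Pairing d d' y x) := by
  obtain ⟨i, hi⟩ := 𝒰.cover (G.proj y)
  exact ⟨⟨i, G.proj y, hi, d.proj_s hi, (d'.proj_s hi).trans h,
    G.P.sec ⟨(d.s i (G.proj y), y), d.proj_s hi⟩ _,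
    G'.P.sec ⟨(d'.s i (G.proj y), x), (d'.proj_s hi).trans h⟩ _⟩⟩

variable (d d')

/-- The fibre of the `U(1)`-bundle that compares two gerbes with the same cocycle. -/
def Fiber (y : Y) (x : X) := Quotient (Pairing.setoid d d' y x)

variable {d d'}

/-- The class of a point. -/
def Fiber.mk (s : Pairing d d' y x) : Fiber d d' y x := Quotient.mk _ s

instance : MulAction Circle (Fiber d d' y x) where
  smul z := Quotient.map (fun s => z • s) fun s t h => by
    rw [equiv_iff, ratio_smul_left, ratio_smul_right, equiv_iff.1 h, mul_one, inv_mul_cancel]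
  one_smul := by
    rintro ⟨s⟩
    exact congrArg Fiber.mk (one_smul Circle s)
  mul_smul := by
    rintro z z' ⟨s⟩
    exact congrArg Fiber.mk (mul_smul z z' s)

theorem smul_mk (z : Circle) (s : Pairing d d' y x) :
    z • Fiber.mk s = Fiber.mk (z • s) := rfl

/-- Equality of classes means ratio 1, and $z\cdot s$ has ratio $z^{-1}$ times the ratio of $s$. So
the ratio is the division map of the torsor. -/
theorem smul_mk_eq_iff {z : Circle} {s t : Pairing d d' y x} :
    z • Fiber.mk s = Fiber.mk t ↔ z = ratio s t := by
  rw [smul_mk]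
  refine Quotient.eq.trans ?_
  change ratio _ _ = 1 ↔ _
  rw [ratio_smul_left, inv_mul_eq_one]

theorem torsor (p q : Fiber d d' y x) : ∃! z : Circle, z • p = q := by
  obtain ⟨s⟩ := p
  obtain ⟨t⟩ := q
  exact ⟨ratio s t, smul_mk_eq_iff.2 rfl, fun z h => smul_mk_eq_iff.1 h⟩

/-- The action of `P` and `Q` on the fibres. -/
def Fiber.act {y₁ y₂ : Y} {x₁ x₂ : X} (hy : G.proj y₁ = G.proj y₂) (hx : G'.proj x₁ = G'.proj x₂)
    (p : G.P.fiber ⟨(y₁, y₂), hy⟩) (r : Fiber d d' y₁ x₁) (q : G'.P.fiber ⟨(x₁, x₂), hx⟩) :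
    Fiber d d' y₂ x₂ :=
  Quotient.map (fun s : Pairing d d' y₁ x₁ => Pairing.act hy hx p s q)
    (fun s t h => (ratio_act hy hx p s t q).trans h) r

/-- The Real structure on the fibres. -/
def Fiber.conj {y' : Y} {x' : X} (ey : y' = G.tauY y) (ex : x' = G'.tauY x) (r : Fiber d d' y x) :
    Fiber d d' y' x' :=
  Quotient.map (fun s : Pairing d d' y x => Pairing.conj ey ex s) (fun s t h => by
    rw [equiv_iff, ratio_conj, equiv_iff.1 h, inv_one]) r

theorem smul_left_equiv (s : Pairing d d' y x) (z : Circle) :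
    ({ s with p := z • s.p } : Pairing d d' y x) ≈ z⁻¹ • s := by
  rw [equiv_iff, ratio_smul_right, ratio]
  change z⁻¹ * (d'.quot s.mem s.mem s.hx s.hx s.q s.q *
    (d.quot s.mem s.mem s.hy s.hy (z • s.p) s.p)⁻¹) = 1
  rw [RealDDData.quot_smul_left, mul_inv, inv_inv, mul_left_comm, inv_mul_cancel_left]
  exact ratio_self s

theorem exists_smooth_ratio {y : T → Y} {x : T → X}
    (hy : ContMDiffOn J 𝓘(ℝ, EY) ∞ y A) (hx : ContMDiffOn J 𝓘(ℝ, EX) ∞ x A)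
    {i j : 𝒰.ι} {m m' : T → M} (hm : ContMDiffOn J 𝓘(ℝ, EM) ∞ m A)
    {hi : ∀ t ∈ A, m t ∈ 𝒰.U i} {hj : ∀ t ∈ A, m' t ∈ 𝒰.U j}
    {hp : ∀ t ∈ A, G.proj (d.s i (m t)) = G.proj (y t)}
    {hp' : ∀ t ∈ A, G.proj (d.s j (m' t)) = G.proj (y t)}
    {hq : ∀ t ∈ A, G'.proj (d'.s i (m t)) = G'.proj (x t)}
    {hq' : ∀ t ∈ A, G'.proj (d'.s j (m' t)) = G'.proj (x t)}
    {p : ∀ t (ht : t ∈ A), G.P.fiber ⟨(d.s i (m t), y t), hp t ht⟩}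
    {p' : ∀ t (ht : t ∈ A), G.P.fiber ⟨(d.s j (m' t), y t), hp' t ht⟩}
    {q : ∀ t (ht : t ∈ A), G'.P.fiber ⟨(d'.s i (m t), x t), hq t ht⟩}
    {q' : ∀ t (ht : t ∈ A), G'.P.fiber ⟨(d'.s j (m' t), x t), hq' t ht⟩}
    (hps : G.P.IsSmoothAlong J A (fun t => (d.s i (m t), y t)) hp p)
    (hps' : G.P.IsSmoothAlong J A (fun t => (d.s j (m' t), y t)) hp' p')
    (hqs : G'.P.IsSmoothAlong J A (fun t => (d'.s i (m t), x t)) hq q)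
    (hqs' : G'.P.IsSmoothAlong J A (fun t => (d'.s j (m' t), x t)) hq' q') :
    ∃ c : T → Circle, ContMDiffOn J 𝓘(ℝ, ℂ) ∞ (fun t => (c t : ℂ)) A ∧
      ∀ t ht, ratio (⟨i, m t, hi t ht, hp t ht, hq t ht, p t ht, q t ht⟩ : Pairing d d' (y t) (x t))
        ⟨j, m' t, hj t ht, hp' t ht, hq' t ht, p' t ht, q' t ht⟩ = c t := by
  obtain ⟨b, hb, hb'⟩ := RealDDData.exists_smooth_quot (hi := hi) (hj := hj) hm hy hps hps'
  obtain ⟨c, hc, hc'⟩ := RealDDData.exists_smooth_quot (hi := hi) (hj := hj) hm hx hqs hqs'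
  exact ⟨fun t => c t * (b t)⁻¹,
    fun t ht => contMDiffWithinAt_circle_mul (hc t ht) (contMDiffWithinAt_circle_inv (hb t ht)),
    fun t ht => congrArg₂ (fun a b => a * b⁻¹) (hc' t ht) (hb' t ht)⟩

end Pairing

end Comparison

/-! ### Smooth structure of the comparison bundle and the stable isomorphism -/

section ComparisonBundle

variable {EM : Type*} [NormedAddCommGroup EM] [NormedSpace ℝ EM]
  {M : Type u} [TopologicalSpace M] [ChartedSpace EM M]
  {EY : Type*} [NormedAddCommGroup EY] [NormedSpace ℝ EY]
  {Y : Type*} [TopologicalSpace Y] [ChartedSpace EY Y]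
  {EX : Type*} [NormedAddCommGroup EX] [NormedSpace ℝ EX]
  {X : Type*} [TopologicalSpace X] [ChartedSpace EX X]
  {τ : SmoothInvolution 𝓘(ℝ, EM) M}
  {E' H' : Type*} [NormedAddCommGroup E'] [NormedSpace ℝ E'] [TopologicalSpace H']
  {J : ModelWithCorners ℝ E' H'} {T : Type*} [TopologicalSpace T] [ChartedSpace H' T]
  {A : Set T}
  {G : RealBundleGerbe.{u, w} τ EY Y} {G' : RealBundleGerbe.{u, w'} τ EX X}
  {𝒰 : RealCover τ} {g : RealCocycle 𝒰}

/-- A member of the cover that contains a given point of the base. -/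
def RealCover.at (𝒰 : RealCover τ) (m : M) : 𝒰.ι := (𝒰.cover m).choose

theorem RealCover.mem_at (𝒰 : RealCover τ) (m : M) : m ∈ 𝒰.U (𝒰.at m) := (𝒰.cover m).choose_spec

namespace Pairing

variable (d : RealDDData G 𝒰 g) (d' : RealDDData G' 𝒰 g)

/-- The base point for the local section of `P` near the first component of `a`. -/
def baseP (a : {s : Y × X | G.proj s.1 = G'.proj s.2}) : {q : Y × Y | G.proj q.1 = G.proj q.2} :=
  ⟨(d.s (𝒰.at (G.proj a.1.1)) (G.proj a.1.1), a.1.1), d.proj_s (𝒰.mem_at _)⟩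

/-- The base point for the local section of `Q` near the second component of `a`. -/
def baseQ (a : {s : Y × X | G.proj s.1 = G'.proj s.2}) :
    {q : X × X | G'.proj q.1 = G'.proj q.2} :=
  ⟨(d'.s (𝒰.at (G.proj a.1.1)) (G.proj a.1.1), a.1.2), (d'.proj_s (𝒰.mem_at _)).trans a.2⟩

/-- The pairing of local sections of `P` and `Q`. -/
def localPairing (a : {s : Y × X | G.proj s.1 = G'.proj s.2}) {y : Y} {x : X} (h : G.proj y = G'.proj x)
    (hy : G.proj y ∈ 𝒰.U (𝒰.at (G.proj a.1.1))) : Pairing d d' y x where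
  i := 𝒰.at (G.proj a.1.1)
  m := G.proj y
  mem := hy
  hy := d.proj_s hy
  hx := (d'.proj_s hy).trans h
  p := G.P.sec (baseP d a) ⟨(_, y), d.proj_s hy⟩
  q := G'.P.sec (baseQ d' a) ⟨(_, x), (d'.proj_s hy).trans h⟩

open scoped Classical in
/-- The `U(1)`-bundle that compares two gerbes with the same cocycle, without its smoothness. -/
def preBundle : PreCircleBundle {s : Y × X | G.proj s.1 = G'.proj s.2} where
  fiber s := Fiber d d' s.1.1 s.1.2
  torsor _ := torsor
  dom a := {t | G.proj t.1 ∈ 𝒰.U (𝒰.at (G.proj a.1.1)) ∧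
    (d.s (𝒰.at (G.proj a.1.1)) (G.proj t.1), t.1) ∈ G.P.dom (baseP d a) ∧
    (d'.s (𝒰.at (G.proj a.1.1)) (G.proj t.1), t.2) ∈ G'.P.dom (baseQ d' a)}
  isOpen_dom a := by
    set i := 𝒰.at (G.proj a.1.1)
    have hG : Continuous (fun t : Y × X => G.proj t.1) :=
      G.proj_submersion.contMDiff.continuous.comp continuous_fst
    have hV : IsOpen {t : Y × X | G.proj t.1 ∈ 𝒰.U i} := (𝒰.isOpen i).preimage hG
    have h1 : ContinuousOn (fun t : Y × X => (d.s i (G.proj t.1), t.1))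
        {t : Y × X | G.proj t.1 ∈ 𝒰.U i} :=
      ((d.s_smooth i).continuousOn.comp hG.continuousOn fun _ h => h).prodMk continuousOn_fst
    have h2 : ContinuousOn (fun t : Y × X => (d'.s i (G.proj t.1), t.2))
        {t : Y × X | G.proj t.1 ∈ 𝒰.U i} :=
      ((d'.s_smooth i).continuousOn.comp hG.continuousOn fun _ h => h).prodMk continuousOn_snd
    convert (h1.isOpen_inter_preimage hV (G.P.isOpen_dom (baseP d a))).inter
      (h2.isOpen_inter_preimage hV (G'.P.isOpen_dom (baseQ d' a))) using 1
    ext t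
    exact ⟨fun h => ⟨⟨h.1, h.2.1⟩, h.1, h.2.2⟩, fun h => ⟨h.1.1, h.1.2, h.2.2⟩⟩
  mem_dom a := ⟨𝒰.mem_at _, G.P.mem_dom (baseP d a), G'.P.mem_dom (baseQ d' a)⟩
  -- A section must have values on the whole fibre product; off `dom a` they are irrelevant, and any
  -- class is taken where the local pairing is undefined.
  sec a s := if h : G.proj s.1.1 ∈ 𝒰.U (𝒰.at (G.proj a.1.1)) then Fiber.mk (localPairing d d' a s.2 h)
    else Fiber.mk (exists_pairing d d' s.2).some

variable {d d'}

theorem localPairing_isSmoothAlong {y : T → Y} {x : T → X} (hy : ContMDiffOn J 𝓘(ℝ, EY) ∞ y A)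
    (hx : ContMDiffOn J 𝓘(ℝ, EX) ∞ x A) (h : ∀ t ∈ A, G.proj (y t) = G'.proj (x t))
    {a : {s : Y × X | G.proj s.1 = G'.proj s.2}}
    (hd : ∀ t ∈ A, (y t, x t) ∈ (preBundle d d').dom a) :
    G.P.IsSmoothAlong J A (fun t => (d.s (𝒰.at (G.proj a.1.1)) (G.proj (y t)), y t))
      (fun t ht => d.proj_s (hd t ht).1) (fun t ht => (localPairing d d' a (h t ht) (hd t ht).1).p) ∧
    G'.P.IsSmoothAlong J A (fun t => (d'.s (𝒰.at (G.proj a.1.1)) (G.proj (y t)), x t))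
      (fun t ht => (d'.proj_s (hd t ht).1).trans (h t ht))
      (fun t ht => (localPairing d d' a (h t ht) (hd t ht).1).q) := by
  have hm : ContMDiffOn J 𝓘(ℝ, EM) ∞ (fun t => G.proj (y t)) A :=
    G.proj_submersion.contMDiff.comp_contMDiffOn hy
  have h1 := (d.s_smooth _).comp hm fun t ht => (hd t ht).1
  have h2 := (d'.s_smooth _).comp hm fun t ht => (hd t ht).1
  exact ⟨G.P.sec_isSmoothAlong (h1.prodMk hy) (fun t ht => d.proj_s (hd t ht).1) (baseP d a)
      fun t ht => (hd t ht).2.1,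
    G'.P.sec_isSmoothAlong (h2.prodMk hx) (fun t ht => (d'.proj_s (hd t ht).1).trans (h t ht))
      (baseQ d' a) fun t ht => (hd t ht).2.2⟩

/-- The coefficient against a local section is the ratio of two smooth representatives, possibly
with different indices of the cover, and such ratios are smooth. -/
theorem mk_isSmoothAlong {y : T → Y} {x : T → X}
    (hy : ContMDiffOn J 𝓘(ℝ, EY) ∞ y A) (hx : ContMDiffOn J 𝓘(ℝ, EX) ∞ x A)
    {hS : ∀ t ∈ A, G.proj (y t) = G'.proj (x t)} {i : 𝒰.ι} {m : T → M} {hi : ∀ t ∈ A, m t ∈ 𝒰.U i}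
    {hp : ∀ t ∈ A, G.proj (d.s i (m t)) = G.proj (y t)}
    {hq : ∀ t ∈ A, G'.proj (d'.s i (m t)) = G'.proj (x t)}
    {p : ∀ t (ht : t ∈ A), G.P.fiber ⟨(d.s i (m t), y t), hp t ht⟩}
    {q : ∀ t (ht : t ∈ A), G'.P.fiber ⟨(d'.s i (m t), x t), hq t ht⟩}
    (hps : G.P.IsSmoothAlong J A (fun t => (d.s i (m t), y t)) hp p)
    (hqs : G'.P.IsSmoothAlong J A (fun t => (d'.s i (m t), x t)) hq q) :
    (preBundle d d').IsSmoothAlong J A (fun t => (y t, x t)) hS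
      (fun t ht => Fiber.mk ⟨i, m t, hi t ht, hp t ht, hq t ht, p t ht, q t ht⟩) := by
  intro a t₀ ht₀ hd
  obtain ⟨U, hU, htU, hUd⟩ := exists_open_of_continuousOn (hy.prodMk hx).continuousOn
    ((preBundle d d').isOpen_dom a) ht₀ hd
  have hs : A ∩ U ⊆ A := Set.inter_subset_left
  have hmA : A ∩ U ∈ 𝓝[A] t₀ :=
    Filter.inter_mem self_mem_nhdsWithin (nhdsWithin_le_nhds (hU.mem_nhds htU))
  have hyU := hy.mono hs
  have hxU := hx.mono hs
  have hmU : ContMDiffOn J 𝓘(ℝ, EM) ∞ (fun t => G.proj (y t)) (A ∩ U) :=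
    G.proj_submersion.contMDiff.comp_contMDiffOn hyU
  have hl := localPairing_isSmoothAlong hyU hxU (fun t h => hS t h.1) hUd
  obtain ⟨c, hc, he⟩ := exists_smooth_ratio (d := d) (d' := d') hyU hxU hmU
    (hi := fun t h => (hUd t h).1) (hj := fun t h => hi t h.1) hl.1 (hps.mono hs) hl.2
    (hqs.mono hs)
  refine ⟨c, (hc t₀ ⟨ht₀, htU⟩).mono_of_mem_nhdsWithin hmA, ?_⟩
  filter_upwards [hmA] with t h hA
  refine Eq.trans ?_ (congrArg (c t • ·) (dif_pos (hUd t h).1)).symm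
  exact (smul_mk_eq_iff.2 (he t h).symm).symm

theorem sec_eq (a : {s : Y × X | G.proj s.1 = G'.proj s.2}) {y : Y} {x : X}
    (h : G.proj y = G'.proj x) (hd : (y, x) ∈ (preBundle d d').dom a) :
    (preBundle d d').sec a ⟨(y, x), h⟩ = Fiber.mk (localPairing d d' a h hd.1) := dif_pos hd.1

variable (d d') in
/-- The `U(1)`-bundle that compares two gerbes with the same cocycle. -/
def bundle : CircleBundle (𝓘(ℝ, EY).prod 𝓘(ℝ, EX)) {s : Y × X | G.proj s.1 = G'.proj s.2} where
  toPreCircleBundle := preBundle d d'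
  sec_smooth b := by
    have hl := localPairing_isSmoothAlong (d := d) (d' := d') (J := 𝓘(ℝ, EY).prod 𝓘(ℝ, EX))
      (A := {s : Y × X | G.proj s.1 = G'.proj s.2} ∩ (preBundle d d').dom b)
      contMDiffOn_fst contMDiffOn_snd (fun t ht => ht.1) (fun t ht => ht.2)
    exact (mk_isSmoothAlong contMDiffOn_fst contMDiffOn_snd hl.1 hl.2).congr
      fun t ht => sec_eq b ht.1 ht.2

variable (d d') in
/-- The Real structure of the comparison bundle. -/
def realStructure : (bundle d d').RealStructure (fun s => (G.tauY s.1, G'.tauY s.2)) where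
  maps s h := by
    change G.proj _ = G'.proj _
    rw [G.proj_tauY, G'.proj_tauY]
    exact congrArg τ h
  tau s s' e r := Fiber.conj (congrArg Prod.fst e) (congrArg Prod.snd e) r
  tau_smul s s' e z r := by
    obtain ⟨t⟩ := r
    exact congrArg Fiber.mk (conj_smul _ _ z t)
  tau_tau s s' e e' r := by
    obtain ⟨t⟩ := r
    exact congrArg Fiber.mk (conj_conj _ _ _ _ t)
  tau_smooth b := by
    set A := {s : Y × X | G.proj s.1 = G'.proj s.2} ∩ (bundle d d').dom b
    have hy : ContMDiffOn (𝓘(ℝ, EY).prod 𝓘(ℝ, EX)) 𝓘(ℝ, EY) ∞ (Prod.fst : Y × X → Y) A :=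
      contMDiffOn_fst
    have hx : ContMDiffOn (𝓘(ℝ, EY).prod 𝓘(ℝ, EX)) 𝓘(ℝ, EX) ∞ (Prod.snd : Y × X → X) A :=
      contMDiffOn_snd
    have hm : ContMDiffOn (𝓘(ℝ, EY).prod 𝓘(ℝ, EX)) 𝓘(ℝ, EM) ∞ (fun t : Y × X => G.proj t.1) A :=
      G.proj_submersion.contMDiff.comp_contMDiffOn hy
    have hl := localPairing_isSmoothAlong (d := d) (d' := d') hy hx (fun t ht => ht.1)
      (fun t ht => ht.2)
    have h1 := (d.s_smooth _).comp hm fun t ht => ht.2.1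
    have h2 := (d'.s_smooth _).comp hm fun t ht => ht.2.1
    -- The conjugated section lies naturally along the conjugate of $s_i$, but the conjugated
    -- pairing uses $s_{\bar i}(\tau m)$. These agree on `A` by equivariance of the sections.
    have hp := PreCircleBundle.IsSmoothAlong.congr_map (L := G.P.toPreCircleBundle)
      (f' := fun t : Y × X => (d.s (𝒰.bar (𝒰.at (G.proj b.1.1))) (τ (G.proj t.1)), G.tauY t.1))
      (fun (t : Y × X) (ht : t ∈ A) n hn e =>
      G.tauP.tau ⟨_, d.proj_s ht.2.1⟩ ⟨n, hn⟩ e (localPairing d d' b ht.1 ht.2.1).p)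
      (G.tauP.isSmoothAlong (h1.prodMk hy) hl.1) (fun t ht => Prod.ext (d.s_real ht.2.1) rfl)
      (hf' := fun t ht => (conj rfl rfl (localPairing d d' b ht.1 ht.2.1)).hy)
    have hq := PreCircleBundle.IsSmoothAlong.congr_map (L := G'.P.toPreCircleBundle)
      (f' := fun t : Y × X => (d'.s (𝒰.bar (𝒰.at (G.proj b.1.1))) (τ (G.proj t.1)), G'.tauY t.2))
      (fun (t : Y × X) (ht : t ∈ A) n hn e =>
      G'.tauP.tau ⟨_, (d'.proj_s ht.2.1).trans ht.1⟩ ⟨n, hn⟩ e (localPairing d d' b ht.1 ht.2.1).q)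
      (G'.tauP.isSmoothAlong (h2.prodMk hx) hl.2) (fun t ht => Prod.ext (d'.s_real ht.2.1) rfl)
      (hf' := fun t ht => (conj rfl rfl (localPairing d d' b ht.1 ht.2.1)).hx)
    refine (mk_isSmoothAlong (G.tauY.smooth.comp_contMDiffOn hy) (G'.tauY.smooth.comp_contMDiffOn hx)
      (hi := fun t ht => 𝒰.tau_mem ht.2.1) hp hq).congr fun t ht => ?_
    exact congrArg (Fiber.conj rfl rfl) (sec_eq b ht.1 ht.2)

end Pairing

open Pairing in
/-- Real bundle gerbes with the same cocycle are stably isomorphic. -/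
def RealDDData.toStableIso (d : RealDDData G 𝒰 g) (d' : RealDDData G' 𝒰 g) :
    RealStableIso.{u, w, w', max u w w'} G G' where
  R := bundle d d'
  tau := realStructure d d'
  act hy hx _ _ p r q := Fiber.act hy hx p r q
  act_smul_left hy hx _ _ z p r q := by
    obtain ⟨s⟩ := r
    -- A scalar in $P$ passes to its inverse in $Q$, which produces the contravariance.
    refine Eq.trans ?_ (Quotient.sound (smul_left_equiv (Pairing.act hy hx p s q) z))
    exact congrArg Fiber.mk (congrArg (fun p' => { Pairing.act hy hx p s q with p := p' })
      (G.mul_smul _ _ z s.p p))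
  act_smul_middle hy hx _ _ z p r q := by
    obtain ⟨s⟩ := r
    exact congrArg Fiber.mk (congrArg (fun q' => { Pairing.act hy hx p s q with q := q' })
      (G'.smul_mul _ _ z s.q q))
  act_smul_right hy hx _ _ z p r q := by
    obtain ⟨s⟩ := r
    exact congrArg Fiber.mk (congrArg (fun q' => { Pairing.act hy hx p s q with q := q' })
      (G'.mul_smul _ _ z s.q q))
  act_mul hy hy' hx hx' _ _ _ p p' r q q' := by
    obtain ⟨s⟩ := r
    exact congrArg Fiber.mk (congrArg₂
      (fun a b => { Pairing.act (hy.trans hy') (hx.trans hx') (G.mul hy hy' p p') s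
        (G'.mul hx hx' q q') with p := a, q := b })
      (G.mul_assoc s.hy hy hy' s.p p p').symm (G'.mul_assoc s.hx hx hx' s.q q q').symm)
  act_smooth a b c := by
    set A := {t : (Y × Y) × (X × X) | (G.proj t.1.1 = G.proj t.1.2 ∧
      G'.proj t.2.1 = G'.proj t.2.2 ∧ G.proj t.1.1 = G'.proj t.2.1 ∧
      G.proj t.1.2 = G'.proj t.2.2) ∧ t.1 ∈ G.P.dom a ∧ (t.1.1, t.2.1) ∈ (bundle d d').dom b ∧
      t.2 ∈ G'.P.dom c}
    have hyy : ContMDiffOn ((𝓘(ℝ, EY).prod 𝓘(ℝ, EY)).prod (𝓘(ℝ, EX).prod 𝓘(ℝ, EX)))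
      (𝓘(ℝ, EY).prod 𝓘(ℝ, EY)) ∞ (Prod.fst : (Y × Y) × (X × X) → Y × Y) A := contMDiffOn_fst
    have hxx : ContMDiffOn ((𝓘(ℝ, EY).prod 𝓘(ℝ, EY)).prod (𝓘(ℝ, EX).prod 𝓘(ℝ, EX)))
      (𝓘(ℝ, EX).prod 𝓘(ℝ, EX)) ∞ (Prod.snd : (Y × Y) × (X × X) → X × X) A := contMDiffOn_snd
    have hy₁ := contMDiff_fst.comp_contMDiffOn hyy
    have hy₂ := contMDiff_snd.comp_contMDiffOn hyy
    have hx₁ := contMDiff_fst.comp_contMDiffOn hxx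
    have hx₂ := contMDiff_snd.comp_contMDiffOn hxx
    have hm := G.proj_submersion.contMDiff.comp_contMDiffOn hy₁
    have hl := localPairing_isSmoothAlong (d := d) (d' := d') hy₁ hx₁ (fun t ht => ht.1.2.2.1)
      (fun t ht => ht.2.2.1)
    have h1 := (d.s_smooth _).comp hm fun t ht => ht.2.2.1.1
    have h2 := (d'.s_smooth _).comp hm fun t ht => ht.2.2.1.1
    have hp := G.mul_isSmoothAlong h1 hy₁ hy₂ hl.1
      (G.P.sec_isSmoothAlong hyy (fun t ht => ht.1.1) a fun t ht => ht.2.1)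
    have hq := G'.mul_isSmoothAlong h2 hx₁ hx₂ hl.2
      (G'.P.sec_isSmoothAlong hxx (fun t ht => ht.1.2.1) c fun t ht => ht.2.2.2)
    refine (mk_isSmoothAlong hy₂ hx₂ (hi := fun t ht => ht.2.2.1.1) hp hq).congr fun t ht => ?_
    exact congrArg (fun r => Fiber.act _ _ _ r _) (sec_eq b ht.1.2.2.1 ht.2.2.1)
  tau_act hy hx _ _ p r q := by
    obtain ⟨s⟩ := r
    exact congrArg Fiber.mk (congrArg₂
      (fun a b => { conj rfl rfl (Pairing.act hy hx p s q) with p := a, q := b })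
      (RealBundleGerbe.tau_mul' (d.s_real s.mem) rfl rfl s.hy hy _ _ s.p p)
      (RealBundleGerbe.tau_mul' (d'.s_real s.mem) rfl rfl s.hx hx _ _ s.q q))

/-- Real bundle gerbes with the same Real Dixmier-Douady class are stably isomorphic. -/
theorem HasRealDDClass.nonempty_stableIso {c : RealH2 τ} (h : HasRealDDClass G c)
    (h' : HasRealDDClass G' c) : Nonempty (RealStableIso.{u, w, w', max u w w'} G G') := by
  obtain ⟨𝒰, g, ⟨d⟩, rfl⟩ := h
  obtain ⟨𝒱, g', ⟨d'⟩, e⟩ := h'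
  obtain ⟨𝒲, r, s, e, he⟩ : Cohomologous ⟨𝒰, g⟩ ⟨𝒱, g'⟩ := Quotient.exact e
  -- Both sets of data are restricted to the common refinement. Rescaling the second by the cochain
  -- `e` gives it the restricted cocycle of the first.
  exact ⟨(d.refine r (.one 𝒲) (g.refine r) fun i j k m _ _ _ => by simp [RealCocycle.refine,
    RealCochain.one]).toStableIso (d'.refine s e (g.refine r) he)⟩

end ComparisonBundle

end RealGerbe

end

/-! ### The main theorem -/

theorem mainTheorem11
    {EM : Type*} [NormedAddCommGroup EM] [NormedSpace ℝ EM] [FiniteDimensional ℝ EM]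
    {M : Type u} [TopologicalSpace M] [ChartedSpace EM M] [IsManifold 𝓘(ℝ, EM) ∞ M]
    [T2Space M] [SecondCountableTopology M]
    (τ : RealGerbe.SmoothInvolution 𝓘(ℝ, EM) M)
    {EY : Type*} [NormedAddCommGroup EY] [NormedSpace ℝ EY]
    {Y : Type*} [TopologicalSpace Y] [ChartedSpace EY Y] [IsManifold 𝓘(ℝ, EY) ∞ Y]
    {EX : Type*} [NormedAddCommGroup EX] [NormedSpace ℝ EX]
    {X : Type*} [TopologicalSpace X] [ChartedSpace EX X] [IsManifold 𝓘(ℝ, EX) ∞ X]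
    (P : RealGerbe.RealBundleGerbe.{u, w} τ EY Y) (Q : RealGerbe.RealBundleGerbe.{u, w'} τ EX X)
    (k : ℕ∞) :
    -- a Real stable isomorphism induces an isomorphism of the semigroups of modules, and of `KR`-theory
    (∀ S : RealGerbe.RealStableIso.{u, w, w', u'} P Q,
      ∃ Φ : RealGerbe.Rmod.{u, w, v} k P ≃+ RealGerbe.Rmod.{u, w', v} k Q,
        (∀ (V : RealGerbe.RealModule.{u, w, v} k P) (W : RealGerbe.RealModule.{u, w', v} k Q),
          Φ (RealGerbe.Rmod.mk V) = RealGerbe.Rmod.mk W ↔ S.Induces V W) ∧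
        (CompactSpace M → ∃ Ψ : RealGerbe.KRbg.{u, w, v} k P ≃+ RealGerbe.KRbg.{u, w', v} k Q,
          ∀ a, Ψ (Algebra.GrothendieckAddGroup.of a) = Algebra.GrothendieckAddGroup.of (Φ a))) ∧
    -- a Real trivialisation induces an isomorphism with Real vector bundles, and with `KR(M)`
    (∀ S : RealGerbe.RealTrivialisation.{u, w, u'} P,
      ∃ Φ : RealGerbe.Rmod.{u, w, v} k P ≃+ RealGerbe.RVect.{v} k τ,
        (∀ (V : RealGerbe.RealModule.{u, w, v} k P) (W : RealGerbe.RealVectorBundle.{v} k τ),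
          Φ (RealGerbe.Rmod.mk V) = RealGerbe.RVect.mk W ↔ S.Induces V W) ∧
        (CompactSpace M → ∃ Ψ : RealGerbe.KRbg.{u, w, v} k P ≃+ RealGerbe.KR.{u, v} k τ,
          ∀ a, Ψ (Algebra.GrothendieckAddGroup.of a) = Algebra.GrothendieckAddGroup.of (Φ a))) ∧
    -- bundle gerbe `KR`-theory depends only on the Real Dixmier-Douady class
    (CompactSpace M → ∀ c : RealGerbe.RealH2 τ, RealGerbe.HasRealDDClass P c →
      RealGerbe.HasRealDDClass Q c →
        Nonempty (RealGerbe.KRbg.{u, w, v} k P ≃+ RealGerbe.KRbg.{u, w', v} k Q)) := by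
  refine ⟨fun S => ?_, fun S => ?_, fun _ c h h' => ?_⟩
  · obtain ⟨Φ, hΦ⟩ := S.exists_addEquiv k
    exact ⟨Φ, hΦ, fun _ => RealGerbe.exists_grothendieck_addEquiv Φ⟩
  · obtain ⟨Φ, hΦ⟩ := S.exists_addEquiv k
    exact ⟨Φ, hΦ, fun _ => RealGerbe.exists_grothendieck_addEquiv Φ⟩
  · obtain ⟨S⟩ := h.nonempty_stableIso h'
    obtain ⟨Φ, -⟩ := S.exists_addEquiv k
    obtain ⟨Ψ, -⟩ := RealGerbe.exists_grothendieck_addEquiv Φ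
    exact ⟨Ψ⟩
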